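/- **Second fundamental theorem for $\mathfrak{gl}(V)$.** Let $V, U, W$ be complex superspaces of superdimension $(n|m)$, $(k|l)$, $(p|q)$ with homogeneous bases $e_i$ ($i\in R_V$), $u_r$ ($r\in R_U$), $w_s$ ($s\in R_W$), where $R_V=\{1<\dots<n<\bar 1<\dots<\bar m\}$, $R_U=\{1<\dots<k<\bar 1<\dots<\bar l\}$, $R_W=\{1<\dots<p<\bar 1<\dots<\bar q\}$; unbarred indices are even, barred ones odd, and $p(\cdot)\in\{0,1\}$ denotes parity. Let $e_i^*$ be the left dual basis of $V^*$, and let $A=S^{\bullet}(U\otimes V\oplus V^*\otimes W)$ be the symmetric superalgebra (free supercommutative superalgebra), with generators $x_{ri}=u_r\otimes e_i$, $x^*_{is}=e_i^*\otimes w_s$, on which $\mathfrak{gl}(V)$ acts by superderivations. Let $A^{\mathfrak{gl}(V)}$ be the subalgebra of invariants; it contains the scalar products $(v_r^*,v_s)=\sum_{i\in R_V}x_{ri}x^*_{is}$. The ideal of relations between the scalar products is the kernel of the algebra homomorphism $$S^{\bullet}(U\otimes W)\to A^{\mathfrak{gl}(V)},\qquad z_{rs}=u_r\otimes w_s\mapsto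 (v_r^*,v_s).$$ Let $N=(n+1)(m+1)$, and let $t$ be any standard tableau of rectangular shape with $n+1$ rows and $m+1$ columns, i.e. a bijective filling of the cells by $1,\dots,N$, increasing along rows and down columns; let $R_t, C_t\subset\mathfrak S_N$ be its row and column stabilizers. A sequence $I=(i_1,\dots,i_N)$ of elements of $R_U$ or $R_W$ is *$t$-semistandard* if, after each entry $\alpha$ of $t$ is replaced by $i_\alpha$, the entries do not decrease along rows and down columns, the even entries strictly increase down columns, and the odd entries strictly increase along rows. For sequences $I$ in $R_U$ and $J$ in $R_W$ of length $N$ set $$Z(I,J)=(-1)^{\sum_{\alpha>\beta}p(i_\alpha)p(j_\beta)}\,z_{i_1j_1}z_{i_2j_2}\cdots z_{i_Nj_N},$$ let $(\sigma I)_\alpha=i_{\sigma^{-1}(\alpha)}$, let $c(I,\sigma)=\prod_{\alpha<\beta,\ \sigma(\alpha)>\sigma(\beta)}(-1)^{p(i_{\sigma(\alpha)})p(i_{\sigma(\beta)})}$ be the sign obtained when the product $x_{i_1}\cdots x_{i_N}$ of supercommuting variables of parities $p(i_\alpha)$ is reordered into $x_{i_{\sigma(1)}}\cdots x_{i_{\sigma(N)}}$,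 and put $$P_t(I,J)=\sum_{\sigma\in R_t,\ \tau\in C_t}\varepsilon(\tau)\,c\big(I,(\sigma\tau)^{-1}\big)\,Z(\sigma\tau I,J),$$ where $\varepsilon$ is the sign character. Then the ideal of relations between the scalar products is generated, as an ideal of $S^{\bullet}(U\otimes W)$, by the polynomials $P_t(I,J)$, where $I$ and $J$ run over the $t$-semistandard sequences with elements from $R_U$ and $R_W$, respectively. -/

import Mathlib

namespace SuperInv

/-! ### Free supercommutative superalgebras -/

/-- Supercommutation relations `x y = (-1)^{p(x) p(y)} y x` among generators with parities
`par : X → ℕ` (only the class mod 2 matters).  For an odd `x` this contains `x² = -x²`,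
i.e. `x² = 0` over `ℂ`. -/
inductive SuperRel {X : Type} (par : X → ℕ) : FreeAlgebra ℂ X → FreeAlgebra ℂ X → Prop
  | comm (x y : X) : SuperRel par (FreeAlgebra.ι ℂ x * FreeAlgebra.ι ℂ y)
      ((-1 : ℂ) ^ (par x * par y) • (FreeAlgebra.ι ℂ y * FreeAlgebra.ι ℂ x))

/-- The free supercommutative superalgebra over `ℂ` on a set `X` of generators with parities
`par`; equivalently, the symmetric algebra of the superspace with homogeneous basis `X`. -/
def SuperSym {X : Type} (par : X → ℕ) : Type := RingQuot (SuperRel par)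

namespace SuperSym

variable {X : Type} {par : X → ℕ}

noncomputable instance : Ring (SuperSym par) := inferInstanceAs (Ring (RingQuot (SuperRel par)))

noncomputable instance : Algebra ℂ (SuperSym par) :=
  inferInstanceAs (Algebra ℂ (RingQuot (SuperRel par)))

/-- The quotient map from the free associative algebra. -/
noncomputable def mk (par : X → ℕ) : FreeAlgebra ℂ X →ₐ[ℂ] SuperSym par :=
  RingQuot.mkAlgHom ℂ (SuperRel par)

theorem mk_surjective : Function.Surjective (mk par) :=
  RingQuot.mkAlgHom_surjective ℂ (SuperRel par)

/-- The generator of `SuperSym par` indexed by `x`. -/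
noncomputable def gen (par : X → ℕ) (x : X) : SuperSym par :=
  mk par (FreeAlgebra.ι ℂ x)

theorem gen_comm (x y : X) :
    gen par x * gen par y = (-1 : ℂ) ^ (par x * par y) • (gen par y * gen par x) := by
  have h : mk par _ = mk par _ := RingQuot.mkAlgHom_rel ℂ (SuperRel.comm (par := par) x y)
  rw [map_mul, map_smul, map_mul] at h
  exact h

/-- The universal property: values on generators that supercommute extend to a homomorphism. -/
noncomputable def lift {B : Type} [Ring B] [Algebra ℂ B] (f : X → B)
    (hf : ∀ x y, f x * f y = (-1 : ℂ) ^ (par x * par y) • (f y * f x)) :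
    SuperSym par →ₐ[ℂ] B :=
  RingQuot.liftAlgHom ℂ ⟨FreeAlgebra.lift ℂ f, by
    rintro _ _ ⟨x, y⟩
    simpa using hf x y⟩

@[simp]
theorem lift_gen {B : Type} [Ring B] [Algebra ℂ B] (f : X → B)
    (hf : ∀ x y, f x * f y = (-1 : ℂ) ^ (par x * par y) • (f y * f x)) (x : X) :
    lift f hf (gen par x) = f x := by
  exact (RingQuot.liftAlgHom_mkAlgHom_apply ℂ (FreeAlgebra.lift ℂ f) _ _).trans
    (FreeAlgebra.lift_ι_apply f x)

theorem hom_ext {B : Type} [Ring B] [Algebra ℂ B] {f g : SuperSym par →ₐ[ℂ] B}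
    (h : ∀ x, f (gen par x) = g (gen par x)) : f = g := by
  have e : f.comp (mk par) = g.comp (mk par) := FreeAlgebra.hom_ext (funext h)
  ext y
  obtain ⟨a, rfl⟩ := mk_surjective y
  exact DFunLike.congr_fun e a

/-- Compatibility of prescribed values `d` on the generators with the supercommutation
relations, for a superderivation of parity `ε`. -/
def DerCompat (par : X → ℕ) (ε : ℕ) (d : X → SuperSym par) : Prop :=
  ∀ x y, (-1 : ℂ) ^ (ε * par x) • (gen par x * d y) + d x * gen par y =
    (-1 : ℂ) ^ (par x * par y) •
      ((-1 : ℂ) ^ (ε * par y) • (gen par y * d x) + d y * gen par x)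

/-- The homomorphism `f ↦ [[γ^ε f, D f], [0, f]]`, with `γ` the parity automorphism and `D` the
superderivation of parity `ε` with values `d` on generators. -/
noncomputable def derHom (ε : ℕ) (d : X → SuperSym par) (hd : DerCompat par ε d) :
    SuperSym par →ₐ[ℂ] Matrix (Fin 2) (Fin 2) (SuperSym par) :=
  lift (fun x => !![(-1 : ℂ) ^ (ε * par x) • gen par x, d x; 0, gen par x]) (by
    intro x y
    have h1 := gen_comm (par := par) x y
    have h2 := hd x y
    ext i j
    fin_cases i <;> fin_cases j
    · simp only [Matrix.mul_apply, Fin.sum_univ_two]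
      simp [h1, smul_smul]
      congr 1
      ring
    · simpa [Matrix.mul_apply, Fin.sum_univ_two] using h2
    · simp [Matrix.mul_apply, Fin.sum_univ_two]
    · simpa [Matrix.mul_apply, Fin.sum_univ_two] using h1)

/-- The superderivation of parity `ε` of `SuperSym par` with value `d x` on the generator `x`:
the unique linear map `D` with `D (gen x) = d x` and
`D (f g) = (D f) g + (-1)^{ε p(f)} f (D g)`. -/
noncomputable def superDer (ε : ℕ) (d : X → SuperSym par) (hd : DerCompat par ε d) :
    SuperSym par →ₗ[ℂ] SuperSym par where
  toFun f := derHom ε d hd f 0 1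
  map_add' f g := by simp
  map_smul' c f := by simp

/-- The power `γ^ε` of the parity automorphism, `γ f = (-1)^{p(f)} f`. -/
noncomputable def parityAut (par : X → ℕ) (ε : ℕ) : SuperSym par →ₐ[ℂ] SuperSym par :=
  lift (fun x => (-1 : ℂ) ^ (ε * par x) • gen par x) (by
    intro x y
    simp [gen_comm (par := par) x y, smul_smul]
    congr 1
    ring)

theorem derHom_eq (ε : ℕ) (d : X → SuperSym par) (hd : DerCompat par ε d) (f : SuperSym par) :
    derHom ε d hd f = !![parityAut par ε f, superDer ε d hd f; 0, f] := by
  obtain ⟨a, rfl⟩ := mk_surjective f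
  induction a using FreeAlgebra.induction with
  | grade0 r =>
    rw [AlgHom.commutes]
    ext i j
    fin_cases i <;> fin_cases j <;>
      simp [superDer, Matrix.algebraMap_matrix_apply]
  | grade1 x =>
    have h : mk par (FreeAlgebra.ι ℂ x) = gen par x := rfl
    rw [h]
    ext i j
    fin_cases i <;> fin_cases j <;> simp [superDer, derHom, parityAut]
  | mul a b ha hb =>
    rw [map_mul]
    generalize mk par a = a at *
    generalize mk par b = b at *
    have e : derHom ε d hd (a * b) = !![parityAut par ε a, superDer ε d hd a; 0, a] *
        !![parityAut par ε b, superDer ε d hd b; 0, b] := by rw [map_mul, ha, hb]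
    have e' : superDer ε d hd (a * b) = _ := congrFun (congrFun e 0) 1
    rw [e', e]
    ext i j
    fin_cases i <;> fin_cases j <;> simp [Matrix.mul_apply, Fin.sum_univ_two]
  | add a b ha hb =>
    rw [map_add]
    generalize mk par a = a at *
    generalize mk par b = b at *
    rw [map_add, ha, hb]
    ext i j
    fin_cases i <;> fin_cases j <;> simp

@[simp]
theorem superDer_gen (ε : ℕ) (d : X → SuperSym par) (hd : DerCompat par ε d) (x : X) :
    superDer ε d hd (gen par x) = d x := by
  simp [superDer, derHom]

theorem superDer_mul (ε : ℕ) (d : X → SuperSym par) (hd : DerCompat par ε d)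
    (f g : SuperSym par) :
    superDer ε d hd (f * g) =
      parityAut par ε f * superDer ε d hd g + superDer ε d hd f * g := by
  have e : derHom ε d hd (f * g) = !![parityAut par ε f, superDer ε d hd f; 0, f] *
      !![parityAut par ε g, superDer ε d hd g; 0, g] := by
    rw [map_mul, derHom_eq ε d hd f, derHom_eq ε d hd g]
  have e' : superDer ε d hd (f * g) = _ := congrFun (congrFun e 0) 1
  rw [e']
  simp [Matrix.mul_apply, Fin.sum_univ_two]

theorem superDer_algebraMap (ε : ℕ) (d : X → SuperSym par) (hd : DerCompat par ε d) (c : ℂ) :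
    superDer ε d hd (algebraMap ℂ _ c) = 0 := by
  change derHom ε d hd (algebraMap ℂ _ c) 0 1 = 0
  rw [AlgHom.commutes]
  simp [Matrix.algebraMap_matrix_apply]

theorem parityAut_gen (ε : ℕ) (x : X) :
    parityAut par ε (gen par x) = (-1 : ℂ) ^ (ε * par x) • gen par x := by
  simp [parityAut]

theorem neg_one_pow_congr {a b : ℕ} (h : a % 2 = b % 2) : (-1 : ℂ) ^ a = (-1) ^ b := by
  rw [neg_one_pow_eq_pow_mod_two, h, ← neg_one_pow_eq_pow_mod_two]

/-- Values `d x` that are multiples of generators of parity `ε + p(x)` are compatible. -/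
theorem derCompat_of (ε : ℕ) (d : X → SuperSym par)
    (h : ∀ x, ∃ (c : ℂ) (y : X), d x = c • gen par y ∧ (c = 0 ∨ par y % 2 = (ε + par x) % 2)) :
    DerCompat par ε d := by
  have key : ∀ x y, gen par x * d y = (-1 : ℂ) ^ (par x * (ε + par y)) • (d y * gen par x) := by
    intro x y
    obtain ⟨c, w, hw, hc⟩ := h y
    rw [hw]
    rcases hc with rfl | hc
    · simp
    · have e : (-1 : ℂ) ^ (par x * par w) = (-1) ^ (par x * (ε + par y)) :=
        neg_one_pow_congr (by rw [Nat.mul_mod, hc, ← Nat.mul_mod])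
      rw [mul_smul_comm, gen_comm, e, smul_mul_assoc, smul_comm]
  intro x y
  rw [key x y, key y x, smul_add, smul_smul, smul_smul, smul_smul, ← pow_add, ← pow_add,
    ← pow_add, add_comm]
  congr 1
  · have e : par x * par y + ε * par y + par y * (ε + par x) =
        2 * (par x * par y + ε * par y) := by ring
    rw [e, pow_mul]
    simp
  · congr 1
    apply neg_one_pow_congr
    have e : ε * par x + par x * (ε + par y) = par x * par y + 2 * (ε * par x) := by ring
    rw [e]
    omega

end SuperSym

/-! ### Index sets, sequences, tableaux -/

/-- The index set `{1 < ⋯ < a < 1̄ < ⋯ < b̄}` of a homogeneous basis of a superspace of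
superdimension `(a | b)`, with its linear order. -/
abbrev Idx (a b : ℕ) : Type := Fin a ⊕ₗ Fin b

/-- The parity of an index: `0` on the first `a` indices, `1` on the last `b`. -/
def parity {a b : ℕ} (i : Idx a b) : ℕ := Sum.elim (fun _ => 0) (fun _ => 1) (ofLex i)

/-- A tableau of rectangular shape with `r` rows and `c` columns: a bijective filling of its cells
by the `r * c` entries. -/
abbrev RectTableau (r c : ℕ) : Type := Fin r × Fin c ≃ Fin (r * c)

namespace RectTableau

variable {r c : ℕ}

/-- Standard: the entries increase along rows and down columns. -/
def IsStandard (t : RectTableau r c) : Prop :=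
  (∀ i, StrictMono fun j => t (i, j)) ∧ (∀ j, StrictMono fun i => t (i, j))

/-- The row stabilizer `R_t`. -/
def rowStab (t : RectTableau r c) : Finset (Equiv.Perm (Fin (r * c))) :=
  {σ | ∀ x, (t.symm (σ x)).1 = (t.symm x).1}

/-- The column stabilizer `C_t`. -/
def colStab (t : RectTableau r c) : Finset (Equiv.Perm (Fin (r * c))) :=
  {σ | ∀ x, (t.symm (σ x)).2 = (t.symm x).2}

/-- `I` is `t`-semistandard: after replacing each entry `α` of `t` by `I α`, the entries do not
decrease along rows and down columns, even entries strictly increase down columns, and odd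
entries strictly increase along rows. -/
def IsSemistandard {a b : ℕ} (t : RectTableau r c) (I : Fin (r * c) → Idx a b) : Prop :=
  (∀ i, Monotone fun j => I (t (i, j))) ∧
  (∀ j, Monotone fun i => I (t (i, j))) ∧
  (∀ j i i', i < i' → parity (I (t (i, j))) = 0 → parity (I (t (i', j))) = 0 →
    I (t (i, j)) < I (t (i', j))) ∧
  (∀ i j j', j < j' → parity (I (t (i, j))) = 1 → parity (I (t (i, j'))) = 1 →
    I (t (i, j)) < I (t (i, j')))

end RectTableau

/-- The action of the symmetric group on sequences: `(σ I)_α = I_{σ⁻¹ α}`. -/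
def permSeq {N : ℕ} {Y : Type} (σ : Equiv.Perm (Fin N)) (I : Fin N → Y) : Fin N → Y :=
  fun α => I (σ⁻¹ α)

/-- The sign `c(I, σ)` with `c(I, σ) x_I = x_{σ⁻¹ I}`, where `x_I = x_{i₁} ⋯ x_{i_N}` is a product
of supercommuting variables of parities `p(i_α)`: every pair of odd factors whose order is
reversed in passing from `x_I` to `x_{σ⁻¹ I} = x_{i_{σ 1}} ⋯ x_{i_{σ N}}` contributes `-1`. -/
def cSign {N a b : ℕ} (I : Fin N → Idx a b) (σ : Equiv.Perm (Fin N)) : ℂ :=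
  ∏ α : Fin N, ∏ β : Fin N,
    if α < β ∧ σ β < σ α then (-1 : ℂ) ^ (parity (I (σ α)) * parity (I (σ β))) else 1

/-! ### The algebra `S(U ⊗ W)` and the polynomials `P_t(I, J)` -/

section SUW

variable (k l p q : ℕ)

/-- Parities of the generators `z_{rs} = u_r ⊗ w_s` of `S(U ⊗ W)`. -/
def zPar : Idx k l × Idx p q → ℕ := fun x => parity x.1 + parity x.2

/-- The symmetric superalgebra `S(U ⊗ W)`, where `dim U = (k | l)` and `dim W = (p | q)`. -/
abbrev SUW : Type := SuperSym (zPar k l p q)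

variable {k l p q}

/-- The generator `z_{rs} = u_r ⊗ w_s`. -/
noncomputable def zGen (r : Idx k l) (s : Idx p q) : SUW k l p q :=
  SuperSym.gen (zPar k l p q) (r, s)

/-- `Z(I, J) = (-1)^{∑_{α > β} p(i_α) p(j_β)} z_{i₁ j₁} z_{i₂ j₂} ⋯ z_{i_N j_N}`. -/
noncomputable def Z {N : ℕ} (I : Fin N → Idx k l) (J : Fin N → Idx p q) : SUW k l p q :=
  (-1 : ℂ) ^ (∑ α : Fin N, ∑ β : Fin N, if β < α then parity (I α) * parity (J β) else 0) •
    (List.ofFn fun α => zGen (I α) (J α)).prod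

/-- The super-determinantal polynomial
`P_t(I, J) = ∑_{σ ∈ R_t, τ ∈ C_t} ε(τ) c(I, (στ)⁻¹) Z(στ I, J)`. -/
noncomputable def P {r c : ℕ} (t : RectTableau r c) (I : Fin (r * c) → Idx k l)
    (J : Fin (r * c) → Idx p q) : SUW k l p q :=
  ∑ σ ∈ t.rowStab, ∑ τ ∈ t.colStab,
    (((Equiv.Perm.sign τ : ℤ) : ℂ) * cSign I (σ * τ)⁻¹) • Z (permSeq (σ * τ) I) J

end SUW

/-! ### The algebra `A = S(U ⊗ V ⊕ V* ⊗ W)`, its `gl(V)`-action and the scalar products -/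

section Invariants

variable (n m k l p q : ℕ)

/-- Parities of the generators `x_{ri} = u_r ⊗ e_i` and `x*_{is} = e_i* ⊗ w_s` of `A`. -/
def aPar : (Idx k l × Idx n m) ⊕ (Idx n m × Idx p q) → ℕ :=
  Sum.elim (fun x => parity x.1 + parity x.2) (fun x => parity x.1 + parity x.2)

/-- `A = S(U ⊗ V ⊕ V* ⊗ W)`, where `dim V = (n | m)`, `dim U = (k | l)`, `dim W = (p | q)`. -/
abbrev Alg : Type := SuperSym (aPar n m k l p q)

variable {n m k l p q}

/-- The generator `x_{ri} = u_r ⊗ e_i`. -/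
noncomputable def xGen (r : Idx k l) (i : Idx n m) : Alg n m k l p q :=
  SuperSym.gen (aPar n m k l p q) (Sum.inl (r, i))

/-- The generator `x*_{is} = e_i* ⊗ w_s`, with `e_i*` the left dual basis. -/
noncomputable def xStar (i : Idx n m) (s : Idx p q) : Alg n m k l p q :=
  SuperSym.gen (aPar n m k l p q) (Sum.inr (i, s))

/-- The action of the matrix unit `E_{ab} ∈ gl(V)`, of parity `p(a) + p(b)`, on the generators.
Since `E_{ab} e_i = δ_{bi} e_a` and `(E f)(v) = -(-1)^{p(E) p(f)} f(E v)` on `V*`, one has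
`E_{ab} (u_r ⊗ e_i) = (-1)^{p(E_{ab}) p(r)} δ_{bi} u_r ⊗ e_a` and
`E_{ab} (e_i* ⊗ w_s) = -(-1)^{p(E_{ab}) p(i)} δ_{ai} e_b* ⊗ w_s`. -/
noncomputable def glGen (a b : Idx n m) :
    (Idx k l × Idx n m) ⊕ (Idx n m × Idx p q) → Alg n m k l p q :=
  Sum.elim
    (fun y => if y.2 = b then (-1 : ℂ) ^ ((parity a + parity b) * parity y.1) • xGen y.1 a else 0)
    (fun y => if y.1 = a then
      -((-1 : ℂ) ^ ((parity a + parity b) * parity y.1) • xStar b y.2) else 0)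

theorem glGen_compat (a b : Idx n m) :
    SuperSym.DerCompat (aPar n m k l p q) (parity a + parity b) (glGen a b) := by
  apply SuperSym.derCompat_of
  rintro (⟨r, i⟩ | ⟨i, s⟩)
  · by_cases h : i = b
    · refine ⟨_, Sum.inl (r, a), by simp [glGen, h, xGen]; rfl, Or.inr ?_⟩
      subst h
      simp only [aPar, Sum.elim_inl]
      omega
    · exact ⟨0, Sum.inl (r, a), by simp [glGen, h], Or.inl rfl⟩
  · by_cases h : i = a
    · refine ⟨-(-1) ^ ((parity a + parity b) * parity i), Sum.inr (b, s),
        by simp [glGen, h, xStar, neg_smul], Or.inr ?_⟩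
      subst h
      simp only [aPar, Sum.elim_inr]
      omega
    · exact ⟨0, Sum.inr (b, s), by simp [glGen, h], Or.inl rfl⟩

/-- The action of the matrix unit `E_{ab} ∈ gl(V)` on `A`, as a superderivation of parity
`p(a) + p(b)`. -/
noncomputable def glUnit (a b : Idx n m) : Alg n m k l p q →ₗ[ℂ] Alg n m k l p q :=
  SuperSym.superDer (parity a + parity b) (glGen a b) (glGen_compat a b)

/-- The action of `T = ∑ T_{ab} E_{ab} ∈ gl(V)` on `A`. -/
noncomputable def glAction (T : Matrix (Idx n m) (Idx n m) ℂ) :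
    Alg n m k l p q →ₗ[ℂ] Alg n m k l p q :=
  ∑ a, ∑ b, T a b • glUnit a b

theorem glAction_single (a b : Idx n m) (f : Alg n m k l p q) :
    glAction (Matrix.single a b 1) f = glUnit a b f := by
  simp [glAction, Matrix.single_apply, ite_and]

theorem forall_glAction_iff (f : Alg n m k l p q) :
    (∀ T : Matrix (Idx n m) (Idx n m) ℂ, glAction T f = 0) ↔
      ∀ a b : Idx n m, glUnit a b f = 0 := by
  constructor
  · intro h a b
    rw [← glAction_single]
    exact h _
  · intro h T
    simp [glAction, h]

variable (n m k l p q)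

/-- The subalgebra `A^{gl(V)}` of `gl(V)`-invariant elements. -/
noncomputable def glInvariants : Subalgebra ℂ (Alg n m k l p q) where
  carrier := {f | ∀ T : Matrix (Idx n m) (Idx n m) ℂ, glAction T f = 0}
  mul_mem' := by
    intro f g hf hg
    simp only [Set.mem_ofPred_eq, forall_glAction_iff] at *
    intro a b
    have h := SuperSym.superDer_mul _ _ (glGen_compat (k := k) (l := l) (p := p) (q := q) a b) f g
    change glUnit a b (f * g) = _ * glUnit a b g + glUnit a b f * g at h
    rw [h, hf, hg]
    simp
  add_mem' := by
    intro f g hf hg T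
    rw [map_add, hf T, hg T, add_zero]
  algebraMap_mem' := by
    intro c
    simp only [Set.mem_ofPred_eq, forall_glAction_iff]
    intro a b
    exact SuperSym.superDer_algebraMap _ _ _ c

variable {n m k l p q}

/-- The scalar product `(v_r*, v_s) = ∑_i x_{ri} x*_{is}`. -/
noncomputable def scalarProd (r : Idx k l) (s : Idx p q) : Alg n m k l p q :=
  ∑ i : Idx n m, xGen r i * xStar i s

theorem scalarProd_mem (r : Idx k l) (s : Idx p q) :
    (scalarProd r s : Alg n m k l p q) ∈ glInvariants n m k l p q := by
  refine (forall_glAction_iff _).2 fun a b => ?_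
  have h1 : ∀ i : Idx n m, glUnit a b (xGen r i * xStar i s : Alg n m k l p q) =
      (if i = a then -((-1 : ℂ) ^ ((parity a + parity b) * parity r) •
        (xGen r a * xStar b s)) else 0) +
      (if i = b then (-1 : ℂ) ^ ((parity a + parity b) * parity r) •
        (xGen r a * xStar b s) else 0) := by
    intro i
    rw [glUnit, SuperSym.superDer_mul]
    have g1 : SuperSym.parityAut (aPar n m k l p q) (parity a + parity b) (xGen r i) =
        (-1 : ℂ) ^ ((parity a + parity b) * (parity r + parity i)) • xGen r i :=
      SuperSym.parityAut_gen _ _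
    have g2 : SuperSym.superDer (parity a + parity b) (glGen a b) (glGen_compat a b)
        (xStar i s : Alg n m k l p q) = if i = a then
          -((-1 : ℂ) ^ ((parity a + parity b) * parity i) • xStar b s) else 0 :=
      SuperSym.superDer_gen _ _ _ _
    have g3 : SuperSym.superDer (parity a + parity b) (glGen a b) (glGen_compat a b)
        (xGen r i : Alg n m k l p q) = if i = b then
          (-1 : ℂ) ^ ((parity a + parity b) * parity r) • xGen r a else 0 :=
      SuperSym.superDer_gen _ _ _ _
    rw [g1, g2, g3]
    congr 1
    · split_ifs with h
      · subst h
        rw [mul_neg, mul_smul_comm, smul_mul_assoc, smul_smul, ← pow_add]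
        congr 2
        apply SuperSym.neg_one_pow_congr
        have e : (parity i + parity b) * parity i + (parity i + parity b) * (parity r + parity i) =
          (parity i + parity b) * parity r + 2 * ((parity i + parity b) * parity i) := by ring
        rw [e]
        omega
      · simp
    · split_ifs with h
      · rw [smul_mul_assoc, h]
      · simp
  simp only [scalarProd, map_sum, h1, Finset.sum_add_distrib, Finset.sum_ite_eq',
    Finset.mem_univ, if_true, neg_add_cancel]

theorem scalarProd_comm (r r' : Idx k l) (s s' : Idx p q) :
    (scalarProd r s * scalarProd r' s' : Alg n m k l p q) =
      (-1 : ℂ) ^ ((parity r + parity s) * (parity r' + parity s')) •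
        (scalarProd r' s' * scalarProd r s) := by
  simp only [scalarProd, Finset.sum_mul_sum, Finset.smul_sum]
  rw [Finset.sum_comm]
  refine Finset.sum_congr rfl fun j _ => Finset.sum_congr rfl fun i _ => ?_
  have c1 : (xStar i s * xGen r' j : Alg n m k l p q) =
      (-1 : ℂ) ^ ((parity i + parity s) * (parity r' + parity j)) • (xGen r' j * xStar i s) :=
    SuperSym.gen_comm _ _
  have c2 : (xStar i s * xStar j s' : Alg n m k l p q) =
      (-1 : ℂ) ^ ((parity i + parity s) * (parity j + parity s')) • (xStar j s' * xStar i s) :=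
    SuperSym.gen_comm _ _
  have c3 : (xGen r i * xGen r' j : Alg n m k l p q) =
      (-1 : ℂ) ^ ((parity r + parity i) * (parity r' + parity j)) • (xGen r' j * xGen r i) :=
    SuperSym.gen_comm _ _
  have c4 : (xGen r i * xStar j s' : Alg n m k l p q) =
      (-1 : ℂ) ^ ((parity r + parity i) * (parity j + parity s')) • (xStar j s' * xGen r i) :=
    SuperSym.gen_comm _ _
  have e : ((xGen r i * xStar i s) * (xGen r' j * xStar j s') : Alg n m k l p q) =
      xGen r i * (xStar i s * xGen r' j) * xStar j s' := by simp only [mul_assoc]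
  have e2 : (xGen r i * (xGen r' j * xStar i s) * xStar j s' : Alg n m k l p q) =
      (xGen r i * xGen r' j) * (xStar i s * xStar j s') := by simp only [mul_assoc]
  have e3 : ((xGen r' j * xGen r i) * (xStar j s' * xStar i s) : Alg n m k l p q) =
      xGen r' j * (xGen r i * xStar j s') * xStar i s := by simp only [mul_assoc]
  rw [e, c1, mul_smul_comm, smul_mul_assoc, e2, c2, c3, smul_mul_smul_comm, e3, c4,
    mul_smul_comm, smul_mul_assoc, smul_smul, smul_smul, ← pow_add, ← pow_add, ← pow_add]
  simp only [mul_assoc]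
  congr 1
  apply SuperSym.neg_one_pow_congr
  apply (Nat.modEq_iff_dvd (n := 2)).2
  refine ⟨-((parity i : ℤ) * parity r' + parity s * parity j + parity i * parity j * 2
    + parity i * parity s' + parity r * parity j), ?_⟩
  push_cast
  ring

variable (n m k l p q)

/-- The homomorphism `S(U ⊗ W) → A^{gl(V)}`, `u_r ⊗ w_s ↦ (v_r*, v_s)`. -/
noncomputable def scalarProdHom : SUW k l p q →ₐ[ℂ] glInvariants n m k l p q :=
  SuperSym.lift (par := zPar k l p q)
    (fun y => (⟨scalarProd y.1 y.2, scalarProd_mem y.1 y.2⟩ : glInvariants n m k l p q)) (by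
    intro y w
    exact Subtype.ext (scalarProd_comm y.1 w.1 y.2 w.2))

end Invariants

end SuperInv

/-! The argument takes place in the group algebra `PermAlg d` of the symmetric group, separately in
each degree `d`. With the sign built into `Z I J`, permuting both sequences simultaneously
multiplies `Z I J` by the two Koszul signs (`Z_comp_perm`). The image of `Z I J` in `A` is a signed
sum, over sequences `K` of indices of `V`, of products `xMon I K * xStarMon K J` (`prodHom_Z`).
Hence a group algebra element acting on `I` can be moved to an action on `K` (`prodHom_signedAct`).

The polynomials are relations: `P t I J` is the Young symmetrizer of the rectangle acting on `I`
(`P_eq_signedAct`). Once it is moved to `K`, the Garnir relations straighten any filling into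
semistandard ones (`IsGarnir.mem_span`), and an `(n+1) × (m+1)` rectangle has no semistandard
filling by indices of `V` (`not_isSemistandard`). So the image vanishes.

Every relation comes from them: take a relation of degree `d` and average its coefficients over
simultaneous permutations. Comparing the coefficients of the monomials in `A` shows that the signed
stabilizer sum `hookSum K` annihilates these coefficients for every `K`
(`signedAct_avgCoeff_hookSum_eq_zero`). By the hook theorem `span_hookGenerators`, these sums
together with the Young symmetrizer of the rectangle generate `PermAlg d` as a two-sided ideal. The
relation is, up to the factor `d!`, the value at `1` of the linear map `relationSum`. Writing `1`
through the generators, the hook terms contribute zero, and the rectangle terms contribute multiples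
of some `P t I J`. Straightening in `I` and then in `J` reduces to semistandard sequences.

The hook theorem: if the ideal were proper, Maschke's theorem would give a nonzero complementary
left ideal, annihilated by all generators. Some Young symmetrizer does not annihilate it
(`exists_youngSymmetrizer_ne_zero`). If its diagram contains the rectangle, the rectangle's
symmetrizer can be absorbed into it. Otherwise the diagram lies in the hook with `n` rows and `m`
columns; labelling cells by their row in the first `n` rows and by their column below gives a `K`
whose `hookSum K` is absorbed. Either way a nonzero multiple of the Young symmetrizer would vanish
on the complement. No classification of irreducible representations is needed: the required Young
symmetrizer is found by a highest weight argument, maximizing the sum of the squares of the row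
lengths. -/

namespace SuperInv

/-! ### Koszul signs -/

/-- The product of `D α β` over all pairs `β < α`. -/
noncomputable def pairProd {N : ℕ} (D : Fin N → Fin N → ℂ) : ℂ :=
  ∏ α : Fin N, ∏ β : Fin N, if β < α then D α β else 1

theorem pairProd_mul {N : ℕ} (D E : Fin N → Fin N → ℂ) :
    pairProd D * pairProd E = pairProd fun α β => D α β * E α β := by
  simp only [pairProd, ← Finset.prod_mul_distrib]
  refine Finset.prod_congr rfl fun α _ => Finset.prod_congr rfl fun β _ => ?_
  split_ifs <;> simp

theorem pairProd_congr {N : ℕ} {D E : Fin N → Fin N → ℂ} (h : ∀ α β, β < α → D α β = E α β) :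
    pairProd D = pairProd E := by
  refine Finset.prod_congr rfl fun α _ => Finset.prod_congr rfl fun β _ => ?_
  split_ifs with hl
  · exact h _ _ hl
  · rfl

/-- A symmetric `D` is a function on unordered pairs, which `σ` merely permutes; the two maps below
re-sort each image pair. -/
theorem pairProd_comp_perm {N : ℕ} (D : Fin N → Fin N → ℂ) (hD : ∀ α β, D α β = D β α)
    (σ : Equiv.Perm (Fin N)) : pairProd (fun α β => D (σ α) (σ β)) = pairProd D := by
  have key : ∀ E : Fin N → Fin N → ℂ, pairProd E =
      ∏ x : Fin N × Fin N with x.2 < x.1, E x.1 x.2 := by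
    intro E
    rw [Finset.prod_filter, Fintype.prod_prod_type]
    rfl
  rw [key, key]
  refine Finset.prod_nbij'
    (fun x => if σ x.2 < σ x.1 then (σ x.1, σ x.2) else (σ x.2, σ x.1))
    (fun x => if σ⁻¹ x.2 < σ⁻¹ x.1 then (σ⁻¹ x.1, σ⁻¹ x.2) else (σ⁻¹ x.2, σ⁻¹ x.1)) ?_ ?_ ?_ ?_ ?_
  · rintro ⟨a, b⟩ h
    simp only [Finset.mem_filter, Finset.mem_univ, true_and] at h ⊢
    split_ifs with h1
    · exact h1
    · exact lt_of_le_of_ne (not_lt.1 h1) fun e => h.ne' (σ.injective e)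
  · rintro ⟨a, b⟩ h
    simp only [Finset.mem_filter, Finset.mem_univ, true_and] at h ⊢
    split_ifs with h1
    · exact h1
    · exact lt_of_le_of_ne (not_lt.1 h1) fun e => h.ne' (σ⁻¹.injective e)
  · rintro ⟨a, b⟩ h
    simp only [Finset.mem_filter, Finset.mem_univ, true_and] at h ⊢
    split_ifs with h1 <;> simp_all [not_lt_of_gt]
  · rintro ⟨a, b⟩ h
    simp only [Finset.mem_filter, Finset.mem_univ, true_and] at h ⊢
    split_ifs with h1 <;> simp_all [not_lt_of_gt]
  · rintro ⟨a, b⟩ h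
    dsimp only
    split_ifs
    · rfl
    · exact hD _ _

/-- The sign with which a product of supercommuting variables of parities `p α` is reordered
by `σ`. -/
noncomputable def koszul {N : ℕ} (p : Fin N → ℕ) (σ : Equiv.Perm (Fin N)) : ℂ :=
  ∏ α : Fin N, ∏ β : Fin N,
    if α < β ∧ σ β < σ α then (-1 : ℂ) ^ (p (σ α) * p (σ β)) else 1

theorem koszul_eq_pairProd {N : ℕ} (p : Fin N → ℕ) (σ : Equiv.Perm (Fin N)) :
    koszul p σ = pairProd fun α β =>
      if (α < β ↔ σ α < σ β) then 1 else (-1 : ℂ) ^ (p (σ α) * p (σ β)) := by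
  rw [koszul, Finset.prod_comm]
  refine Finset.prod_congr rfl fun α _ => Finset.prod_congr rfl fun β _ => ?_
  by_cases h : β < α
  · simp only [h, true_and, not_lt_of_gt h, false_iff, if_true, ite_not]
    rw [mul_comm]
  · simp [h]

theorem neg_one_pow_mul_self (a : ℕ) : (-1 : ℂ) ^ a * (-1) ^ a = 1 := by
  rw [← mul_pow]; simp

/-- A pair is inverted by the product exactly when one of the two factors inverts it; if both do,
its sign occurs twice and cancels. This cocycle identity is what makes the signed permutation of
sequences an action. -/
theorem koszul_mul {N : ℕ} (p : Fin N → ℕ) (σ τ : Equiv.Perm (Fin N)) :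
    koszul p (σ * τ) = koszul p σ * koszul (p ∘ σ) τ := by
  rw [koszul_eq_pairProd, koszul_eq_pairProd, koszul_eq_pairProd,
    ← pairProd_comp_perm (fun α β => if (α < β ↔ σ α < σ β) then 1 else
      (-1 : ℂ) ^ (p (σ α) * p (σ β))) _ τ, pairProd_mul]
  · refine pairProd_congr fun α β _ => ?_
    simp only [Equiv.Perm.mul_apply, Function.comp_apply]
    by_cases h1 : α < β <;> by_cases h2 : τ α < τ β <;> by_cases h3 : σ (τ α) < σ (τ β) <;>
      simp [h1, h2, h3, neg_one_pow_mul_self]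
  · intro α β
    rcases lt_trichotomy α β with h | rfl | h
    · have h' : σ α ≠ σ β := fun e => h.ne (σ.injective e)
      rcases lt_or_gt_of_ne h' with h2 | h2 <;>
        simp [h, h2, not_lt_of_gt, mul_comm]
    · rfl
    · have h' : σ α ≠ σ β := fun e => h.ne' (σ.injective e)
      rcases lt_or_gt_of_ne h' with h2 | h2 <;>
        simp [h, h2, not_lt_of_gt, mul_comm]

@[simp]
theorem koszul_one {N : ℕ} (p : Fin N → ℕ) : koszul p 1 = 1 := by
  simp [koszul_eq_pairProd, pairProd]

theorem koszul_mul_self {N : ℕ} (p : Fin N → ℕ) (σ : Equiv.Perm (Fin N)) :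
    koszul p σ * koszul p σ = 1 := by
  rw [koszul_eq_pairProd, pairProd_mul]
  refine Finset.prod_eq_one fun α _ => Finset.prod_eq_one fun β _ => ?_
  by_cases h : (α < β ↔ σ α < σ β) <;> simp [h, neg_one_pow_mul_self]

theorem koszul_ne_zero {N : ℕ} (p : Fin N → ℕ) (σ : Equiv.Perm (Fin N)) : koszul p σ ≠ 0 :=
  left_ne_zero_of_mul (koszul_mul_self p σ ▸ one_ne_zero)

/-- If `koszul p σ * x = y` then `x = koszul p σ * y`. -/
theorem koszul_inv {N : ℕ} (p : Fin N → ℕ) (σ : Equiv.Perm (Fin N)) :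
    koszul (p ∘ σ) σ⁻¹ = koszul p σ := by
  have h := koszul_mul p σ σ⁻¹
  rw [mul_inv_cancel, koszul_one] at h
  calc koszul (p ∘ σ) σ⁻¹ = (koszul p σ * koszul p σ) * koszul (p ∘ σ) σ⁻¹ := by
        rw [koszul_mul_self, one_mul]
    _ = koszul p σ := by rw [mul_assoc, ← h, mul_one]

/-- The sign `(-1)^{∑_{β < α} p_α q_β}` of unshuffling. -/
noncomputable def interSign {N : ℕ} (p q : Fin N → ℕ) : ℂ :=
  pairProd fun α β => (-1 : ℂ) ^ (p α * q β)

theorem interSign_eq_pow {N : ℕ} (p q : Fin N → ℕ) :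
    interSign p q =
      (-1 : ℂ) ^ (∑ α : Fin N, ∑ β : Fin N, if β < α then p α * q β else 0) := by
  simp only [interSign, pairProd, ← Finset.prod_pow_eq_pow_sum]
  refine Finset.prod_congr rfl fun α _ => Finset.prod_congr rfl fun β _ => ?_
  split_ifs <;> simp

theorem interSign_mul_self {N : ℕ} (p q : Fin N → ℕ) : interSign p q * interSign p q = 1 := by
  rw [interSign_eq_pow, neg_one_pow_mul_self]

theorem interSign_add_left {N : ℕ} (p p' q : Fin N → ℕ) :
    interSign (p + p') q = interSign p q * interSign p' q := by
  rw [interSign, interSign, interSign, pairProd_mul]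
  refine pairProd_congr fun α β _ => ?_
  rw [← pow_add, Pi.add_apply, add_mul]

theorem interSign_add_right {N : ℕ} (p q q' : Fin N → ℕ) :
    interSign p (q + q') = interSign p q * interSign p q' := by
  rw [interSign, interSign, interSign, pairProd_mul]
  refine pairProd_congr fun α β _ => ?_
  rw [← pow_add, Pi.add_apply, mul_add]

theorem interSign_self_comp {N : ℕ} (p : Fin N → ℕ) (σ : Equiv.Perm (Fin N)) :
    interSign (p ∘ σ) (p ∘ σ) = interSign p p :=
  pairProd_comp_perm (fun α β => (-1 : ℂ) ^ (p α * p β)) (fun α β => by rw [mul_comm]) σ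

/-- For a pair of variables `a ⊗ b` with parities `p + q`, the exponent `(p + q)(p' + q')` has two
mixed terms. They are exactly the change of `interSign`, so after this twist the sign of a
permutation splits into one factor for each tensor factor. -/
theorem koszul_add {N : ℕ} (p q : Fin N → ℕ) (σ : Equiv.Perm (Fin N)) :
    koszul (p + q) σ * interSign (p ∘ σ) (q ∘ σ) =
      koszul p σ * koszul q σ * interSign p q := by
  have e : interSign p q = pairProd fun α β =>
      if β < α then (-1 : ℂ) ^ (p α * q β) else if α < β then (-1) ^ (p β * q α) else 1 :=
    pairProd_congr fun α β hl => by simp [hl]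
  rw [e, ← pairProd_comp_perm _ _ σ, koszul_eq_pairProd, koszul_eq_pairProd, koszul_eq_pairProd,
    interSign, pairProd_mul, pairProd_mul, pairProd_mul]
  · refine pairProd_congr fun α β h => ?_
    have h' : σ α ≠ σ β := fun e => h.ne' (σ.injective e)
    simp only [Pi.add_apply, Function.comp_apply]
    rcases lt_or_gt_of_ne h' with h2 | h2
    · simp only [not_lt_of_gt h, h2, false_iff, not_true, if_false, not_lt_of_gt h2, if_true]
      rw [← pow_add, ← pow_add, ← pow_add]
      apply SuperSym.neg_one_pow_congr
      have : (p (σ α) + q (σ α)) * (p (σ β) + q (σ β)) + p (σ α) * q (σ β) =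
        p (σ α) * p (σ β) + q (σ α) * q (σ β) + p (σ β) * q (σ α) + 2 * (p (σ α) * q (σ β)) := by
        ring
      rw [this]
      omega
    · simp [not_lt_of_gt h, not_lt_of_gt h2, h2]
  · intro α β
    rcases lt_trichotomy α β with h | rfl | h
    · simp [h, not_lt_of_gt]
    · simp
    · simp [h, not_lt_of_gt]

theorem koszul_swap_adj {N : ℕ} (p : Fin N → ℕ) (i : ℕ) (hi : i + 1 < N) :
    koszul p (Equiv.swap ⟨i, by omega⟩ ⟨i + 1, hi⟩) =
      (-1 : ℂ) ^ (p ⟨i, by omega⟩ * p ⟨i + 1, hi⟩) := by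
  set a : Fin N := ⟨i, by omega⟩ with ha
  set b : Fin N := ⟨i + 1, hi⟩ with hb
  have hv : ∀ γ : Fin N, ((Equiv.swap a b γ : Fin N) : ℕ) =
      if (γ : ℕ) = i then i + 1 else if (γ : ℕ) = i + 1 then i else γ := by
    intro γ
    rw [Equiv.swap_apply_def]
    simp only [Fin.ext_iff, ha, hb]
    split_ifs <;> rfl
  have hc : ∀ α β : Fin N, (α < β ∧ Equiv.swap a b β < Equiv.swap a b α) ↔ (α = a ∧ β = b) := by
    intro α β
    rw [Fin.lt_def, Fin.lt_def, hv, hv, Fin.ext_iff, Fin.ext_iff, ha, hb]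
    dsimp only
    split_ifs <;> omega
  rw [koszul, Finset.prod_eq_single a, Finset.prod_eq_single b]
  · rw [if_pos ((hc _ _).2 ⟨rfl, rfl⟩), Equiv.swap_apply_left, Equiv.swap_apply_right, mul_comm]
  · intro β _ hβ
    rw [if_neg fun h => hβ ((hc _ _).1 h).2]
  · simp
  · intro α _ hα
    refine Finset.prod_eq_one fun β _ => ?_
    rw [if_neg fun h => hα ((hc _ _).1 h).1]
  · simp

/-- The variables in between are passed twice, by two variables of equal parity, so their signs
cancel. Formally, conjugate the swap to the positions `0, 1` by some `g`; since the parities agree,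
the two Koszul signs of `g` are equal and cancel. -/
theorem koszul_swap {N : ℕ} (p : Fin N → ℕ) {x y : Fin N} (hxy : x ≠ y) (h : p x = p y) :
    koszul p (Equiv.swap x y) = (-1 : ℂ) ^ (p x * p y) := by
  have hN : 1 < N := by
    have := x.2; have := y.2; have : (x : ℕ) ≠ y := fun e => hxy (Fin.ext e); omega
  set a : Fin N := ⟨0, by omega⟩ with ha
  set b : Fin N := ⟨1, hN⟩ with hb
  have hab : a ≠ b := by simp [ha, hb]
  obtain ⟨g, hgx, hgy⟩ : ∃ g : Equiv.Perm (Fin N), g a = x ∧ g b = y := by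
    let g₁ := Equiv.swap a x
    refine ⟨Equiv.swap (g₁ b) y * g₁, ?_, ?_⟩
    · rw [Equiv.Perm.mul_apply, Equiv.swap_apply_left]
      refine Equiv.swap_apply_of_ne_of_ne (fun e => hab ?_) hxy
      exact g₁.injective ((Equiv.swap_apply_left a x).trans e)
    · simp
  have e : Equiv.swap x y = g * Equiv.swap a b * g⁻¹ := by
    rw [← hgx, ← hgy, Equiv.mul_swap_eq_swap_mul, mul_inv_cancel_right]
  have hp : (p ∘ g) ∘ (Equiv.swap a b : Equiv.Perm (Fin N)) = p ∘ g := by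
    funext γ
    simp only [Function.comp_apply]
    by_cases h1 : γ = a
    · subst h1; rw [Equiv.swap_apply_left, hgx, hgy, h]
    · by_cases h2 : γ = b
      · subst h2; rw [Equiv.swap_apply_right, hgx, hgy, h]
      · rw [Equiv.swap_apply_of_ne_of_ne h1 h2]
  have hp' : p ∘ (g * Equiv.swap a b : Equiv.Perm (Fin N)) = p ∘ g := hp
  rw [e, koszul_mul, hp', koszul_mul, koszul_inv, mul_comm, ← mul_assoc, koszul_mul_self, one_mul,
    ha, hb, koszul_swap_adj (p ∘ g) 0 hN]
  simp only [Function.comp_apply]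
  rw [← hgx, ← hgy]

end SuperInv

/-! ### Monomials and coefficient functionals of free supercommutative superalgebras -/

namespace SuperInv

theorem ofFn_comp_swap {X : Type} {N : ℕ} (z : Fin N → X) (u v : List X) (a b : X)
    (h : List.ofFn z = u ++ a :: b :: v) (hi : u.length + 1 < N) :
    List.ofFn (z ∘ Equiv.swap (⟨u.length, by omega⟩ : Fin N) ⟨u.length + 1, hi⟩) =
      u ++ b :: a :: v := by
  have hz : ∀ (i : Fin N) (h' : (i : ℕ) < (u ++ a :: b :: v).length),
      z i = (u ++ a :: b :: v)[(i : ℕ)] := by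
    intro i h'
    simp [← h]
  have hl : N = u.length + 2 + v.length := by
    have := congrArg List.length h
    simp at this
    omega
  apply List.ext_getElem
  · simp; omega
  intro k h1 h2
  rw [List.getElem_ofFn, Function.comp_apply, Equiv.swap_apply_def]
  simp only [Fin.ext_iff]
  split_ifs with c1 c2
  · rw [hz _ (by simp)]
    simp [c1]
  · rw [hz _ (by simp)]
    simp [c2]
  · have hk : k < (u ++ a :: b :: v).length := by simp at h2 ⊢; omega
    rw [hz _ hk]
    dsimp only
    rcases lt_or_ge k u.length with h3 | h3
    · rw [List.getElem_append_left h3, List.getElem_append_left h3]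
    · obtain ⟨j, rfl⟩ : ∃ j, k = u.length + 2 + j := ⟨k - u.length - 2, by omega⟩
      rw [List.getElem_append_right (by omega), List.getElem_append_right (by omega)]
      have : u.length + 2 + j - u.length = j + 2 := by omega
      simp [this]

theorem sum_eq_sum_mul_right {G E : Type*} [Group G] [Fintype G] [AddCommMonoid E] (s : G)
    (f : G → E) : ∑ g, f g = ∑ g, f (g * s) :=
  (Equiv.sum_comp (Equiv.mulRight s) f).symm

namespace SuperSym

variable {X : Type} {par : X → ℕ}

/-! ### Monomials -/

/-- The monomial `x₁ ⋯ x_N`. -/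
noncomputable def mon (par : X → ℕ) {N : ℕ} (x : Fin N → X) : SuperSym par :=
  (List.ofFn fun i => gen par (x i)).prod

theorem mon_eq_map (par : X → ℕ) {N : ℕ} (x : Fin N → X) :
    mon par x = ((List.ofFn x).map (gen par)).prod := by
  rw [mon, List.map_ofFn]; rfl

/-- Adjacent transpositions generate the symmetric group. For one of them this is the defining
relation, and `koszul_mul` propagates it to products. -/
theorem mon_comp_perm {N : ℕ} (x : Fin N → X) (σ : Equiv.Perm (Fin N)) :
    mon par (x ∘ σ) = koszul (par ∘ x) σ • mon par x := by
  rcases N with _ | n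
  · have : σ = 1 := Subsingleton.elim _ _
    simp [this]
  have hσ : σ ∈ Submonoid.closure
      (Set.range fun i : Fin n => Equiv.swap i.castSucc i.succ) := by
    rw [Equiv.Perm.mclosure_swap_castSucc_succ]; trivial
  induction hσ using Submonoid.closure_induction generalizing x with
  | mem τ hτ =>
    obtain ⟨i, rfl⟩ := hτ
    set l := List.ofFn x with hl
    have hi : (i : ℕ) + 1 < n + 1 := by omega
    have hlen : l.length = n + 1 := by simp [hl]
    have hget : ∀ (j : ℕ) (h1 : j < l.length) (h2 : j < n + 1), l[j] = x ⟨j, h2⟩ := by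
      intro j h1 h2
      simp only [hl]
      rw [List.getElem_ofFn]
    have e : l = l.take i ++ x i.castSucc :: x i.succ :: l.drop (i + 2) := by
      conv_lhs => rw [← List.take_append_drop i l]
      rw [List.drop_eq_getElem_cons (by omega), List.drop_eq_getElem_cons (by omega),
        hget _ _ (by omega), hget _ _ (by omega)]
      rfl
    have htl : (l.take i).length = i := by simp [hlen]; omega
    have e2 := ofFn_comp_swap x _ _ _ _ e (by rw [htl]; omega)
    have e3 : List.ofFn (x ∘ Equiv.swap i.castSucc i.succ) =
        l.take i ++ x i.succ :: x i.castSucc :: l.drop (i + 2) := by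
      rw [← e2]
      congr 4 <;> exact Fin.ext (by simp [htl])
    have hk := koszul_swap_adj (par ∘ x) i hi
    have h1 : (⟨i, by omega⟩ : Fin (n + 1)) = i.castSucc := rfl
    have h2 : (⟨i + 1, by omega⟩ : Fin (n + 1)) = i.succ := rfl
    rw [h1, h2] at hk
    rw [hk, mon_eq_map, mon_eq_map, e3, ← hl, e]
    simp only [List.map_append, List.map_cons, List.prod_append, List.prod_cons,
      Function.comp_apply]
    rw [← mul_assoc (gen par (x i.succ)), gen_comm, mul_comm (par (x i.succ)),
      smul_mul_assoc, mul_smul_comm, mul_assoc (gen par (x i.castSucc))]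
    have hd : (l.take i ++ x i.castSucc :: x i.succ :: l.drop (i + 2)) = l := e.symm
    rw [← e]
  | one => simp
  | mul σ τ _ _ h1 h2 =>
    have e : x ∘ (σ * τ : Equiv.Perm _) = (x ∘ σ) ∘ τ := rfl
    rw [e, h2, h1, koszul_mul, smul_smul, mul_comm]
    rfl

theorem basisFreeMonoid_apply (w : List X) :
    FreeAlgebra.basisFreeMonoid ℂ X (FreeMonoid.ofList w) = (w.map (FreeAlgebra.ι ℂ)).prod := by
  simp only [FreeAlgebra.basisFreeMonoid, Module.Basis.map_apply, Finsupp.coe_basisSingleOne,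
    LinearEquiv.trans_symm, LinearEquiv.trans_apply]
  change MonoidAlgebra.lift ℂ (FreeAlgebra ℂ X) (FreeMonoid X) (FreeMonoid.lift (FreeAlgebra.ι ℂ))
    (MonoidAlgebra.single (FreeMonoid.ofList w) 1) = _
  rw [MonoidAlgebra.lift_single, one_smul, FreeMonoid.lift_apply, FreeMonoid.toList_ofList]

theorem mk_prod_map_ι (w : List X) :
    mk par (w.map (FreeAlgebra.ι ℂ)).prod = (w.map (gen par)).prod := by
  rw [map_list_prod, List.map_map]; rfl

theorem mk_prod_ofFn {N : ℕ} (x : Fin N → X) :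
    mk par ((List.ofFn x).map (FreeAlgebra.ι ℂ)).prod = mon par x := by
  rw [mk_prod_map_ι, mon_eq_map]

theorem freeAlgebra_mem_span (a : FreeAlgebra ℂ X) :
    a ∈ Submodule.span ℂ (Set.range fun w : List X => (w.map (FreeAlgebra.ι ℂ)).prod) := by
  have h := (FreeAlgebra.basisFreeMonoid ℂ X).mem_span a
  refine Submodule.span_mono ?_ h
  rintro _ ⟨w, rfl⟩
  exact ⟨FreeMonoid.toList w, (basisFreeMonoid_apply _).symm⟩

/-- The monomials span the free supercommutative superalgebra. -/
theorem mem_span_mon (f : SuperSym par) :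
    f ∈ Submodule.span ℂ (Set.range fun s : Σ N, (Fin N → X) => mon par s.2) := by
  obtain ⟨a, rfl⟩ := mk_surjective f
  have h := Submodule.mem_map_of_mem (f := (mk par).toLinearMap) (freeAlgebra_mem_span a)
  rw [Submodule.map_span] at h
  refine Submodule.span_mono ?_ h
  rintro _ ⟨_, ⟨w, rfl⟩, rfl⟩
  refine ⟨⟨w.length, w.get⟩, ?_⟩
  change mon par w.get = mk par _
  rw [mk_prod_map_ι, mon_eq_map, List.ofFn_get]

/-! ### Linear functionals -/

/-- This provides linear functionals on the quotient without a basis of it: a functional on words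
descends as soon as it respects the exchange of adjacent letters. -/
theorem ker_mk_le (F : FreeAlgebra ℂ X →ₗ[ℂ] ℂ)
    (hF : ∀ (u v : List X) (a b : X),
      F ((u ++ a :: b :: v).map (FreeAlgebra.ι ℂ)).prod = (-1 : ℂ) ^ (par a * par b) *
        F ((u ++ b :: a :: v).map (FreeAlgebra.ι ℂ)).prod) :
    LinearMap.ker (mk par).toLinearMap ≤ LinearMap.ker F := by
  -- The largest two-sided ideal inside the kernel of `F`. It contains the supercommutation
  -- relations, so the universal property of `SuperSym par` maps onto the quotient by it, and
  -- everything killed by `mk par` lies in `T`.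
  let T : TwoSidedIdeal (FreeAlgebra ℂ X) := TwoSidedIdeal.mk' {a | ∀ u v, F (u * a * v) = 0}
    (by simp) (fun h1 h2 u v => by simp [mul_add, add_mul, h1 u v, h2 u v])
    (fun h u v => by simp [h u v])
    (fun {x y} h u v => by rw [← mul_assoc]; exact h (u * x) v)
    (fun {x y} h u v => by rw [← mul_assoc, mul_assoc _ y v]; exact h u (y * v))
  have hT : ∀ a, a ∈ T ↔ ∀ u v, F (u * a * v) = 0 := fun a => by
    rw [TwoSidedIdeal.mem_mk']; rfl
  have hq : ∀ a : FreeAlgebra ℂ X, (a : T.ringCon.Quotient) = 0 ↔ a ∈ T := fun a => by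
    rw [TwoSidedIdeal.mem_iff, ← RingCon.eq]; rfl
  have hrel : ∀ x y : X, FreeAlgebra.ι ℂ x * FreeAlgebra.ι ℂ y -
      (-1 : ℂ) ^ (par x * par y) • (FreeAlgebra.ι ℂ y * FreeAlgebra.ι ℂ x) ∈ T := by
    intro x y
    rw [hT]
    intro u v
    induction freeAlgebra_mem_span u using Submodule.span_induction with
    | zero => simp
    | add a b _ _ h1 h2 => rw [add_mul, add_mul, map_add, h1, h2, add_zero]
    | smul c a _ h => rw [smul_mul_assoc, smul_mul_assoc, map_smul, h, smul_zero]
    | mem u hu =>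
      obtain ⟨u, rfl⟩ := hu
      induction freeAlgebra_mem_span v using Submodule.span_induction with
      | zero => simp
      | add a b _ _ h1 h2 => rw [mul_add, map_add, h1, h2, add_zero]
      | smul c a _ h => rw [mul_smul_comm, map_smul, h, smul_zero]
      | mem v hv =>
        obtain ⟨v, rfl⟩ := hv
        have h := hF u v x y
        simp only [List.map_append, List.map_cons, List.prod_append, List.prod_cons] at h
        dsimp only
        rw [mul_sub, sub_mul, map_sub, mul_smul_comm, smul_mul_assoc, map_smul, smul_eq_mul,
          sub_eq_zero]
        simpa only [mul_assoc] using h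
  let φ : SuperSym par →ₐ[ℂ] T.ringCon.Quotient := lift
    (fun x => ((FreeAlgebra.ι ℂ x : FreeAlgebra ℂ X) : T.ringCon.Quotient)) (by
      intro x y
      rw [← sub_eq_zero]
      exact (hq _).2 (hrel x y))
  have hφ : ∀ a, φ (mk par a) = (a : T.ringCon.Quotient) := by
    let π : FreeAlgebra ℂ X →ₐ[ℂ] T.ringCon.Quotient :=
      { T.ringCon.mk' with commutes' := fun c => rfl }
    have : φ.comp (mk par) = π := FreeAlgebra.hom_ext (funext fun x => lift_gen _ _ x)
    intro a
    exact DFunLike.congr_fun this a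
  intro a ha
  have h0 : mk par a = 0 := ha
  have h1 := hφ a
  rw [h0, map_zero] at h1
  have h2 := (hT a).1 ((hq a).1 h1.symm) 1 1
  rw [LinearMap.mem_ker]
  simpa using h2

open Classical in
/-- The coefficient functional of a word, symmetrized with signs, on words. -/
noncomputable def wordCoeff (par : X → ℕ) {N : ℕ} (y : Fin N → X) (l : List X) : ℂ :=
  ∑ σ : Equiv.Perm (Fin N), if l = List.ofFn (y ∘ σ) then koszul (par ∘ y) σ else 0

/-- Reindex the sum by the adjacent transposition and apply the cocycle identity. A word of the
wrong length gives zero on both sides. -/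
theorem wordCoeff_swap {N : ℕ} (y : Fin N → X) (u v : List X) (a b : X) :
    wordCoeff par y (u ++ a :: b :: v) =
      (-1 : ℂ) ^ (par a * par b) * wordCoeff par y (u ++ b :: a :: v) := by
  by_cases hN : u.length + 2 + v.length = N
  · have hi : u.length + 1 < N := by omega
    set s : Equiv.Perm (Fin N) := Equiv.swap ⟨u.length, by omega⟩ ⟨u.length + 1, hi⟩ with hs
    have hss : s * s = 1 := Equiv.swap_mul_self _ _
    rw [wordCoeff, wordCoeff, sum_eq_sum_mul_right s, Finset.mul_sum]
    refine Finset.sum_congr rfl fun σ _ => ?_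
    have e : y ∘ (σ * s : Equiv.Perm _) = (y ∘ σ) ∘ s := rfl
    by_cases h : u ++ b :: a :: v = List.ofFn (y ∘ σ)
    · have h1 := ofFn_comp_swap _ _ _ _ _ h.symm hi
      rw [if_pos h, e, h1, if_pos rfl, koszul_mul, hs, koszul_swap_adj, mul_comm]
      have hz : ∀ (i : Fin N) (h' : (i : ℕ) < (u ++ b :: a :: v).length),
          (y ∘ σ) i = (u ++ b :: a :: v)[(i : ℕ)] := by
        intro i h'
        simp [h]
      have g1 : y (σ ⟨u.length, by omega⟩) = b := by
        have := hz ⟨u.length, by omega⟩ (by simp)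
        simpa using this
      have g2 : y (σ ⟨u.length + 1, hi⟩) = a := by
        have := hz ⟨u.length + 1, hi⟩ (by simp)
        simpa using this
      simp only [Function.comp_apply, g1, g2]
      rw [mul_comm (par b)]
    · rw [if_neg h, mul_zero, if_neg]
      intro h2
      rw [e] at h2
      have h1 := ofFn_comp_swap _ _ _ _ _ h2.symm hi
      apply h
      rw [← h1]
      congr 1
      have e2 : y ∘ σ = (y ∘ σ) ∘ (s * s : Equiv.Perm _) := by rw [hss]; rfl
      exact e2.symm
  · have h0 : ∀ (c d : X), wordCoeff par y (u ++ c :: d :: v) = 0 := by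
      intro c d
      refine Finset.sum_eq_zero fun σ _ => if_neg fun h => hN ?_
      have := congrArg List.length h
      simp at this
      omega
    rw [h0, h0, mul_zero]

/-- The coefficient functional of the monomial `y₁ ⋯ y_N`, up to a normalization. -/
noncomputable def coeffFun (par : X → ℕ) {N : ℕ} (y : Fin N → X) : SuperSym par →ₗ[ℂ] ℂ :=
  (Submodule.liftQ _ ((FreeAlgebra.basisFreeMonoid ℂ X).constr ℂ
      fun w => wordCoeff par y (FreeMonoid.toList w)) (ker_mk_le (par := par) _ (by
        intro u v a b
        rw [← basisFreeMonoid_apply, ← basisFreeMonoid_apply, Module.Basis.constr_basis,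
          Module.Basis.constr_basis]
        exact wordCoeff_swap y u v a b))).comp
    ((mk par).toLinearMap.quotKerEquivOfSurjective mk_surjective).symm.toLinearMap

theorem coeffFun_mon {N M : ℕ} (y : Fin N → X) (x : Fin M → X) :
    coeffFun par y (mon par x) = wordCoeff par y (List.ofFn x) := by
  have e : ((mk par).toLinearMap.quotKerEquivOfSurjective mk_surjective).symm (mon par x) =
      Submodule.Quotient.mk ((List.ofFn x).map (FreeAlgebra.ι ℂ)).prod := by
    rw [LinearEquiv.symm_apply_eq]
    exact (mk_prod_ofFn x).symm
  rw [coeffFun, LinearMap.comp_apply, LinearEquiv.coe_coe, e, Submodule.liftQ_apply,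
    ← basisFreeMonoid_apply, Module.Basis.constr_basis]
  rfl

theorem coeffFun_mon_of_ne {N M : ℕ} (h : M ≠ N) (y : Fin N → X) (x : Fin M → X) :
    coeffFun par y (mon par x) = 0 := by
  rw [coeffFun_mon]
  refine Finset.sum_eq_zero fun σ _ => if_neg fun e => h ?_
  simpa using congrArg List.length e

open Classical in
theorem coeffFun_mon_eq {N : ℕ} (y x : Fin N → X) :
    coeffFun par y (mon par x) =
      ∑ σ : Equiv.Perm (Fin N), if x = y ∘ σ then koszul (par ∘ y) σ else 0 := by
  rw [coeffFun_mon]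
  refine Finset.sum_congr rfl fun σ _ => ?_
  simp only [List.ofFn_injective.eq_iff]

end SuperSym
end SuperInv

/-! ### Expanding products of scalar products, and separating the coefficients of two groups of
variables -/

namespace SuperInv

theorem prod_ofFn_sum {B ι : Type*} [Semiring B] [Fintype ι] {N : ℕ} (f : Fin N → ι → B) :
    (List.ofFn fun α => ∑ i, f α i).prod =
      ∑ K : Fin N → ι, (List.ofFn fun α => f α (K α)).prod := by
  induction N with
  | zero => simp
  | succ N ih =>
    rw [List.ofFn_succ, List.prod_cons, ih, Finset.sum_mul_sum,
      ← (Fin.consEquiv fun _ : Fin (N + 1) => ι).sum_comp, Fintype.sum_prod_type]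
    refine Finset.sum_congr rfl fun i _ => Finset.sum_congr rfl fun K _ => ?_
    simp [List.ofFn_succ, Fin.consEquiv]

theorem mul_prod_ofFn_comm {B : Type*} [Ring B] [Algebra ℂ B] {N : ℕ} (a : Fin N → B) (b : B)
    (p : Fin N → ℕ) (q : ℕ) (h : ∀ α, b * a α = (-1 : ℂ) ^ (p α * q) • (a α * b)) :
    b * (List.ofFn a).prod = (∏ α, (-1 : ℂ) ^ (p α * q)) • ((List.ofFn a).prod * b) := by
  induction N with
  | zero => simp
  | succ N ih =>
    rw [List.ofFn_succ, List.prod_cons, ← mul_assoc, h 0, smul_mul_assoc, mul_assoc,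
      ih _ (fun α => p α.succ) fun α => h α.succ, mul_smul_comm, smul_smul, Fin.prod_univ_succ,
      mul_assoc]

theorem interSign_succ {N : ℕ} (p q : Fin (N + 1) → ℕ) :
    interSign p q = (∏ α : Fin N, (-1 : ℂ) ^ (p α.succ * q 0)) *
      interSign (fun α => p α.succ) fun α => q α.succ := by
  simp [interSign, pairProd, Fin.prod_univ_succ, Finset.prod_mul_distrib]

/-- Collecting all the `a α` on the left moves each of them past the `b β` with `β < α`, which is
the exponent in `interSign`. -/
theorem prod_ofFn_mul {B : Type*} [Ring B] [Algebra ℂ B] {N : ℕ} (a b : Fin N → B)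
    (p q : Fin N → ℕ) (h : ∀ α β, b β * a α = (-1 : ℂ) ^ (p α * q β) • (a α * b β)) :
    (List.ofFn fun α => a α * b α).prod =
      interSign p q • ((List.ofFn a).prod * (List.ofFn b).prod) := by
  induction N with
  | zero => simp [interSign, pairProd]
  | succ N ih =>
    rw [List.ofFn_succ, List.prod_cons, ih _ _ (fun α => p α.succ) (fun α => q α.succ)
      fun α β => h α.succ β.succ, List.ofFn_succ (f := a), List.prod_cons, List.ofFn_succ (f := b),
      List.prod_cons, interSign_succ, mul_smul_comm]
    have e := mul_prod_ofFn_comm (fun α => a (Fin.succ α)) (b 0) (fun α => p α.succ) (q 0)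
      fun α => h α.succ 0
    have e2 : a 0 * b 0 * ((List.ofFn fun α => a (Fin.succ α)).prod *
        (List.ofFn fun α => b (Fin.succ α)).prod) =
        a 0 * (b 0 * (List.ofFn fun α => a (Fin.succ α)).prod) *
        (List.ofFn fun α => b (Fin.succ α)).prod := by simp only [mul_assoc]
    rw [e2, e, mul_smul_comm, smul_mul_assoc, smul_smul, mul_comm (interSign _ _)]
    simp only [mul_assoc]

/-! ### Permutations of two consecutive blocks -/

/-- The permutation acting by `σ` on the first `a` and by `τ` on the last `b` positions. -/
def blockPerm {a b : ℕ} (σ : Equiv.Perm (Fin a)) (τ : Equiv.Perm (Fin b)) :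
    Equiv.Perm (Fin (a + b)) :=
  finSumFinEquiv.permCongr (Equiv.Perm.sumCongr σ τ)

@[simp]
theorem blockPerm_castAdd {a b : ℕ} (σ : Equiv.Perm (Fin a)) (τ : Equiv.Perm (Fin b))
    (i : Fin a) : blockPerm σ τ (Fin.castAdd b i) = Fin.castAdd b (σ i) := by
  simp [blockPerm, Equiv.permCongr_apply]

@[simp]
theorem blockPerm_natAdd {a b : ℕ} (σ : Equiv.Perm (Fin a)) (τ : Equiv.Perm (Fin b))
    (i : Fin b) : blockPerm σ τ (Fin.natAdd a i) = Fin.natAdd a (τ i) := by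
  simp [blockPerm, Equiv.permCongr_apply]

theorem append_comp_blockPerm {X : Type*} {a b : ℕ} (x : Fin a → X) (y : Fin b → X)
    (σ : Equiv.Perm (Fin a)) (τ : Equiv.Perm (Fin b)) :
    Fin.append x y ∘ blockPerm σ τ = Fin.append (x ∘ σ) (y ∘ τ) := by
  funext i
  refine Fin.addCases (fun i => ?_) (fun i => ?_) i <;> simp

theorem blockPerm_injective {a b : ℕ} : Function.Injective
    fun s : Equiv.Perm (Fin a) × Equiv.Perm (Fin b) => blockPerm s.1 s.2 := by
  rintro ⟨σ, τ⟩ ⟨σ', τ'⟩ h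
  have h' : blockPerm σ τ = blockPerm σ' τ' := h
  ext i
  · have := congrArg (fun f => (f (Fin.castAdd b i) : ℕ)) h'
    simpa using this
  · have := congrArg (fun f => (f (Fin.natAdd a i) : ℕ)) h'
    simpa using this

theorem exists_blockPerm {a b : ℕ} (ρ : Equiv.Perm (Fin (a + b)))
    (h : ∀ i : Fin a, ∃ j : Fin a, ρ (Fin.castAdd b i) = Fin.castAdd b j) :
    ∃ σ τ, ρ = blockPerm σ τ := by
  have hm : finSumFinEquiv.symm.permCongr ρ ∈ (Equiv.Perm.sumCongrHom (Fin a) (Fin b)).range := by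
    apply Equiv.Perm.mem_sumCongrHom_range_of_perm_mapsTo_inl
    rintro _ ⟨i, rfl⟩
    obtain ⟨j, hj⟩ := h i
    exact ⟨j, by simp [Equiv.permCongr_apply, hj]⟩
  obtain ⟨⟨σ, τ⟩, hs⟩ := hm
  refine ⟨σ, τ, ?_⟩
  have hs' : Equiv.Perm.sumCongr σ τ = finSumFinEquiv.symm.permCongr ρ := hs
  rw [blockPerm, hs']
  ext i
  simp [Equiv.permCongr_apply]

theorem koszul_blockPerm {a b : ℕ} (p : Fin (a + b) → ℕ) (σ : Equiv.Perm (Fin a))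
    (τ : Equiv.Perm (Fin b)) : koszul p (blockPerm σ τ) =
      koszul (p ∘ Fin.castAdd b) σ * koszul (p ∘ Fin.natAdd a) τ := by
  have h1 : ∀ (i : Fin a) (j : Fin b), ¬ Fin.natAdd a j < Fin.castAdd b i := by
    intro i j
    rw [Fin.lt_def]
    simp
    omega
  have h2 : ∀ i j : Fin a, Fin.castAdd b i < Fin.castAdd b j ↔ i < j := fun i j => Iff.rfl
  have h3 : ∀ i j : Fin b, Fin.natAdd a i < Fin.natAdd a j ↔ i < j := fun i j => by
    rw [Fin.lt_def, Fin.lt_def]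
    simp
  simp [koszul, Fin.prod_univ_add, h1, h2, h3]

namespace SuperSym

variable {X : Type} {par : X → ℕ}

theorem mon_append {a b : ℕ} (x : Fin a → X) (y : Fin b → X) :
    mon par (Fin.append x y) = mon par x * mon par y := by
  rw [mon_eq_map, List.ofFn_fin_append, List.map_append, List.prod_append, ← mon_eq_map,
    ← mon_eq_map]

/-- The predicate `s` separates the two groups of variables. A permutation matching the two
concatenated words must keep the first block, because the letters of `x` satisfy `s` and those of
`y'` do not; it is then a block permutation, and its sign factors. -/
theorem coeffFun_append {a b : ℕ} (s : X → Prop) (x x' : Fin a → X) (y y' : Fin b → X)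
    (hx : ∀ i, s (x i)) (hy' : ∀ i, ¬ s (y' i)) :
    coeffFun par (Fin.append x' y') (mon par x * mon par y) =
      coeffFun par x' (mon par x) * coeffFun par y' (mon par y) := by
  rw [← mon_append, coeffFun_mon_eq, coeffFun_mon_eq, coeffFun_mon_eq, Finset.sum_mul_sum,
    ← Finset.sum_product', Finset.univ_product_univ]
  symm
  refine Fintype.sum_of_injective _ blockPerm_injective _ _ ?_ ?_
  · intro ρ hρ
    refine if_neg fun e => hρ ?_
    obtain ⟨σ, τ, h⟩ := exists_blockPerm ρ fun i => by
      have h1 := congrFun e (Fin.castAdd b i)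
      rw [Fin.append_left, Function.comp_apply] at h1
      have h2 := hx i
      rw [h1] at h2
      generalize ρ (Fin.castAdd b i) = j at h2
      revert h2
      refine Fin.addCases (fun j => ?_) (fun j => ?_) j
      · exact fun _ => ⟨j, rfl⟩
      · intro h2
        rw [Fin.append_right] at h2
        exact absurd h2 (hy' j)
    exact ⟨(σ, τ), h.symm⟩
  · rintro ⟨σ, τ⟩
    have e1 : (par ∘ Fin.append x' y') ∘ Fin.castAdd b = par ∘ x' := by
      funext i; simp
    have e2 : (par ∘ Fin.append x' y') ∘ Fin.natAdd a = par ∘ y' := by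
      funext i; simp
    dsimp only
    rw [append_comp_blockPerm, koszul_blockPerm, e1, e2]
    have h : Fin.append x y = Fin.append (x' ∘ σ) (y' ∘ τ) ↔ x = x' ∘ σ ∧ y = y' ∘ τ := by
      constructor
      · intro h
        constructor
        · funext i
          simpa using congrFun h (Fin.castAdd b i)
        · funext i
          simpa using congrFun h (Fin.natAdd a i)
      · rintro ⟨h1, h2⟩
        rw [h1, h2]
    by_cases h1 : x = x' ∘ σ
    · by_cases h2 : y = y' ∘ τ
      · rw [if_pos h1, if_pos h2, if_pos (h.2 ⟨h1, h2⟩)]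
      · rw [if_neg h2, if_neg fun h' => h2 (h.1 h').2, mul_zero]
    · rw [if_neg h1, if_neg fun h' => h1 (h.1 h').1, zero_mul]

theorem interSign_smul_mon_comp {N : ℕ} (x : Fin N → X) (p q : Fin N → ℕ) (h : par ∘ x = p + q)
    (σ : Equiv.Perm (Fin N)) :
    interSign (p ∘ σ) (q ∘ σ) • mon par (x ∘ σ) =
      (koszul p σ * koszul q σ) • interSign p q • mon par x := by
  rw [mon_comp_perm, smul_smul, smul_smul, h, mul_comm (interSign _ _), koszul_add]

end SuperSym

/-! ### Twisted monomials and the scalar product homomorphism -/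

section

variable {n m k l p q : ℕ}

/-- The parities of the elements of a sequence. -/
abbrev pars {N a b : ℕ} (I : Fin N → Idx a b) : Fin N → ℕ := fun α => parity (I α)

theorem Z_eq {N : ℕ} (I : Fin N → Idx k l) (J : Fin N → Idx p q) :
    Z I J = interSign (pars I) (pars J) •
      SuperSym.mon (zPar k l p q) fun α => (I α, J α) := by
  rw [interSign_eq_pow]; rfl

theorem Z_comp_perm {N : ℕ} (I : Fin N → Idx k l) (J : Fin N → Idx p q)
    (σ : Equiv.Perm (Fin N)) :
    Z (I ∘ σ) (J ∘ σ) = (koszul (pars I) σ * koszul (pars J) σ) • Z I J := by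
  rw [Z_eq, Z_eq]
  exact SuperSym.interSign_smul_mon_comp (fun α => (I α, J α)) (pars I) (pars J) rfl σ

/-- The monomial `± x_{i₁ k₁} ⋯ x_{i_N k_N}`. -/
noncomputable def xMon {N : ℕ} (I : Fin N → Idx k l) (K : Fin N → Idx n m) : Alg n m k l p q :=
  interSign (pars I) (pars K) • SuperSym.mon (aPar n m k l p q) fun α => Sum.inl (I α, K α)

/-- The monomial `± x*_{k₁ j₁} ⋯ x*_{k_N j_N}`. -/
noncomputable def xStarMon {N : ℕ} (K : Fin N → Idx n m) (J : Fin N → Idx p q) :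
    Alg n m k l p q :=
  interSign (pars K) (pars J) • SuperSym.mon (aPar n m k l p q) fun α => Sum.inr (K α, J α)

theorem xMon_comp_perm {N : ℕ} (I : Fin N → Idx k l) (K : Fin N → Idx n m)
    (σ : Equiv.Perm (Fin N)) : (xMon (I ∘ σ) (K ∘ σ) : Alg n m k l p q) =
      (koszul (pars I) σ * koszul (pars K) σ) • xMon I K :=
  SuperSym.interSign_smul_mon_comp (par := aPar n m k l p q)
    (fun α => Sum.inl (I α, K α)) (pars I) (pars K) rfl σ

variable (n m k l p q) in
/-- The homomorphism `S(U ⊗ W) → A` with values the scalar products. -/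
noncomputable def prodHom : SUW k l p q →ₐ[ℂ] Alg n m k l p q :=
  (glInvariants n m k l p q).val.comp (scalarProdHom n m k l p q)

theorem scalarProdHom_eq_zero_iff (f : SUW k l p q) :
    scalarProdHom n m k l p q f = 0 ↔ prodHom n m k l p q f = 0 :=
  Subtype.ext_iff

theorem prodHom_zGen (r : Idx k l) (s : Idx p q) :
    prodHom n m k l p q (zGen r s) = scalarProd r s := by
  rw [prodHom, AlgHom.comp_apply, zGen, scalarProdHom, SuperSym.lift_gen]
  rfl

/-- Expand every scalar product over an index of `V` and separate the `x` from the `x*`. The sign in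
`Z` cancels the part involving `I` and `J`, leaving the two normalized monomials and the sign of `K`
against itself. -/
theorem prodHom_Z {N : ℕ} (I : Fin N → Idx k l) (J : Fin N → Idx p q) :
    prodHom n m k l p q (Z I J) =
      ∑ K : Fin N → Idx n m, interSign (pars K) (pars K) • (xMon I K * xStarMon K J) := by
  rw [Z, map_smul, map_list_prod, List.map_ofFn]
  have e1 : (prodHom n m k l p q : SUW k l p q → Alg n m k l p q) ∘
      (fun α => zGen (I α) (J α)) = fun α => ∑ i, xGen (I α) i * xStar i (J α) := by
    funext α
    exact prodHom_zGen _ _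
  rw [e1, prod_ofFn_sum, Finset.smul_sum, ← interSign_eq_pow (pars I) (pars J)]
  refine Finset.sum_congr rfl fun K _ => ?_
  rw [prod_ofFn_mul (fun α => xGen (I α) (K α)) (fun α => xStar (K α) (J α))
    (pars I + pars K) (pars K + pars J), smul_smul, xMon, xStarMon, smul_mul_smul_comm, smul_smul]
  · congr 1
    rw [interSign_add_left, interSign_add_right, interSign_add_right]
    linear_combination (interSign (pars I) (pars K) * interSign (pars K) (pars K) *
      interSign (pars K) (pars J)) * interSign_mul_self (pars I) (pars J)
  · intro α β
    have h : (xStar (K β) (J β) * xGen (I α) (K α) : Alg n m k l p q) =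
      (-1 : ℂ) ^ ((parity (K β) + parity (J β)) * (parity (I α) + parity (K α))) •
        (xGen (I α) (K α) * xStar (K β) (J β)) := SuperSym.gen_comm _ _
    rw [h, mul_comm (parity (K β) + parity (J β))]
    rfl

open Classical in
theorem coeffFun_xMon {N : ℕ} (I I' : Fin N → Idx k l) (K K' : Fin N → Idx n m) :
    SuperSym.coeffFun (aPar n m k l p q) (fun α => Sum.inl (I' α, K' α)) (xMon I K) =
      interSign (pars I') (pars K') * ∑ σ : Equiv.Perm (Fin N),
        if I = I' ∘ σ ∧ K = K' ∘ σ then koszul (pars I') σ * koszul (pars K') σ else 0 := by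
  rw [xMon, map_smul, SuperSym.coeffFun_mon_eq, smul_eq_mul, Finset.mul_sum, Finset.mul_sum]
  refine Finset.sum_congr rfl fun σ _ => ?_
  have h : ((fun α => Sum.inl (I α, K α)) : Fin N → (Idx k l × Idx n m) ⊕ (Idx n m × Idx p q)) =
      (fun α => Sum.inl (I' α, K' α)) ∘ σ ↔ I = I' ∘ σ ∧ K = K' ∘ σ := by
    simp [funext_iff, forall_and]
  by_cases hc : I = I' ∘ σ ∧ K = K' ∘ σ
  · rw [if_pos (h.2 hc), if_pos hc, hc.1, hc.2, mul_comm (interSign (pars I') _)]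
    have := koszul_add (pars I') (pars K') σ
    rw [← this, mul_comm]
    rfl
  · rw [if_neg fun h' => hc (h.1 h'), if_neg hc, mul_zero, mul_zero]

open Classical in
theorem coeffFun_xStarMon {N : ℕ} (K K' : Fin N → Idx n m) (J J' : Fin N → Idx p q) :
    SuperSym.coeffFun (aPar n m k l p q) (fun α => Sum.inr (K' α, J' α)) (xStarMon K J) =
      interSign (pars K') (pars J') * ∑ σ : Equiv.Perm (Fin N),
        if K = K' ∘ σ ∧ J = J' ∘ σ then koszul (pars K') σ * koszul (pars J') σ else 0 := by
  rw [xStarMon, map_smul, SuperSym.coeffFun_mon_eq, smul_eq_mul, Finset.mul_sum, Finset.mul_sum]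
  refine Finset.sum_congr rfl fun σ _ => ?_
  have h : ((fun α => Sum.inr (K α, J α)) : Fin N → (Idx k l × Idx n m) ⊕ (Idx n m × Idx p q)) =
      (fun α => Sum.inr (K' α, J' α)) ∘ σ ↔ K = K' ∘ σ ∧ J = J' ∘ σ := by
    simp [funext_iff, forall_and]
  by_cases hc : K = K' ∘ σ ∧ J = J' ∘ σ
  · rw [if_pos (h.2 hc), if_pos hc, hc.1, hc.2, mul_comm (interSign (pars K') _)]
    have := koszul_add (pars K') (pars J') σ
    rw [← this, mul_comm]
    rfl
  · rw [if_neg fun h' => hc (h.1 h'), if_neg hc, mul_zero, mul_zero]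

end

end SuperInv

namespace SuperInv

open Classical in
section

/-! ### Signed sums over stabilizers in the group algebra of the symmetric group -/

/-- The group algebra of the symmetric group. -/
abbrev PermAlg (d : ℕ) : Type := MonoidAlgebra ℂ (Equiv.Perm (Fin d))

/-- The element of the group algebra given by a permutation. -/
noncomputable abbrev el {d : ℕ} : Equiv.Perm (Fin d) →* PermAlg d :=
  MonoidAlgebra.of ℂ (Equiv.Perm (Fin d))

/-- A sign as a complex number. -/
noncomputable def sg : ℤˣ →* ℂ := (Int.castRingHom ℂ).toMonoidHom.comp (Units.coeHom ℤ)

theorem sg_apply (u : ℤˣ) : sg u = ((u : ℤ) : ℂ) := rfl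

@[simp]
theorem sg_neg_one : sg (-1) = -1 := by simp [sg_apply]

theorem sg_mul_self (u : ℤˣ) : sg u * sg u = 1 := by
  rw [← map_mul, Int.units_mul_self, map_one]

variable {d : ℕ} {ι κ : Type*}

/-- The stabilizer of a function on the positions. -/
noncomputable def stab (f : Fin d → ι) : Finset (Equiv.Perm (Fin d)) :=
  Finset.univ.filter fun σ => f ∘ ⇑σ = f

@[simp]
theorem mem_stab {f : Fin d → ι} {σ : Equiv.Perm (Fin d)} : σ ∈ stab f ↔ f ∘ ⇑σ = f := by
  simp [stab]

/-- The sum of `χ(σ) σ` over the stabilizer of a function. -/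
noncomputable def stabSum (χ : Equiv.Perm (Fin d) →* ℤˣ) (f : Fin d → ι) : PermAlg d :=
  ∑ σ ∈ stab f, sg (χ σ) • el σ

theorem el_mul_stabSum_comp (χ : Equiv.Perm (Fin d) →* ℤˣ) (f : Fin d → ι)
    (ρ : Equiv.Perm (Fin d)) : stabSum χ f * el ρ = el ρ * stabSum χ (f ∘ ρ) := by
  rw [stabSum, stabSum, Finset.sum_mul, Finset.mul_sum]
  refine Finset.sum_nbij' (fun σ => ρ⁻¹ * σ * ρ) (fun σ => ρ * σ * ρ⁻¹) ?_ ?_ ?_ ?_ ?_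
  · intro σ hσ
    rw [mem_stab] at hσ ⊢
    funext x
    simpa using congrFun hσ (ρ x)
  · intro σ hσ
    rw [mem_stab] at hσ ⊢
    funext x
    simpa using congrFun hσ (ρ⁻¹ x)
  · intro σ _
    group
  · intro σ _
    group
  · intro σ _
    have h : χ (ρ⁻¹ * σ * ρ) = χ σ := by
      rw [map_mul, map_mul, mul_comm, ← mul_assoc, ← map_mul, mul_inv_cancel, map_one, one_mul]
    rw [h, smul_mul_assoc, mul_smul_comm, ← map_mul, ← map_mul]
    congr 2
    group

theorem el_mul_stabSum (χ : Equiv.Perm (Fin d) →* ℤˣ) (f : Fin d → ι) (ρ : Equiv.Perm (Fin d))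
    (hρ : f ∘ ρ = f) : el ρ * stabSum χ f = sg (χ ρ) • stabSum χ f := by
  rw [stabSum, Finset.mul_sum, Finset.smul_sum]
  refine Finset.sum_nbij' (fun σ => ρ * σ) (fun σ => ρ⁻¹ * σ) ?_ ?_ ?_ ?_ ?_
  · intro σ hσ
    rw [mem_stab] at hσ ⊢
    rw [Equiv.Perm.coe_mul, ← Function.comp_assoc, hρ, hσ]
  · intro σ hσ
    rw [mem_stab] at hσ ⊢
    funext x
    have h1 := congrFun hρ (ρ⁻¹ (σ x))
    have h2 := congrFun hσ x
    have h3 : ρ (ρ⁻¹ (σ x)) = σ x := by simp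
    rw [Function.comp_apply, h3] at h1
    exact h1.symm.trans h2
  · intro σ _
    group
  · intro σ _
    group
  · intro σ _
    rw [mul_smul_comm, ← map_mul, smul_smul, map_mul χ, map_mul sg, ← mul_assoc, sg_mul_self,
      one_mul]

theorem stabSum_mul_el (χ : Equiv.Perm (Fin d) →* ℤˣ) (f : Fin d → ι) (ρ : Equiv.Perm (Fin d))
    (hρ : f ∘ ρ = f) : stabSum χ f * el ρ = sg (χ ρ) • stabSum χ f := by
  rw [el_mul_stabSum_comp, hρ, el_mul_stabSum _ _ _ hρ]

theorem comp_swap_eq {f : Fin d → ι} {x y : Fin d} (h : f x = f y) :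
    f ∘ (Equiv.swap x y : Equiv.Perm (Fin d)) = f := by
  funext z
  rw [Function.comp_apply, Equiv.swap_apply_def]
  split_ifs with h1 h2
  · rw [h1, h]
  · rw [h2, h]
  · rfl

/-- The pigeonhole principle for products of opposite symmetrizers. -/
theorem stabSum_mul_stabSum_eq_zero (χ χ' : Equiv.Perm (Fin d) →* ℤˣ) (f : Fin d → ι)
    (g : Fin d → κ) {x y : Fin d} (hf : f x = f y) (hg : g x = g y)
    (hχ : χ (Equiv.swap x y) * χ' (Equiv.swap x y) = -1) :
    stabSum χ f * stabSum χ' g = 0 := by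
  set s := Equiv.swap x y
  have h1 := stabSum_mul_el χ f s (comp_swap_eq hf)
  have h2 := el_mul_stabSum χ' g s (comp_swap_eq hg)
  have h : stabSum χ f * stabSum χ' g = -(stabSum χ f * stabSum χ' g) := by
    calc stabSum χ f * stabSum χ' g = (stabSum χ f * el s) * (el s * stabSum χ' g) := by
          rw [mul_assoc, ← mul_assoc (el s), ← map_mul, Equiv.swap_mul_self, map_one, one_mul]
      _ = (sg (χ s * χ' s)) • (stabSum χ f * stabSum χ' g) := by
          rw [h1, h2, smul_mul_smul_comm, map_mul]
      _ = _ := by rw [hχ, sg_neg_one, neg_one_smul]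
  have h' : (2 : ℂ) • (stabSum χ f * stabSum χ' g) = 0 := by
    rw [two_smul]
    nth_rewrite 1 [h]
    simp
  exact (smul_eq_zero.1 h').resolve_left two_ne_zero

/-- The symmetrizer of the fibres of a function. -/
noncomputable abbrev symSum (f : Fin d → ι) : PermAlg d := stabSum 1 f

/-- The antisymmetrizer of the fibres of a function. -/
noncomputable abbrev altSum (f : Fin d → ι) : PermAlg d := stabSum Equiv.Perm.sign f

/-! ### Highest weight vectors -/

/-- Invariance under the stabilizer of `r`. -/
def RowInvariant (r : Fin d → ι) (v : PermAlg d) : Prop :=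
  ∀ σ : Equiv.Perm (Fin d), r ∘ σ = r → el σ * v = v

/-- The sum of the transpositions of `x` with the elements of the row `i`, when `x` is moved
into this row. -/
noncomputable def raiseSum (r : Fin d → ι) (x : Fin d) (i : ι) : PermAlg d :=
  ∑ y : Fin d with Function.update r x i y = i, el (Equiv.swap x y)

theorem symSum_mul_of_rowInvariant {r : Fin d → ι} {v : PermAlg d} (hv : RowInvariant r v) :
    symSum r * v = ((stab r).card : ℂ) • v := by
  rw [symSum, stabSum, Finset.sum_mul, Finset.sum_congr rfl (g := fun _ => v)]
  · rw [Finset.sum_const, ← Nat.cast_smul_eq_nsmul ℂ]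
  · intro σ hσ
    rw [mem_stab] at hσ
    rw [MonoidHom.one_apply, map_one, one_smul, hv σ hσ]

theorem card_stab_ne_zero (r : Fin d → ι) :
    ((stab r).card : ℂ) ≠ 0 := by
  rw [Nat.cast_ne_zero]
  exact Finset.card_ne_zero_of_mem (a := 1) (by simp)

theorem rowInvariant_symSum_mul (r : Fin d → ι) (q : PermAlg d) :
    RowInvariant r (symSum r * q) := by
  intro σ hσ
  rw [← mul_assoc, el_mul_stabSum _ _ _ hσ, MonoidHom.one_apply, map_one, one_smul]

/-- Decompose the stabilizer of the new row function by the image `y` of `x`. Each `π` is the swap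
of `x` and `y` times a permutation fixing `x`; the latter also preserves the old rows, so it fixes
`v`. The constant is the order of the stabilizer of `x`, hence nonzero. -/
theorem symSum_update_mul {r : Fin d → ι} {v : PermAlg d} (hv : RowInvariant r v) (x : Fin d)
    (i : ι) : ∃ c : ℂ, c ≠ 0 ∧
      symSum (Function.update r x i) * v = c • (raiseSum r x i * v) := by
  set r' := Function.update r x i with hr'
  have hx : r' x = i := by simp [hr']
  refine ⟨(((stab r').filter fun π => π x = x).card : ℂ), ?_, ?_⟩
  · rw [Nat.cast_ne_zero]
    exact Finset.card_ne_zero_of_mem (a := 1) (by simp)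
  have h1 : ∀ π : Equiv.Perm (Fin d), r' ∘ π = r' →
      el π * v = el (Equiv.swap x (π x)) * v := by
    intro π hπ
    have e : π = Equiv.swap x (π x) * (Equiv.swap x (π x) * π) := by
      rw [← mul_assoc, Equiv.swap_mul_self, one_mul]
    have hπx : r' (π x) = r' x := congrFun hπ x
    have h2 : r ∘ (Equiv.swap x (π x) * π : Equiv.Perm (Fin d)) = r := by
      have h3 : r' ∘ (Equiv.swap x (π x) * π : Equiv.Perm (Fin d)) = r' := by
        rw [Equiv.Perm.coe_mul, ← Function.comp_assoc, comp_swap_eq hπx.symm, hπ]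
      funext z
      by_cases hz : z = x
      · simp [hz]
      · have h4 := congrFun h3 z
        have h5 : (Equiv.swap x (π x) * π : Equiv.Perm (Fin d)) z ≠ x := by
          intro h6
          apply hz
          apply (Equiv.swap x (π x) * π : Equiv.Perm (Fin d)).injective
          rw [h6]
          simp
        rw [Function.comp_apply, hr', Function.update_of_ne h5, Function.update_of_ne hz] at h4
        exact h4
    nth_rewrite 1 [e]
    rw [map_mul, mul_assoc, hv _ h2]
  rw [symSum, stabSum, Finset.sum_mul, raiseSum, Finset.sum_mul, Finset.smul_sum]
  rw [← Finset.sum_fiberwise_of_maps_to (t := {y : Fin d | r' y = i}) (g := fun π => π x)]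
  · refine Finset.sum_congr rfl fun y hy => ?_
    simp only [Finset.mem_filter, Finset.mem_univ, true_and] at hy
    rw [Finset.sum_congr rfl (g := fun _ => el (Equiv.swap x y) * v)]
    · rw [Finset.sum_const, ← Nat.cast_smul_eq_nsmul ℂ]
      congr 2
      have hs : r' ∘ (Equiv.swap x y : Equiv.Perm (Fin d)) = r' := comp_swap_eq (hx.trans hy.symm)
      refine Finset.card_nbij' (fun π => Equiv.swap x y * π) (fun π => Equiv.swap x y * π)
        ?_ ?_ ?_ ?_
      · intro π hπ
        rw [Finset.mem_coe, Finset.mem_filter, mem_stab] at hπ ⊢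
        refine ⟨?_, by simp [hπ.2]⟩
        rw [Equiv.Perm.coe_mul, ← Function.comp_assoc, hs, hπ.1]
      · intro π hπ
        rw [Finset.mem_coe, Finset.mem_filter, mem_stab] at hπ ⊢
        refine ⟨?_, by simp [hπ.2]⟩
        rw [Equiv.Perm.coe_mul, ← Function.comp_assoc, hs, hπ.1]
      · intro π _
        simp
      · intro π _
        simp
    · intro π hπ
      rw [Finset.mem_filter, mem_stab] at hπ
      rw [MonoidHom.one_apply, map_one, one_smul, h1 π hπ.1, hπ.2]
  · intro π hπ
    rw [mem_stab] at hπ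
    simp only [Finset.mem_filter, Finset.mem_univ, true_and]
    rw [← hx]
    exact congrFun hπ x

/-- Annihilation by all raising operators. -/
def Raised (r : Fin d → Fin d) (v : PermAlg d) : Prop :=
  ∀ x i, i < r x → raiseSum r x i * v = 0

theorem exists_lt_of_comp_ne (r : Fin d → Fin d) (g : Equiv.Perm (Fin d)) (h : r ∘ g ≠ r) :
    ∃ x, r x < r (g x) := by
  by_contra! hc
  apply h
  have h1 : ∑ x, (r (g x) : ℕ) = ∑ x, (r x : ℕ) := Equiv.sum_comp g fun x => (r x : ℕ)
  have h2 := (Finset.sum_eq_sum_iff_of_le (s := Finset.univ) (f := fun x => (r (g x) : ℕ))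
    (g := fun x => (r x : ℕ)) fun x _ => hc x).1 h1
  funext x
  exact Fin.ext (h2 x (Finset.mem_univ x))

/-- The compression of a permutation acts on highest weight vectors by a scalar that depends
only on the weight. -/
theorem exists_scalar_compress (r : Fin d → Fin d) (g : Equiv.Perm (Fin d)) :
    ∃ c : ℂ, ∀ v, RowInvariant r v → Raised r v → symSum r * (el g * v) = c • v := by
  induction hn : Finset.card {x : Fin d | r x ≠ r (g⁻¹ x)} using Nat.strong_induction_on
    generalizing g with
  | _ N ih =>
  by_cases hg : r ∘ ⇑g⁻¹ = r
  · refine ⟨((stab r).card : ℂ), fun v hv _ => ?_⟩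
    have hg' : r ∘ ⇑g = r := by
      conv_lhs => rw [← hg]
      funext x
      simp
    rw [hv g hg', symSum_mul_of_rowInvariant hv]
  -- Position `x` receives an element `x₀` of a later row. Raising `x₀` into the row of `x`
  -- annihilates `v`; multiplying this identity by `g` and symmetrizing expresses the compression of
  -- `g` through better permutations.
  obtain ⟨x, hx⟩ := exists_lt_of_comp_ne r g⁻¹ hg
  set x₀ := g⁻¹ x with hx₀
  have hgx : g x₀ = x := by simp [hx₀]
  set i := r x with hi
  set A : Finset (Fin d) := {y | r y = i ∧ r (g y) = i} with hA
  set C : Finset (Fin d) := {y | r y = i ∧ r (g y) ≠ i} with hC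
  have hset : raiseSum r x₀ i = ∑ y ∈ insert x₀ (A ∪ C), el (Equiv.swap x₀ y) := by
    refine Finset.sum_congr (Finset.ext fun y => ?_) fun _ _ => rfl
    simp only [Finset.mem_filter, Finset.mem_univ, true_and, Finset.mem_insert,
      Finset.mem_union, hA, hC]
    by_cases hy : y = x₀
    · simp [hy]
    · rw [Function.update_of_ne hy]
      tauto
  have hx₀n : x₀ ∉ A ∪ C := by
    simp only [Finset.mem_union, Finset.mem_filter, Finset.mem_univ, true_and, hA, hC]
    have := hx.ne'
    tauto
  have hdisj : Disjoint A C := by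
    rw [Finset.disjoint_left]
    intro y h1 h2
    simp only [Finset.mem_filter, Finset.mem_univ, true_and, hA, hC] at h1 h2
    exact h2.2 h1.2
  -- For `y ∈ C`, the modified permutation sends `y` to `x` and `x₀` to `g y`. Now `x` is no longer
  -- displaced, while `g y` was displaced before, so the induction applies. The scalar is obtained
  -- before `v` is given.
  have hIH : ∀ y, ∃ c : ℂ, y ∈ C → ∀ v, RowInvariant r v → Raised r v →
      symSum r * (el (Equiv.swap x (g y) * g) * v) = c • v := by
    intro y
    by_cases hy : y ∈ C
    · have hy' := hy
      simp only [Finset.mem_filter, Finset.mem_univ, true_and, hC] at hy'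
      obtain ⟨c, hc⟩ := ih _ (by
        rw [← hn]
        apply Finset.card_lt_card
        rw [Finset.ssubset_iff_of_subset]
        · refine ⟨x, ?_, ?_⟩
          · simp only [Finset.mem_filter, Finset.mem_univ, true_and]
            exact hx.ne
          · simp [hy'.1, hi]
        · intro z
          simp only [Finset.mem_filter, Finset.mem_univ, true_and, mul_inv_rev,
            Equiv.Perm.mul_apply, Equiv.swap_inv]
          intro hz
          by_cases h1 : z = x
          · rw [h1]; exact hx.ne
          · by_cases h2 : z = g y
            · rw [h2]; simpa [hy'.1] using hy'.2
            · rwa [Equiv.swap_apply_of_ne_of_ne h1 h2] at hz) (Equiv.swap x (g y) * g) rfl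
      exact ⟨c, fun _ => hc⟩
    · exact ⟨0, fun h => absurd h hy⟩
  choose c hc using hIH
  refine ⟨(1 + (A.card : ℂ))⁻¹ * (-∑ y ∈ C, c y), fun v hv hr => ?_⟩
  have h0 : symSum r * (el g * (raiseSum r x₀ i * v)) = 0 := by
    rw [hr x₀ i hx, mul_zero, mul_zero]
  have hterm : ∀ y, symSum r * (el g * (el (Equiv.swap x₀ y) * v)) =
      symSum r * (el (Equiv.swap x (g y) * g) * v) := by
    intro y
    rw [← mul_assoc (el g), ← map_mul, Equiv.mul_swap_eq_swap_mul, hgx]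
  have hAt : ∀ y ∈ A, symSum r * (el (Equiv.swap x (g y) * g) * v) =
      symSum r * (el g * v) := by
    intro y hy
    simp only [Finset.mem_filter, Finset.mem_univ, true_and, hA] at hy
    rw [map_mul, mul_assoc, ← mul_assoc (symSum r), stabSum_mul_el _ _ _
      (comp_swap_eq (hi.symm.trans hy.2.symm)), MonoidHom.one_apply, map_one, one_smul]
  rw [hset, Finset.sum_mul, Finset.mul_sum, Finset.mul_sum, Finset.sum_insert hx₀n,
    Finset.sum_union hdisj, hterm, hgx, Equiv.swap_self] at h0
  rw [Finset.sum_congr rfl fun y hy => (hterm y).trans (hAt y hy),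
    Finset.sum_congr rfl fun y hy => (hterm y).trans (hc y hy v hv hr), Finset.sum_const,
    ← Finset.sum_smul, ← Nat.cast_smul_eq_nsmul ℂ] at h0
  -- The summand `1` is the term `y = x₀`, where the swap is the identity. The terms in `A` agree
  -- with it because the row symmetrizer absorbs the swap of `x` and `g y`.
  have h1 : (1 + (A.card : ℂ)) • (symSum r * (el g * v)) = (-∑ y ∈ C, c y) • v := by
    rw [add_smul, one_smul, neg_smul, eq_neg_iff_add_eq_zero, add_assoc]
    exact h0
  have h2 : (1 + (A.card : ℂ)) ≠ 0 := by
    have : ((1 + A.card : ℕ) : ℂ) ≠ 0 := Nat.cast_ne_zero.2 (by omega)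
    simpa using this
  rw [mul_smul, ← h1, smul_smul, inv_mul_cancel₀ h2, one_smul]

end

end SuperInv

namespace SuperInv

open Classical in
section

/-! ### Young symmetrizers of arbitrary shape -/

variable {d : ℕ} {ι κ : Type*}

/-- Raising amounts to symmetrizing over the modified rows. After moving a row permutation `σ` to
the left, the cell `σ⁻¹ x` shares its new row with a cell of its own column, so symmetrizer times
antisymmetrizer vanishes. -/
theorem raised_symSum_mul_altSum (r : Fin d → Fin d) (c : Fin d → κ)
    (hshape : ∀ x i, i < r x → ∃ y, r y = i ∧ c y = c x) :
    Raised r (symSum r * altSum c) := by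
  intro x i hi
  obtain ⟨a, ha, h⟩ := symSum_update_mul (rowInvariant_symSum_mul r (altSum c)) x i
  have h0 : symSum (Function.update r x i) * (symSum r * altSum c) = 0 := by
    have e : symSum r * altSum c = ∑ σ ∈ stab r, el σ * altSum c := by
      rw [symSum, stabSum, Finset.sum_mul]
      refine Finset.sum_congr rfl fun σ _ => ?_
      rw [MonoidHom.one_apply, map_one, one_smul]
    rw [e, Finset.mul_sum]
    refine Finset.sum_eq_zero fun σ hσ => ?_
    rw [mem_stab] at hσ
    rw [← mul_assoc, el_mul_stabSum_comp, mul_assoc]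
    have hσx : σ (σ⁻¹ x) = x := by simp
    have hr : r (σ⁻¹ x) = r x := by
      have := congrFun hσ (σ⁻¹ x)
      rw [Function.comp_apply, hσx] at this
      exact this.symm
    obtain ⟨y, hy, hcy⟩ := hshape (σ⁻¹ x) i (by rw [hr]; exact hi)
    have hry : r (σ y) = i := (congrFun hσ y).trans hy
    have hσy : σ y ≠ x := by
      rintro rfl
      exact hi.ne hry.symm
    have hne : σ⁻¹ x ≠ y := by
      intro e
      rw [e] at hσx
      exact hσy hσx
    rw [stabSum_mul_stabSum_eq_zero 1 Equiv.Perm.sign _ c (x := σ⁻¹ x) (y := y) ?_ hcy.symm,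
      mul_zero]
    · rw [MonoidHom.one_apply, one_mul, Equiv.Perm.sign_swap hne]
    · rw [Function.comp_apply, Function.comp_apply, hσx, Function.update_self,
        Function.update_of_ne hσy, hry]
  rw [h0] at h
  exact (smul_eq_zero.1 h.symm).resolve_left ha

theorem trace_mulLeft (x : PermAlg d) :
    LinearMap.trace ℂ _ (LinearMap.mulLeft ℂ x) =
      (Fintype.card (Equiv.Perm (Fin d)) : ℂ) * x.coeff 1 := by
  let b : Module.Basis (Equiv.Perm (Fin d)) ℂ (PermAlg d) :=
    ⟨MonoidAlgebra.coeffLinearEquiv ℂ⟩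
  rw [LinearMap.trace_eq_matrix_trace ℂ b, Matrix.trace]
  have h : ∀ g, LinearMap.toMatrix b b (LinearMap.mulLeft ℂ x) g g = x.coeff 1 := by
    intro g
    rw [LinearMap.toMatrix_apply]
    have hb : b g = MonoidAlgebra.single g (1 : ℂ) := by
      apply b.repr.injective
      rw [b.repr_self]
      rfl
    rw [hb, LinearMap.mulLeft_apply]
    change (x * MonoidAlgebra.single g (1 : ℂ)).coeff g = _
    rw [MonoidAlgebra.coeff_mul_single_eq_coeff_mul 1 fun m' _ => mul_eq_right, mul_one]
  refine (Finset.sum_congr rfl fun g _ => h g).trans ?_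
  rw [Finset.sum_const, nsmul_eq_mul, Finset.card_univ]

theorem coeff_one_symSum_mul_altSum (r : Fin d → ι) (c : Fin d → κ)
    (hinj : ∀ x y, r x = r y → c x = c y → x = y) :
    (symSum r * altSum c).coeff 1 = 1 := by
  have key : ∀ σ τ : Equiv.Perm (Fin d), r ∘ ⇑σ = r → c ∘ ⇑τ = c → σ * τ = 1 →
      σ = 1 ∧ τ = 1 := by
    intro σ τ hσ hτ h
    have hσ1 : σ = 1 := by
      ext1 x
      refine hinj _ _ (congrFun hσ x) ?_
      have := congrFun hτ (σ x)
      have h' : τ (σ x) = x := by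
        have : τ * σ = 1 := by rw [← mul_eq_one_comm]; exact h
        simpa using congrArg (fun g : Equiv.Perm (Fin d) => g x) this
      rw [Function.comp_apply, h'] at this
      exact this.symm
    exact ⟨hσ1, by rwa [hσ1, one_mul] at h⟩
  let L : PermAlg d →ₗ[ℂ] ℂ :=
    (Finsupp.lapply 1).comp (MonoidAlgebra.coeffLinearEquiv ℂ).toLinearMap
  have hL : ∀ g, L (el g) = if g = 1 then 1 else 0 := fun g => by
    change (MonoidAlgebra.single g (1 : ℂ)).coeff 1 = _
    rw [MonoidAlgebra.coeff_single, Finsupp.single_apply]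
  change L _ = 1
  rw [symSum, altSum, stabSum, stabSum, Finset.sum_mul_sum, map_sum,
    Finset.sum_eq_single_of_mem 1 (by simp), map_sum, Finset.sum_eq_single_of_mem 1 (by simp)]
  · simp only [map_one, one_smul, mul_one]
    rw [← map_one el, hL, if_pos rfl]
  · intro τ hτ hne
    rw [smul_mul_smul_comm, ← map_mul el, map_smul, hL, if_neg, smul_zero]
    exact fun h => hne (key 1 τ (by simp) (mem_stab.1 hτ) h).2
  · intro σ hσ hne
    rw [map_sum]
    refine Finset.sum_eq_zero fun τ hτ => ?_
    rw [smul_mul_smul_comm, ← map_mul el, map_smul, hL, if_neg, smul_zero]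
    exact fun h => hne (key σ τ (mem_stab.1 hσ) (mem_stab.1 hτ) h).1

/-- By `exists_scalar_compress` the scalar is the same for every highest weight vector, and `symSum
r * altSum c` is one of them. Were the scalar zero, this element would have square zero and left
multiplication by it would have trace zero. But its coefficient at `1` is `1`, because no nontrivial
permutation preserves both rows and columns, so the trace is `d!`. -/
theorem exists_symSum_mul_altSum_scalar (r : Fin d → Fin d) (c : Fin d → κ)
    (hinj : ∀ x y, r x = r y → c x = c y → x = y)
    (hshape : ∀ x i, i < r x → ∃ y, r y = i ∧ c y = c x) :
    ∃ a : ℂ, a ≠ 0 ∧ ∀ v, RowInvariant r v → Raised r v →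
      symSum r * (altSum c * v) = a • v := by
  choose s hs using exists_scalar_compress r
  have h1 : ∀ v, RowInvariant r v → Raised r v →
      symSum r * (altSum c * v) = (∑ τ ∈ stab c, sg (Equiv.Perm.sign τ) * s τ) • v := by
    intro v hv hr
    rw [altSum, stabSum, Finset.sum_mul, Finset.mul_sum, Finset.sum_smul]
    refine Finset.sum_congr rfl fun τ _ => ?_
    rw [smul_mul_assoc, mul_smul_comm, hs τ v hv hr, smul_smul]
  refine ⟨_, ?_, h1⟩
  intro h0
  rw [h0] at h1
  have h2 := h1 _ (rowInvariant_symSum_mul r (altSum c)) (raised_symSum_mul_altSum r c hshape)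
  rw [zero_smul, ← mul_assoc] at h2
  have hn : IsNilpotent (LinearMap.mulLeft ℂ (symSum r * altSum c)) := by
    refine ⟨2, ?_⟩
    rw [pow_two]
    refine LinearMap.ext fun v => ?_
    simp only [Module.End.mul_apply, LinearMap.mulLeft_apply, LinearMap.zero_apply]
    rw [← mul_assoc, h2, zero_mul]
  have h3 := LinearMap.isNilpotent_trace_of_isNilpotent hn
  rw [isNilpotent_iff_eq_zero, trace_mulLeft, coeff_one_symSum_mul_altSum r c hinj, mul_one] at h3
  exact Nat.cast_ne_zero.2 Fintype.card_ne_zero h3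

/-! ### Vectors of dominant weight in left ideals -/

/-- The number of elements of a row. -/
noncomputable def rowSize (r : Fin d → Fin d) (i : Fin d) : ℕ := Finset.card {x | r x = i}

theorem stab_comp_injective (r : Fin d → ι) (e : ι → κ) (he : Function.Injective e) :
    stab (e ∘ r) = stab r := by
  ext σ
  simp only [mem_stab, funext_iff, Function.comp_apply, he.eq_iff]

theorem rowSize_update (r : Fin d → Fin d) (x : Fin d) (i k : Fin d) :
    (rowSize (Function.update r x i) k : ℤ) =
      rowSize r k + (if i = k then 1 else 0) - if r x = k then 1 else 0 := by
  rw [rowSize, rowSize, Finset.card_filter, Finset.card_filter,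
    ← Finset.add_sum_erase _ _ (Finset.mem_univ x),
    ← Finset.add_sum_erase _ (fun y => if r y = k then 1 else 0) (Finset.mem_univ x),
    Function.update_self]
  have : ∑ y ∈ Finset.univ.erase x, (if Function.update r x i y = k then 1 else 0) =
      ∑ y ∈ Finset.univ.erase x, (if r y = k then 1 else 0) := by
    refine Finset.sum_congr rfl fun y hy => ?_
    rw [Function.update_of_ne (Finset.ne_of_mem_erase hy)]
  rw [this]
  push_cast
  ring

theorem sum_rowSize_sq_update_lt (r : Fin d → Fin d) (x i : Fin d) (hi : i ≠ r x)
    (h : rowSize r (r x) ≤ rowSize r i) :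
    ∑ k, rowSize r k ^ 2 < ∑ k, rowSize (Function.update r x i) k ^ 2 := by
  have e : ∀ k, (rowSize (Function.update r x i) k : ℤ) ^ 2 = (rowSize r k : ℤ) ^ 2 +
      (if i = k then 2 * (rowSize r k : ℤ) + 1 else 0) +
      (if r x = k then 1 - 2 * (rowSize r k : ℤ) else 0) := by
    intro k
    rw [rowSize_update]
    by_cases h1 : i = k
    · have h2 : r x ≠ k := fun h2 => hi (h1.trans h2.symm)
      simp only [h1, if_true, h2, if_false]
      ring
    · by_cases h2 : r x = k
      · simp only [h1, if_false, h2, if_true]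
        ring
      · simp [h1, h2]
  zify
  simp only [e, Finset.sum_add_distrib, Finset.sum_ite_eq, Finset.mem_univ, if_true]
  have : (rowSize r (r x) : ℤ) ≤ rowSize r i := by exact_mod_cast h
  linarith

theorem exists_column_function (r : Fin d → Fin d) :
    ∃ c : Fin d → ℕ, (∀ x y, r x = r y → c x = c y → x = y) ∧ (∀ x, c x < rowSize r (r x)) ∧
      ∀ i k, k < rowSize r i → ∃ y, r y = i ∧ c y = k := by
  have hc : ∀ i, Fintype.card {x // r x = i} = rowSize r i := fun i => by
    exact Fintype.card_of_subtype _ (by simp)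
  let E : ∀ i, {x // r x = i} ≃ Fin (rowSize r i) := fun i => Fintype.equivFinOfCardEq (hc i)
  have hE : ∀ x i (h : r x = i), (E (r x) ⟨x, rfl⟩ : ℕ) = E i ⟨x, h⟩ := by
    rintro x _ rfl; rfl
  refine ⟨fun x => E (r x) ⟨x, rfl⟩, ?_, fun x => (E (r x) ⟨x, rfl⟩).2, ?_⟩
  · intro x y h h'
    dsimp only at h'
    rw [hE x _ h] at h'
    have := (E (r y)).injective (Fin.ext h')
    exact congrArg Subtype.val this
  · intro i k hk
    refine ⟨(E i).symm ⟨k, hk⟩, ((E i).symm ⟨k, hk⟩).2, ?_⟩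
    dsimp only
    rw [hE _ i ((E i).symm ⟨k, hk⟩).2]
    simp

/-- Every nonzero left ideal is not annihilated by some Young symmetrizer. -/
theorem exists_youngSymmetrizer_ne_zero (Q : Ideal (PermAlg d)) (hQ : Q ≠ ⊥) :
    ∃ (r : Fin d → Fin d) (c : Fin d → ℕ),
      (∀ i j, i ≤ j → rowSize r j ≤ rowSize r i) ∧
      (∀ x, c x < rowSize r (r x)) ∧
      (∀ i k, k < rowSize r i → ∃ y, r y = i ∧ c y = k) ∧
      ∃ q ∈ Q, altSum c * (symSum r * q) ≠ 0 := by
  -- The weights occurring in `Q`. The identity row function always occurs, as its symmetrizer is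
  -- `1`.
  let S : Finset (Fin d → Fin d) := {r | ∃ q ∈ Q, symSum r * q ≠ 0}
  have hS : S.Nonempty := by
    obtain ⟨q, hq, hq0⟩ := Submodule.exists_mem_ne_zero_of_ne_bot hQ
    refine ⟨id, ?_⟩
    simp only [S, Finset.mem_filter, Finset.mem_univ, true_and]
    refine ⟨q, hq, ?_⟩
    have h1 : stab (id : Fin d → Fin d) = {1} := by
      ext σ
      rw [mem_stab, Finset.mem_singleton]
      constructor
      · intro h; ext1 x; exact congrFun h x
      · rintro rfl; rfl
    rw [symSum, stabSum, h1, Finset.sum_singleton]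
    rwa [MonoidHom.one_apply, map_one, one_smul, map_one, one_mul]
  obtain ⟨r₀, hr₀, hmax⟩ := S.exists_max_image (fun r => ∑ k, rowSize r k ^ 2) hS
  obtain ⟨r, hr, hrmax, hanti⟩ : ∃ r ∈ S, (∀ r' ∈ S, ∑ k, rowSize r' k ^ 2 ≤
      ∑ k, rowSize r k ^ 2) ∧ ∀ i j, i ≤ j → rowSize r j ≤ rowSize r i := by
    -- Relabelling the rows changes neither their stabilizer nor the sum of squares, so the rows may
    -- be taken in decreasing order of length.
    let s : Equiv.Perm (Fin d) := Tuple.sort fun i => OrderDual.toDual (rowSize r₀ i)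
    have hs : Monotone ((fun i => OrderDual.toDual (rowSize r₀ i)) ∘ s) := Tuple.monotone_sort _
    have hsize : ∀ i, rowSize (⇑s⁻¹ ∘ r₀) i = rowSize r₀ (s i) := by
      intro i
      rw [rowSize, rowSize]
      congr 1
      ext x
      simp only [Finset.mem_filter, Finset.mem_univ, true_and, Function.comp_apply]
      exact Equiv.Perm.inv_eq_iff_eq
    refine ⟨⇑s⁻¹ ∘ r₀, ?_, ?_, ?_⟩
    · simp only [S, Finset.mem_filter, Finset.mem_univ, true_and] at hr₀ ⊢
      rw [symSum, stabSum, stab_comp_injective _ _ s⁻¹.injective]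
      exact hr₀
    · have : ∑ k, rowSize (⇑s⁻¹ ∘ r₀) k ^ 2 = ∑ k, rowSize r₀ k ^ 2 := by
        simp only [hsize]
        exact Equiv.sum_comp s fun k => rowSize r₀ k ^ 2
      rw [this]
      exact hmax
    · intro i j hij
      rw [hsize, hsize]
      exact hs hij
  obtain ⟨c, hinj, hlt, hex⟩ := exists_column_function r
  refine ⟨r, c, hanti, hlt, hex, ?_⟩
  simp only [S, Finset.mem_filter, Finset.mem_univ, true_and] at hr
  obtain ⟨q, hq, hq0⟩ := hr
  refine ⟨q, hq, fun h0 => ?_⟩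
  have hinv := rowInvariant_symSum_mul r q
  -- Moving an element into an earlier, hence at least as long, row strictly increases the sum of
  -- squares; by maximality the corresponding symmetrizer annihilates `Q`.
  have hraised : Raised r (symSum r * q) := by
    intro x i hi
    obtain ⟨a, ha, h⟩ := symSum_update_mul hinv x i
    have h1 : symSum (Function.update r x i) * (symSum r * q) = 0 := by
      by_contra hne
      have hmem : Function.update r x i ∈ S := by
        simp only [S, Finset.mem_filter, Finset.mem_univ, true_and]
        exact ⟨_, Q.mul_mem_left _ hq, hne⟩
      exact absurd (hrmax _ hmem)
        (not_le.2 (sum_rowSize_sq_update_lt r x i hi.ne (hanti _ _ hi.le)))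
    rw [h1] at h
    exact (smul_eq_zero.1 h.symm).resolve_left ha
  obtain ⟨a, ha, h⟩ := exists_symSum_mul_altSum_scalar r c hinj fun x i hi =>
    hex i (c x) ((hlt x).trans_le (hanti _ _ hi.le))
  have h2 := h _ hinv hraised
  rw [h0, mul_zero] at h2
  exact hq0 ((smul_eq_zero.1 h2.symm).resolve_left ha)

end

end SuperInv

namespace SuperInv

open Classical in
section

/-! ### The annihilator of a tensor power in the group algebra -/

variable {d n m : ℕ}

/-- The signed sum over the stabilizer of a sequence of indices. -/
noncomputable def hookSum (K : Fin d → Idx n m) : PermAlg d :=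
  ∑ π ∈ stab K, koszul (pars K) π • el π

/-- The Young symmetrizer of a rectangular tableau, transported along an embedding. -/
noncomputable def rectSum {r c : ℕ} (t : RectTableau r c) (φ : Fin (r * c) ↪ Fin d) : PermAlg d :=
  ∑ σ ∈ t.rowStab, ∑ τ ∈ t.colStab,
    sg (Equiv.Perm.sign τ) • el (Equiv.Perm.viaEmbedding (σ * τ)⁻¹ φ)

/-- On positions of constant parity the Koszul sign is trivial or the usual sign, even if the
positions are not consecutive: this is `koszul_swap` extended by the cocycle identity. -/
theorem koszul_ofSubtype (f : Fin d → ℕ) (p : Fin d → Prop) [DecidablePred p] (a : ℕ)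
    (hp : ∀ x, p x → f x = a)
    (τ : Equiv.Perm {x // p x}) :
    koszul f (Equiv.Perm.ofSubtype τ) = sg (Equiv.Perm.sign τ) ^ (a * a) := by
  have hcomp : ∀ τ : Equiv.Perm {x // p x}, f ∘ ⇑(Equiv.Perm.ofSubtype τ) = f := by
    intro τ
    funext x
    by_cases hx : p x
    · rw [Function.comp_apply, Equiv.Perm.ofSubtype_apply_of_mem _ hx, hp _ (τ ⟨x, hx⟩).2, hp x hx]
    · rw [Function.comp_apply, Equiv.Perm.ofSubtype_apply_of_not_mem _ hx]
  induction τ using Equiv.Perm.swap_induction_on with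
  | one => simp
  | swap_mul g x y hxy ih =>
    rw [map_mul, koszul_mul, hcomp, ih, map_mul, map_mul, mul_pow, Equiv.Perm.sign_swap hxy,
      Equiv.Perm.ofSubtype_swap_eq, koszul_swap _ (fun h => hxy (Subtype.ext h))
      ((hp _ x.2).trans (hp _ y.2).symm), hp _ x.2, hp _ y.2, sg_neg_one]

/-- An element of the stabilizer of `K` is a product of a permutation of the even positions and one
of the odd positions. The first preserves rows and is absorbed by the row symmetrizer; the second
preserves columns and is absorbed by the column antisymmetrizer, its Koszul sign being cancelled by
its ordinary sign. -/
theorem altSum_hookSum_symSum {ι κ : Type*} (r : Fin d → ι) (c : Fin d → κ) (p : Fin d → Prop)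
    (K : Fin d → Idx n m) (hp : ∀ x, p x → parity (K x) = 0) (hp' : ∀ x, ¬ p x → parity (K x) = 1)
    (hr : ∀ x y, K x = K y → p x → r x = r y) (hc : ∀ x y, K x = K y → ¬ p x → c x = c y) :
    altSum c * (hookSum K * symSum r) = ((stab K).card : ℂ) • (altSum c * symSum r) := by
  rw [hookSum, Finset.sum_mul, Finset.mul_sum, Finset.sum_congr rfl
    (g := fun _ => altSum c * symSum r), Finset.sum_const, ← Nat.cast_smul_eq_nsmul ℂ]
  intro π hπ
  rw [mem_stab] at hπ
  have hπ' : ∀ x, K (π x) = K x := congrFun hπ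
  have hpar : ∀ x, p x ↔ parity (K x) = 0 := fun x =>
    ⟨hp x, fun h => by_contra fun h' => by simp [hp' x h'] at h⟩
  have h1 : ∀ x, p (π x) ↔ p x := fun x => by rw [hpar, hpar, hπ' x]
  have h2 : ∀ x, ¬ p (π x) ↔ ¬ p x := fun x => not_congr (h1 x)
  set π₁ := Equiv.Perm.ofSubtype (π.subtypePerm h1) with hπ₁
  set π₂ := Equiv.Perm.ofSubtype (π.subtypePerm (p := fun x => ¬ p x) h2) with hπ₂
  have hπ₂p : ∀ x, p x → π₂ x = x := fun x hx =>
    Equiv.Perm.ofSubtype_subtypePerm_of_not_mem (p := fun x => ¬ p x) h2 (not_not.2 hx)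
  have hπ₂n : ∀ x, ¬ p x → π₂ x = π x := fun x hx =>
    Equiv.Perm.ofSubtype_subtypePerm_of_mem (p := fun x => ¬ p x) h2 hx
  have e : π = π₂ * π₁ := by
    ext1 x
    by_cases hx : p x
    · rw [Equiv.Perm.mul_apply, hπ₁, Equiv.Perm.ofSubtype_subtypePerm_of_mem h1 hx, 
        hπ₂p _ ((h1 x).2 hx)]
    · rw [Equiv.Perm.mul_apply, hπ₁, Equiv.Perm.ofSubtype_subtypePerm_of_not_mem h1 hx,
        hπ₂n _ hx]
  have hr1 : r ∘ ⇑π₁ = r := by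
    funext x
    by_cases hx : p x
    · rw [Function.comp_apply, hπ₁, Equiv.Perm.ofSubtype_subtypePerm_of_mem h1 hx]
      exact (hr x (π x) (hπ' x).symm hx).symm
    · rw [Function.comp_apply, hπ₁, Equiv.Perm.ofSubtype_subtypePerm_of_not_mem h1 hx]
  have hc2 : c ∘ ⇑π₂ = c := by
    funext x
    by_cases hx : p x
    · rw [Function.comp_apply, hπ₂p _ hx]
    · rw [Function.comp_apply, hπ₂n _ hx]
      exact (hc x (π x) (hπ' x).symm hx).symm
  have hK2 : pars K ∘ ⇑π₂ = pars K := by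
    funext x
    by_cases hx : p x
    · rw [Function.comp_apply, hπ₂p _ hx]
    · rw [Function.comp_apply, hπ₂n _ hx]
      exact congrArg parity (hπ' x)
  have hk : koszul (pars K) π = sg (Equiv.Perm.sign π₂) := by
    rw [e, koszul_mul, hK2, hπ₁, hπ₂, koszul_ofSubtype _ p 0 hp,
      koszul_ofSubtype _ (fun x => ¬ p x) 1 hp',
      Equiv.Perm.sign_ofSubtype]
    simp
  rw [hk, smul_mul_assoc, mul_smul_comm, e, map_mul, mul_assoc, el_mul_stabSum 1 r π₁ hr1,
    MonoidHom.one_apply, map_one, one_smul, ← mul_assoc, stabSum_mul_el _ c π₂ hc2,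
    smul_mul_assoc, smul_smul, sg_mul_self, one_smul]

theorem comp_viaEmbedding {N : ℕ} {ι : Type*} (f : Fin d → ι) (φ : Fin N ↪ Fin d)
    (σ : Equiv.Perm (Fin N)) (h : ∀ α, f (φ (σ α)) = f (φ α)) :
    f ∘ ⇑(Equiv.Perm.viaEmbedding σ φ) = f := by
  funext x
  by_cases hx : x ∈ Set.range φ
  · obtain ⟨α, rfl⟩ := hx
    rw [Function.comp_apply, Equiv.Perm.viaEmbedding_apply, h]
  · rw [Function.comp_apply, Equiv.Perm.viaEmbedding_apply_of_notMem _ _ _ hx]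

theorem viaEmbedding_conj {N : ℕ} (φ ψ : Fin N ↪ Fin d) (g : Equiv.Perm (Fin d))
    (hg : ∀ α, g (φ α) = ψ α) (σ : Equiv.Perm (Fin N)) :
    Equiv.Perm.viaEmbedding σ ψ = g * Equiv.Perm.viaEmbedding σ φ * g⁻¹ := by
  rw [eq_mul_inv_iff_mul_eq]
  ext1 x
  rw [Equiv.Perm.mul_apply, Equiv.Perm.mul_apply]
  by_cases hx : x ∈ Set.range φ
  · obtain ⟨α, rfl⟩ := hx
    rw [Equiv.Perm.viaEmbedding_apply, hg, hg, Equiv.Perm.viaEmbedding_apply]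
  · rw [Equiv.Perm.viaEmbedding_apply_of_notMem _ φ _ hx,
      Equiv.Perm.viaEmbedding_apply_of_notMem]
    rintro ⟨α, h⟩
    rw [← hg] at h
    exact hx ⟨α, g.injective h⟩

theorem exists_perm_comp_eq {N : ℕ} (φ ψ : Fin N ↪ Fin d) :
    ∃ g : Equiv.Perm (Fin d), ∀ α, g (φ α) = ψ α := by
  let e : {x // x ∈ Set.range φ} ≃ {x // x ∈ Set.range ψ} :=
    (Equiv.ofInjective φ φ.injective).symm.trans (Equiv.ofInjective ψ ψ.injective)
  refine ⟨e.extendSubtype, fun α => ?_⟩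
  rw [Equiv.extendSubtype_apply_of_mem e (φ α) ⟨α, rfl⟩]
  have : (Equiv.ofInjective φ φ.injective).symm ⟨φ α, ⟨α, rfl⟩⟩ = α :=
    Equiv.ofInjective_symm_apply φ.injective α
  simp [e, this]

theorem sign_viaEmbedding {N : ℕ} (φ : Fin N ↪ Fin d) (σ : Equiv.Perm (Fin N)) :
    Equiv.Perm.sign (Equiv.Perm.viaEmbedding σ φ) = Equiv.Perm.sign σ := by
  rw [Equiv.Perm.viaEmbedding]
  convert Equiv.Perm.sign_extendDomain σ (Equiv.ofInjective φ.1 φ.2)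

theorem rectSum_conj {r c : ℕ} (t : RectTableau r c) (φ ψ : Fin (r * c) ↪ Fin d)
    (g : Equiv.Perm (Fin d)) (hg : ∀ α, g (φ α) = ψ α) :
    rectSum t ψ = el g * rectSum t φ * el g⁻¹ := by
  simp only [rectSum, Finset.mul_sum, Finset.sum_mul, mul_smul_comm, smul_mul_assoc, ← map_mul el,
    viaEmbedding_conj φ ψ g hg]

/-- In `(σ * τ)⁻¹` the column factor `τ⁻¹` stands on the left, next to `altSum c`, and the row
factor on the right, next to `symSum r`; both are absorbed, and every term contributes equally. -/
theorem altSum_rectSum_symSum {a b : ℕ} (t : RectTableau a b) (φ : Fin (a * b) ↪ Fin d)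
    {ι κ : Type*} (r : Fin d → ι) (c : Fin d → κ)
    (hr : ∀ α β, (t.symm α).1 = (t.symm β).1 → r (φ α) = r (φ β))
    (hc : ∀ α β, (t.symm α).2 = (t.symm β).2 → c (φ α) = c (φ β)) :
    altSum c * (rectSum t φ * symSum r) =
      ((t.rowStab.card * t.colStab.card : ℕ) : ℂ) • (altSum c * symSum r) := by
  rw [rectSum, Finset.sum_mul, Finset.mul_sum, Finset.sum_congr rfl
    (g := fun _ => (t.colStab.card : ℂ) • (altSum c * symSum r)), Finset.sum_const,
    ← Nat.cast_smul_eq_nsmul ℂ, smul_smul, Nat.cast_mul]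
  intro σ hσ
  rw [Finset.sum_mul, Finset.mul_sum, Finset.sum_congr rfl
    (g := fun _ => altSum c * symSum r), Finset.sum_const, ← Nat.cast_smul_eq_nsmul ℂ]
  intro τ hτ
  simp only [RectTableau.rowStab, RectTableau.colStab, Finset.mem_filter, Finset.mem_univ,
    true_and] at hσ hτ
  have hσ' : r ∘ ⇑(Equiv.Perm.viaEmbedding σ⁻¹ φ) = r := comp_viaEmbedding _ _ _ fun α => by
    apply hr
    have := hσ (σ⁻¹ α)
    simpa using this.symm
  have hτ' : c ∘ ⇑(Equiv.Perm.viaEmbedding τ⁻¹ φ) = c := comp_viaEmbedding _ _ _ fun α => by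
    apply hc
    have := hτ (τ⁻¹ α)
    simpa using this.symm
  have e : Equiv.Perm.viaEmbedding (σ * τ)⁻¹ φ =
      Equiv.Perm.viaEmbedding τ⁻¹ φ * Equiv.Perm.viaEmbedding σ⁻¹ φ := by
    rw [mul_inv_rev]
    exact map_mul (Equiv.Perm.viaEmbeddingHom φ) _ _
  rw [e, smul_mul_assoc, mul_smul_comm, map_mul, mul_assoc, el_mul_stabSum 1 r _ hσ',
    MonoidHom.one_apply, map_one, one_smul, ← mul_assoc, stabSum_mul_el _ c _ hτ',
    sign_viaEmbedding, Equiv.Perm.sign_inv, smul_mul_assoc, smul_smul, sg_mul_self, one_smul]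

variable (d) in
/-- The signed stabilizer sums of sequences of indices, and the Young symmetrizer of a
rectangular tableau. -/
def hookGenerators (t : RectTableau (n + 1) (m + 1)) : Set (PermAlg d) :=
  {e | (∃ K : Fin d → Idx n m, e = hookSum K) ∨
    ∃ h : (n + 1) * (m + 1) ≤ d, e = rectSum t (Fin.castLEEmb h)}

variable (d) in
/-- The hook theorem: the generators generate the group algebra as a two-sided ideal. -/
theorem span_hookGenerators (t : RectTableau (n + 1) (m + 1)) :
    Ideal.span {x : PermAlg d | ∃ e ∈ hookGenerators d t, ∃ g, x = e * el g} = ⊤ := by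
  set Y := Ideal.span {x : PermAlg d | ∃ e ∈ hookGenerators d t, ∃ g, x = e * el g} with hY
  by_contra htop
  -- The hypothesis of Maschke's theorem, which makes the left ideal `Y` complemented.
  have : NeZero (Nat.card (Equiv.Perm (Fin d)) : ℂ) :=
    ⟨Nat.cast_ne_zero.2 Nat.card_pos.ne'⟩
  obtain ⟨Q, hQ⟩ := exists_isCompl Y
  have hQ0 : Q ≠ ⊥ := by
    rintro rfl
    exact htop (by simpa using hQ.sup_eq_top)
  -- `Y` contains `e` times any element, and `Q` is a left ideal, so `e * q` lies in both
  -- complementary ideals.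
  have hkill : ∀ e ∈ hookGenerators d t, ∀ q ∈ Q, e * q = 0 := by
    intro e he q hq
    have h1 : e * q ∈ Y := by
      have hall : ∀ q : PermAlg d, e * q ∈ Y := by
        intro q
        induction q using MonoidAlgebra.induction_on with
        | of g => exact Ideal.subset_span ⟨e, he, g, rfl⟩
        | add f g hf hg => rw [mul_add]; exact Y.add_mem hf hg
        | smul a f hf =>
          rw [mul_smul_comm, ← one_mul (e * f), ← smul_mul_assoc]
          exact Y.mul_mem_left _ hf
      exact hall q
    exact (Submodule.disjoint_def.1 hQ.disjoint) _ h1 (Q.mul_mem_left _ hq)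
  obtain ⟨r, c, hanti, hlt, hex, q, hq, hne⟩ := exists_youngSymmetrizer_ne_zero Q hQ0
  have hsq : symSum r * q ∈ Q := Q.mul_mem_left _ hq
  -- it suffices to absorb an annihilating element between the two symmetrizers
  have habs : ∀ (e : PermAlg d) (a : ℂ), a ≠ 0 →
      altSum c * (e * symSum r) = a • (altSum c * symSum r) → e * (symSum r * q) ≠ 0 := by
    intro e a ha h h0
    have h1 : a • (altSum c * (symSum r * q)) = 0 := by
      rw [← mul_assoc (altSum c), ← smul_mul_assoc, ← h, mul_assoc, mul_assoc, h0, mul_zero]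
    exact hne ((smul_eq_zero.1 h1).resolve_left ha)
  -- Whether the diagram has a cell in row `n` and column `m`, counting from zero, that is, whether
  -- it contains the rectangle.
  by_cases hrect : ∃ hn : n < d, m + 1 ≤ rowSize r ⟨n, hn⟩
  · obtain ⟨hn, hm⟩ := hrect
    have hcell : ∀ x : Fin (n + 1) × Fin (m + 1), ∃ y, (r y : ℕ) = x.1 ∧ c y = x.2 := by
      intro x
      obtain ⟨y, hy1, hy2⟩ := hex ⟨x.1, by omega⟩ x.2 (by
        have h := hanti ⟨x.1, by omega⟩ ⟨n, hn⟩ (Fin.mk_le_mk.2 (by omega))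
        omega)
      exact ⟨y, by rw [hy1], hy2⟩
    choose f hf1 hf2 using hcell
    have hfinj : Function.Injective f := by
      intro x y h
      apply Prod.ext
      · apply Fin.ext
        rw [← hf1, ← hf1, h]
      · apply Fin.ext
        rw [← hf2, ← hf2, h]
    let φ : Fin ((n + 1) * (m + 1)) ↪ Fin d := ⟨f ∘ t.symm, hfinj.comp t.symm.injective⟩
    have hN : (n + 1) * (m + 1) ≤ d := by
      simpa using Fintype.card_le_of_embedding φ
    obtain ⟨g, hg⟩ := exists_perm_comp_eq (Fin.castLEEmb hN) φ
    refine habs (rectSum t φ) _ ?_ (altSum_rectSum_symSum t φ r c ?_ ?_) ?_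
    · refine Nat.cast_ne_zero.2 (mul_ne_zero ?_ ?_)
      · exact Finset.card_ne_zero_of_mem (a := 1) (by simp [RectTableau.rowStab])
      · exact Finset.card_ne_zero_of_mem (a := 1) (by simp [RectTableau.colStab])
    · intro α β h
      apply Fin.ext
      change (r (f (t.symm α)) : ℕ) = r (f (t.symm β))
      rw [hf1, hf1, h]
    · intro α β h
      change c (f (t.symm α)) = c (f (t.symm β))
      rw [hf2, hf2, h]
    · rw [rectSum_conj t _ φ g hg, mul_assoc, mul_assoc,
        hkill _ (Or.inr ⟨hN, rfl⟩) _ (Q.mul_mem_left _ hsq), mul_zero]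
  · have hcol : ∀ x, ¬ (r x : ℕ) < n → c x < m := by
      intro x hx
      have hn : n < d := by have := (r x).2; omega
      have h1 : ¬ m + 1 ≤ rowSize r ⟨n, hn⟩ := fun h => hrect ⟨hn, h⟩
      have h2 := hanti ⟨n, hn⟩ (r x) (by rw [Fin.le_def]; dsimp only; omega)
      have h3 := hlt x
      omega
    -- Even labels record the row in the first `n` rows. The remaining cells lie in the first `m`
    -- columns, and odd labels record their column.
    let K : Fin d → Idx n m := fun x =>
      if h : (r x : ℕ) < n then toLex (Sum.inl ⟨r x, h⟩) else toLex (Sum.inr ⟨c x, hcol x h⟩)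
    have hK1 : ∀ x (h : (r x : ℕ) < n), K x = toLex (Sum.inl ⟨r x, h⟩) := fun x h => dif_pos h
    have hK2 : ∀ x (h : ¬ (r x : ℕ) < n), K x = toLex (Sum.inr ⟨c x, hcol x h⟩) :=
      fun x h => dif_neg h
    refine habs (hookSum K) _ (card_stab_ne_zero K)
      (altSum_hookSum_symSum r c (fun x => (r x : ℕ) < n) K ?_ ?_ ?_ ?_)
      (hkill _ (Or.inl ⟨K, rfl⟩) _ hsq)
    · intro x hx
      rw [hK1 x hx]; rfl
    · intro x hx
      rw [hK2 x hx]; rfl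
    · intro x y h hx
      rw [hK1 x hx] at h
      by_cases hy : (r y : ℕ) < n
      · rw [hK1 y hy] at h
        have := Sum.inl_injective (toLex.injective h)
        exact Fin.ext (Fin.mk.inj_iff.1 this)
      · rw [hK2 y hy] at h
        exact absurd (toLex.injective h) Sum.inl_ne_inr
    · intro x y h hx
      rw [hK2 x hx] at h
      by_cases hy : (r y : ℕ) < n
      · rw [hK1 y hy] at h
        exact absurd (toLex.injective h) Sum.inr_ne_inl
      · rw [hK2 y hy] at h
        have := Sum.inr_injective (toLex.injective h)
        exact Fin.mk.inj_iff.1 this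

end

end SuperInv

namespace SuperInv

open Classical in
section

/-! ### Straightening -/

variable {N R C a b : ℕ} {E : Type*} [AddCommGroup E] [Module ℂ E]

/-- Semistandardness of a filling, with the entries of parity `s` strict down the columns and the
other entries strict along the rows. -/
def IsSemistd (s : ℕ) (t : Fin R × Fin C ≃ Fin N) (I : Fin N → Idx a b) : Prop :=
  (∀ i, Monotone fun j => I (t (i, j))) ∧
  (∀ j, Monotone fun i => I (t (i, j))) ∧
  (∀ j i i', i < i' → parity (I (t (i, j))) = s → parity (I (t (i', j))) = s →
    I (t (i, j)) < I (t (i', j))) ∧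
  (∀ i j j', j < j' → parity (I (t (i, j))) = 1 - s → parity (I (t (i, j'))) = 1 - s →
    I (t (i, j)) < I (t (i, j')))

theorem parity_le_one (z : Idx a b) : parity z ≤ 1 := by
  unfold parity
  generalize ofLex z = w
  cases w <;> simp

/-- The number of smaller indices. -/
noncomputable def idxRank (z : Idx a b) : ℕ := Finset.card {w : Idx a b | w < z}

theorem idxRank_strictMono : StrictMono (idxRank : Idx a b → ℕ) := by
  intro z w h
  apply Finset.card_lt_card
  rw [Finset.ssubset_iff_of_subset]
  · exact ⟨z, by simp [h], by simp⟩
  · intro u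
    simp only [Finset.mem_filter, Finset.mem_univ, true_and]
    exact fun hu => hu.trans h

/-- The statistic that increases under straightening. -/
noncomputable def fillWeight (t : Fin R × Fin C ≃ Fin N) (I : Fin N → Idx a b) : ℕ :=
  ∑ α, ((t.symm α).2 : ℕ) * idxRank (I α)

theorem fillWeight_le (t : Fin R × Fin C ≃ Fin N) (I : Fin N → Idx a b) :
    fillWeight t I ≤ ∑ _α : Fin N, C * Fintype.card (Idx a b) :=
  Finset.sum_le_sum fun α _ => Nat.mul_le_mul (t.symm α).2.2.le (Finset.card_le_univ _)

theorem fillWeight_comp_of_col (t : Fin R × Fin C ≃ Fin N) (I : Fin N → Idx a b)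
    (τ : Equiv.Perm (Fin N)) (h : ∀ α, (t.symm (τ α)).2 = (t.symm α).2) :
    fillWeight t (I ∘ τ) = fillWeight t I := by
  have e := Equiv.sum_comp τ fun α => ((t.symm α).2 : ℕ) * idxRank (I α)
  rw [fillWeight, fillWeight, ← e]
  simp [h]

theorem fillWeight_comp_swap (t : Fin R × Fin C ≃ Fin N) (K : Fin N → Idx a b) {α β : Fin N}
    (h : α ≠ β) : (fillWeight t (K ∘ Equiv.swap α β) : ℤ) = fillWeight t K -
      (((t.symm α).2 : ℤ) - ((t.symm β).2 : ℤ)) * ((idxRank (K α) : ℤ) - idxRank (K β)) := by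
  have e : ((fillWeight t (K ∘ Equiv.swap α β) : ℤ) - fillWeight t K) =
      ∑ γ, (((t.symm γ).2 : ℕ) : ℤ) * ((idxRank (K (Equiv.swap α β γ)) : ℤ) - idxRank (K γ)) := by
    simp [fillWeight, mul_sub]
  rw [Fintype.sum_eq_add α β h] at e
  · rw [Equiv.swap_apply_left, Equiv.swap_apply_right] at e
    linarith
  · rintro γ ⟨h1, h2⟩
    rw [Equiv.swap_apply_of_ne_of_ne h1 h2, sub_self, mul_zero]

/-- The function whose stabilizer consists of the permutations supported in `S`. -/
noncomputable def outside (S : Finset (Fin N)) (α : Fin N) : Option (Fin N) :=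
  if α ∈ S then none else some α

theorem mem_of_comp_outside {S : Finset (Fin N)} {π : Equiv.Perm (Fin N)}
    (h : outside S ∘ ⇑π = outside S) {α : Fin N} (hα : α ∈ S) : π α ∈ S := by
  by_contra hc
  have := congrFun h α
  simp [outside, hα, hc] at this

theorem apply_eq_of_comp_outside {S : Finset (Fin N)} {π : Equiv.Perm (Fin N)}
    (h : outside S ∘ ⇑π = outside S) {α : Fin N} (hα : α ∉ S) : π α = α := by
  have := congrFun h α
  simp only [Function.comp_apply, outside, hα, if_false] at this
  split_ifs at this with h1
  exact Option.some_injective _ this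

/-- The alternation laws of a function of fillings under a Young symmetrizer: the columns
transform by `χ`, and the Garnir relations hold. -/
structure IsGarnir (t : Fin R × Fin C ≃ Fin N) (χ : Equiv.Perm (Fin N) →* ℤˣ)
    (F : (Fin N → Idx a b) → E) : Prop where
  column : ∀ I (τ : Equiv.Perm (Fin N)), (∀ α, (t.symm (τ α)).2 = (t.symm α).2) →
    koszul (pars I) τ • F (I ∘ τ) = sg (χ τ) • F I
  garnir : ∀ I (S : Finset (Fin N)), R < S.card →
    ∑ π ∈ stab (outside S), (sg (χ π) * koszul (pars I) π) • F (I ∘ π) = 0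

variable {t : Fin R × Fin C ≃ Fin N} {χ : Equiv.Perm (Fin N) →* ℤˣ} {F : (Fin N → Idx a b) → E}

theorem mem_of_apply_mem {S : Finset (Fin N)} {π : Equiv.Perm (Fin N)} (h : ∀ x ∈ S, π x ∈ S)
    {x : Fin N} (hx : π x ∈ S) : x ∈ S := by
  have e : S.image π = S := Finset.eq_of_subset_of_card_le (Finset.image_subset_iff.2 h)
    (Finset.card_image_of_injective _ π.injective).ge
  rw [← e, Finset.mem_image] at hx
  obtain ⟨y, hy, hxy⟩ := hx
  exact π.injective hxy ▸ hy

theorem pars_comp (I : Fin N → Idx a b) (π : Equiv.Perm (Fin N)) :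
    pars (I ∘ ⇑π) = pars I ∘ ⇑π := rfl

/-- Uncross `π` one pair at a time. Entries on `X` dominate those on `Y`, so a crossing of unequal
entries puts the larger one in the later column and raises the weight. Equal entries have parity
other than `s`, and there the Koszul sign of the swap equals its value under `χ`. Without crossings
`π` preserves columns and the column law applies. -/
theorem IsGarnir.exchange (hF : IsGarnir t χ F) {s : ℕ}
    (hχ : ∀ x y : Fin N, x ≠ y → sg (χ (Equiv.swap x y)) = (-1) ^ (s + 1)) (hs : s ≤ 1)
    (I : Fin N → Idx a b) (X Y : Finset (Fin N)) (j j' : Fin C) (hj : j < j')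
    (hX : ∀ α ∈ X, (t.symm α).2 = j) (hY : ∀ α ∈ Y, (t.symm α).2 = j')
    (hXY : ∀ α ∈ X, ∀ β ∈ Y, I β ≤ I α ∧ (I β = I α → parity (I α) ≠ s))
    (π : Equiv.Perm (Fin N)) (hπ : outside (X ∪ Y) ∘ ⇑π = outside (X ∪ Y)) :
    (fillWeight t (I ∘ π) = fillWeight t I ∧
      (sg (χ π) * koszul (pars I) π) • F (I ∘ π) = F I) ∨
      fillWeight t I < fillWeight t (I ∘ π) := by
  have hdisj : ∀ α ∈ X, α ∉ Y := fun α h1 h2 => hj.ne ((hX α h1).symm.trans (hY α h2))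
  induction hn : (Y.filter fun α => π α ∈ X).card using Nat.strong_induction_on generalizing π with
  | _ n ih =>
  have hS : ∀ α, α ∈ X ∨ α ∈ Y → π α ∈ X ∨ π α ∈ Y := fun α h =>
    Finset.mem_union.1 (mem_of_comp_outside hπ (Finset.mem_union.2 h))
  by_cases hcross : ∃ α ∈ Y, π α ∈ X
  · obtain ⟨α, hα, hπα⟩ := hcross
    obtain ⟨β, hβ, hπβ⟩ : ∃ β ∈ X, π β ∈ Y := by
      by_contra! hc
      exact hdisj α (mem_of_apply_mem (fun β hβ =>
        (hS β (Or.inl hβ)).resolve_right (hc β hβ)) hπα) hα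
    have hne : α ≠ β := fun e => hdisj β hβ (e ▸ hα)
    -- This removes the crossing at `α` and creates no new one.
    set π' := π * Equiv.swap α β with hπ'
    have hπ'α : π' α = π β := by simp [hπ']
    have hπ'β : π' β = π α := by simp [hπ']
    have hπ'o : ∀ γ, γ ≠ α → γ ≠ β → π' γ = π γ := fun γ h1 h2 => by
      rw [hπ', Equiv.Perm.mul_apply, Equiv.swap_apply_of_ne_of_ne h1 h2]
    have hstab : outside (X ∪ Y) ∘ ⇑π' = outside (X ∪ Y) := by
      rw [hπ', Equiv.Perm.coe_mul, ← Function.comp_assoc, hπ, comp_swap_eq]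
      rw [outside, outside, if_pos (Finset.mem_union_right _ hα),
        if_pos (Finset.mem_union_left _ hβ)]
    have hlt : (Y.filter fun γ => π' γ ∈ X).card < n := by
      rw [← hn]
      apply Finset.card_lt_card
      rw [Finset.ssubset_iff_of_subset]
      · refine ⟨α, by simp [hα, hπα], ?_⟩
        rw [Finset.mem_filter, hπ'α]
        exact fun h => hdisj _ h.2 hπβ
      · intro γ
        rw [Finset.mem_filter, Finset.mem_filter]
        rintro ⟨h1, h2⟩
        refine ⟨h1, ?_⟩
        rw [hπ'o γ] at h2
        · exact h2
        · rintro rfl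
          rw [hπ'α] at h2
          exact hdisj _ h2 hπβ
        · rintro rfl
          exact hdisj _ hβ h1
    have hrec := ih _ hlt π' hstab rfl
    obtain ⟨hle, hpar⟩ := hXY _ hπα _ hπβ
    rcases hle.eq_or_lt with heq | hl
    · have hs' : π = Equiv.swap (π α) (π β) * π' := by
        rw [hπ', Equiv.mul_swap_eq_swap_mul, ← mul_assoc, Equiv.swap_mul_self, one_mul]
      have hne' : π α ≠ π β := fun e => hne (π.injective e)
      have hI : I ∘ ⇑(Equiv.swap (π α) (π β)) = I := comp_swap_eq heq.symm
      have hIπ : I ∘ ⇑π = I ∘ ⇑π' := by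
        conv_lhs => rw [hs', Equiv.Perm.coe_mul, ← Function.comp_assoc, hI]
      have hsign : sg (χ π) * koszul (pars I) π = sg (χ π') * koszul (pars I) π' := by
        have h1 := hpar heq
        have h2 := parity_le_one (I (π α))
        have h3 : (-1 : ℂ) ^ (s + 1) * (-1) ^ (parity (I (π α)) * parity (I (π α))) = 1 := by
          obtain ⟨h, h'⟩ | ⟨h, h'⟩ : (s = 0 ∧ parity (I (π α)) = 1) ∨
              (s = 1 ∧ parity (I (π α)) = 0) := by omega
          · rw [h, h']
            norm_num
          · rw [h, h']
            norm_num
        have h4 := koszul_swap (pars I) hne' (congrArg parity heq.symm)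
        have h5 : pars I (π β) = pars I (π α) := congrArg parity heq
        rw [h5] at h4
        conv_lhs => rw [hs', map_mul, map_mul, koszul_mul, ← pars_comp, hI, hχ _ _ hne', h4]
        linear_combination (sg (χ π') * koszul (pars I) π') * h3
      rw [hIπ, hsign]
      exact hrec
    · right
      have h1 : fillWeight t I ≤ fillWeight t (I ∘ π') := by
        rcases hrec with h | h
        · exact h.1.ge
        · exact h.le
      have h2 : I ∘ ⇑π' = (I ∘ ⇑π) ∘ ⇑(Equiv.swap α β) := rfl
      have h3 := fillWeight_comp_swap t (I ∘ ⇑π) hne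
      rw [← h2, hY α hα, hX β hβ] at h3
      have h4 := idxRank_strictMono hl
      have h5 : (0 : ℤ) < ((j' : ℤ) - (j : ℤ)) *
          ((idxRank ((I ∘ ⇑π) α) : ℤ) - idxRank ((I ∘ ⇑π) β)) := by
        apply mul_pos
        · have : (j : ℕ) < j' := hj
          omega
        · simp only [Function.comp_apply]
          omega
      have h6 : (fillWeight t I : ℤ) ≤ fillWeight t (I ∘ π') := by exact_mod_cast h1
      zify
      linarith
  · left
    push Not at hcross
    have hmY : ∀ β ∈ Y, π β ∈ Y := fun β hβ =>
      (hS β (Or.inr hβ)).resolve_left (hcross β hβ)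
    have hmX : ∀ α ∈ X, π α ∈ X := by
      intro α hα
      refine (hS α (Or.inl hα)).resolve_right fun h => ?_
      exact hdisj α hα (mem_of_apply_mem hmY h)
    have hcol : ∀ α, (t.symm (π α)).2 = (t.symm α).2 := by
      intro α
      by_cases h1 : α ∈ X
      · rw [hX _ h1, hX _ (hmX α h1)]
      · by_cases h2 : α ∈ Y
        · rw [hY _ h2, hY _ (hmY α h2)]
        · rw [apply_eq_of_comp_outside hπ (by simp [h1, h2])]
    refine ⟨fillWeight_comp_of_col t I π hcol, ?_⟩
    rw [mul_smul, hF.column I π hcol, smul_smul, sg_mul_self, one_smul]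

/-- At a row violation the Garnir relation expresses a positive multiple of `F I` through fillings
of larger weight. A forbidden repetition in a column makes `F I` zero. -/
theorem IsGarnir.mem_span_of_sorted (hF : IsGarnir t χ F) {s : ℕ}
    (hχ : ∀ x y : Fin N, x ≠ y → sg (χ (Equiv.swap x y)) = (-1) ^ (s + 1)) (hs : s ≤ 1)
    (I : Fin N → Idx a b) (hI : ∀ j, Monotone fun i => I (t (i, j)))
    (ih : ∀ I', fillWeight t I < fillWeight t I' →
      F I' ∈ Submodule.span ℂ {f | ∃ I, IsSemistd s t I ∧ f = F I}) :
    F I ∈ Submodule.span ℂ {f | ∃ I, IsSemistd s t I ∧ f = F I} := by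
  by_cases hstrict : ∀ j i i', i < i' → parity (I (t (i, j))) = s →
      parity (I (t (i', j))) = s → I (t (i, j)) < I (t (i', j))
  · by_cases hviol : ∃ i j j', j < j' ∧ I (t (i, j')) ≤ I (t (i, j)) ∧
        (I (t (i, j')) = I (t (i, j)) → parity (I (t (i, j))) ≠ s)
    · obtain ⟨i, j, j', hj, hle, hpar⟩ := hviol
      -- Column `j` from row `i` downwards and column `j'` down to row `i`: both contain row `i`, so
      -- together they have `R + 1` cells, just enough for a Garnir relation.
      set X : Finset (Fin N) := (Finset.Ici i).image fun i => t (i, j) with hX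
      set Y : Finset (Fin N) := (Finset.Iic i).image fun i => t (i, j') with hY
      have hXc : ∀ α ∈ X, (t.symm α).2 = j := by
        intro α hα
        obtain ⟨i', _, rfl⟩ := Finset.mem_image.1 hα
        simp
      have hYc : ∀ α ∈ Y, (t.symm α).2 = j' := by
        intro α hα
        obtain ⟨i', _, rfl⟩ := Finset.mem_image.1 hα
        simp
      have hinj : ∀ j, Function.Injective fun i => t (i, j) := fun j i i' h =>
        (Prod.mk.inj (t.injective h)).1
      have hcard : R < (X ∪ Y).card := by
        rw [Finset.card_union_of_disjoint, hX, hY, Finset.card_image_of_injective _ (hinj j),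
          Finset.card_image_of_injective _ (hinj j'), Fin.card_Ici, Fin.card_Iic]
        · have := i.2
          omega
        · rw [Finset.disjoint_left]
          exact fun α h1 h2 => hj.ne ((hXc α h1).symm.trans (hYc α h2))
      have hXY : ∀ α ∈ X, ∀ β ∈ Y, I β ≤ I α ∧ (I β = I α → parity (I α) ≠ s) := by
        intro α hα β hβ
        obtain ⟨i₁, h1, rfl⟩ := Finset.mem_image.1 hα
        obtain ⟨i₂, h2, rfl⟩ := Finset.mem_image.1 hβ
        have h3 : I (t (i, j)) ≤ I (t (i₁, j)) := hI j (Finset.mem_Ici.1 h1)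
        have h4 : I (t (i₂, j')) ≤ I (t (i, j')) := hI j' (Finset.mem_Iic.1 h2)
        refine ⟨h4.trans (hle.trans h3), fun e => ?_⟩
        have e1 : I (t (i, j)) = I (t (i₁, j)) :=
          le_antisymm h3 (e ▸ (h4.trans hle))
        have e2 : I (t (i, j')) = I (t (i, j)) :=
          le_antisymm hle (e1 ▸ e ▸ h4)
        rw [← e1]
        exact hpar e2
      have hsum := hF.garnir I (X ∪ Y) hcard
      have hex := hF.exchange hχ hs I X Y j j' hj hXc hYc hXY
      rw [← Finset.sum_filter_add_sum_filter_not _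
        fun π : Equiv.Perm (Fin N) => fillWeight t I < fillWeight t (I ∘ π)] at hsum
      have h1 : ∑ π ∈ (stab (outside (X ∪ Y))).filter fun π : Equiv.Perm (Fin N) =>
          ¬ fillWeight t I < fillWeight t (I ∘ π),
          (sg (χ π) * koszul (pars I) π) • F (I ∘ π) = (Finset.card ((stab (outside (X ∪ Y))).filter
            fun π : Equiv.Perm (Fin N) => ¬ fillWeight t I < fillWeight t (I ∘ π)) : ℂ) • F I := by
        rw [Nat.cast_smul_eq_nsmul, ← Finset.sum_const]
        refine Finset.sum_congr rfl fun π hπ => ?_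
        rw [Finset.mem_filter, mem_stab] at hπ
        exact ((hex π hπ.1).resolve_right hπ.2).2
      have hne : (Finset.card ((stab (outside (X ∪ Y))).filter
            fun π : Equiv.Perm (Fin N) => ¬ fillWeight t I < fillWeight t (I ∘ π)) : ℂ) ≠ 0 := by
        refine Nat.cast_ne_zero.2 (Finset.card_ne_zero_of_mem (a := 1) ?_)
        simp
      rw [h1, add_comm, add_eq_zero_iff_eq_neg] at hsum
      rw [← Submodule.smul_mem_iff _ hne, hsum]
      refine Submodule.neg_mem _ (Submodule.sum_mem _ fun π hπ => Submodule.smul_mem _ _ ?_)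
      rw [Finset.mem_filter] at hπ
      exact ih _ hπ.2
    · push Not at hviol
      refine Submodule.subset_span ⟨I, ⟨?_, hI, hstrict, ?_⟩, rfl⟩
      · intro i j j' hj
        rcases hj.eq_or_lt with rfl | hj
        · exact le_rfl
        · by_contra hc
          have hc' : I (t (i, j')) < I (t (i, j)) := not_le.1 hc
          exact hc'.ne (hviol i j j' hj hc'.le).1
      · intro i j j' hj h1 h2
        by_contra hc
        have h3 := hviol i j j' hj (not_lt.1 hc)
        have := h3.2
        omega
  · push Not at hstrict
    obtain ⟨j, i, i', hi, h1, h2, h3⟩ := hstrict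
    have heq : I (t (i, j)) = I (t (i', j)) := le_antisymm (hI j hi.le) h3
    have hne : t (i, j) ≠ t (i', j) := fun e => hi.ne (Prod.mk.inj (t.injective e)).1
    have hcol : ∀ α, (t.symm (Equiv.swap (t (i, j)) (t (i', j)) α)).2 = (t.symm α).2 :=
      congrFun (comp_swap_eq (f := fun α => (t.symm α).2) (by simp))
    have h4 := hF.column I _ hcol
    have h6 := koszul_swap (pars I) hne (congrArg parity heq)
    rw [show pars I (t (i, j)) = s from h1, show pars I (t (i', j)) = s from h2] at h6
    rw [comp_swap_eq heq, h6, hχ _ _ hne] at h4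
    -- Two equal entries of parity `s` have Koszul sign `(-1) ^ s`, whereas `χ` gives `(-1) ^ (s +
    -- 1)`.
    have h5 : (2 : ℂ) • F I = 0 := by
      interval_cases s
      · norm_num at h4
        rw [two_smul]
        nth_rewrite 1 [h4]
        simp
      · norm_num at h4
        rw [two_smul]
        nth_rewrite 1 [← h4]
        simp
    rw [(smul_eq_zero.1 h5).resolve_left two_ne_zero]
    exact Submodule.zero_mem _

/-- Straightening: the values at semistandard fillings span. -/
theorem IsGarnir.mem_span (hF : IsGarnir t χ F) {s : ℕ}
    (hχ : ∀ x y : Fin N, x ≠ y → sg (χ (Equiv.swap x y)) = (-1) ^ (s + 1)) (hs : s ≤ 1)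
    (I : Fin N → Idx a b) :
    F I ∈ Submodule.span ℂ {f | ∃ I, IsSemistd s t I ∧ f = F I} := by
  induction hn : (∑ _α : Fin N, C * Fintype.card (Idx a b)) - fillWeight t I using
    Nat.strong_induction_on generalizing I with
  | _ n ih =>
  -- Sort each column. The weight does not change, so the induction hypothesis still covers all
  -- fillings of larger weight.
  let τ : Equiv.Perm (Fin N) := t.permCongr
    (Equiv.prodCongrLeft fun j => Tuple.sort fun i => I (t (i, j)))
  have hτ : ∀ i j, τ (t (i, j)) = t (Tuple.sort (fun i => I (t (i, j))) i, j) := by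
    intro i j
    simp [τ, Equiv.permCongr_apply]
  have hcol : ∀ α, (t.symm (τ α)).2 = (t.symm α).2 := by
    intro α
    obtain ⟨⟨i, j⟩, rfl⟩ := t.surjective α
    rw [hτ]
    simp
  have hw := fillWeight_comp_of_col t I τ hcol
  have h1 := hF.mem_span_of_sorted hχ hs (I ∘ τ) (by
    intro j
    have := Tuple.monotone_sort fun i => I (t (i, j))
    intro i i' hi
    simp only [Function.comp_apply, hτ]
    exact this hi) (by
    intro I' hI'
    rw [hw] at hI'
    have := fillWeight_le t I'
    exact ih _ (by omega) I' rfl)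
  have h2 := hF.column I τ hcol
  have h3 : F I = (sg (χ τ) * koszul (pars I) τ) • F (I ∘ τ) := by
    rw [mul_smul, h2, smul_smul, sg_mul_self, one_smul]
  rw [h3]
  exact Submodule.smul_mem _ _ h1

end

end SuperInv

namespace SuperInv

open Classical in
section

/-! ### The signed action of the group algebra on functions of sequences -/

variable {N a b : ℕ} {E : Type*} [AddCommGroup E] [Module ℂ E]

theorem permAlg_hom_ext {f g : PermAlg N →ₗ[ℂ] E} (h : ∀ x, f (el x) = g (el x)) : f = g :=
  (MonoidAlgebra.basis _ ℂ).ext fun x => by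
    simpa using h x

/-- The signed right action of the group algebra on functions of sequences. -/
noncomputable def signedAct (G : (Fin N → Idx a b) → E) (I : Fin N → Idx a b) :
    PermAlg N →ₗ[ℂ] E :=
  (MonoidAlgebra.basis _ ℂ).constr ℂ fun x => koszul (pars I) x • G (I ∘ x)

@[simp]
theorem signedAct_el (G : (Fin N → Idx a b) → E) (I : Fin N → Idx a b)
    (x : Equiv.Perm (Fin N)) : signedAct G I (el x) = koszul (pars I) x • G (I ∘ x) := by
  exact (MonoidAlgebra.basis (Equiv.Perm (Fin N)) ℂ).constr_basis ℂ
    (fun x => koszul (pars I) x • G (I ∘ x)) x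

theorem signedAct_el_mul (G : (Fin N → Idx a b) → E) (I : Fin N → Idx a b)
    (x : Equiv.Perm (Fin N)) (w : PermAlg N) :
    signedAct G I (el x * w) = koszul (pars I) x • signedAct G (I ∘ x) w := by
  have : signedAct G I ∘ₗ LinearMap.mulLeft ℂ (el x) =
      koszul (pars I) x • signedAct G (I ∘ x) := by
    refine permAlg_hom_ext fun y => ?_
    rw [LinearMap.comp_apply, LinearMap.mulLeft_apply, ← map_mul, signedAct_el,
      LinearMap.smul_apply, signedAct_el, koszul_mul, smul_smul]
    rfl
  exact LinearMap.congr_fun this w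

/-- The column law is absorption into the left factor. For the Garnir relation, expand that factor:
for each column permutation `τ`, two elements of `τ⁻¹ S` share a row since `S` has more than `R`
elements, and the opposite characters `χ`, `χ'` cancel on their swap. -/
theorem isGarnir_signedAct {R C : ℕ} (t : Fin R × Fin C ≃ Fin N)
    (χ χ' : Equiv.Perm (Fin N) →* ℤˣ)
    (hχ : ∀ x y, x ≠ y → χ (Equiv.swap x y) * χ' (Equiv.swap x y) = -1)
    (G : (Fin N → Idx a b) → E) :
    IsGarnir t χ fun I => signedAct G I
      (stabSum χ (fun α => (t.symm α).2) * stabSum χ' (fun α => (t.symm α).1)) where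
  column I τ hτ := by
    rw [← signedAct_el_mul, ← mul_assoc, el_mul_stabSum _ _ _ (funext hτ), smul_mul_assoc,
      map_smul]
  garnir I S hS := by
    simp only [mul_smul, ← signedAct_el_mul]
    simp only [← map_smul, ← smul_mul_assoc]
    rw [← map_sum, ← Finset.sum_mul]
    change signedAct G I (stabSum χ (outside S) * _) = 0
    rw [← mul_assoc, stabSum.eq_def χ fun α => (t.symm α).2, Finset.mul_sum, Finset.sum_mul,
      Finset.sum_eq_zero, map_zero]
    intro τ _
    obtain ⟨x, hx, y, hy, hxy, he⟩ := Finset.exists_ne_map_eq_of_card_lt_of_maps_to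
      (s := S.map τ⁻¹.toEmbedding) (t := (Finset.univ : Finset (Fin R)))
      (by simpa using hS) (f := fun α => (t.symm α).1) (fun _ _ => Finset.mem_univ _)
    rw [mul_smul_comm, el_mul_stabSum_comp, smul_mul_assoc, mul_assoc,
      stabSum_mul_stabSum_eq_zero χ χ' _ _ (x := x) (y := y) _ he (hχ x y hxy), mul_zero, smul_zero]
    rw [Finset.mem_map] at hx hy
    obtain ⟨x, hx, rfl⟩ := hx
    obtain ⟨y, hy, rfl⟩ := hy
    simp [outside, hx, hy]

theorem sg_sign_swap {x y : Fin N} (h : x ≠ y) :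
    sg (Equiv.Perm.sign (Equiv.swap x y)) = (-1) ^ (0 + 1) := by
  simp [Equiv.Perm.sign_swap h]

/-! ### The polynomials of a rectangular tableau -/

variable {k l p q r c n m : ℕ}

theorem mem_rowStab {t : RectTableau r c} {σ : Equiv.Perm (Fin (r * c))} :
    σ ∈ t.rowStab ↔ σ ∈ stab fun α => (t.symm α).1 := by
  rw [RectTableau.rowStab, Finset.mem_filter, mem_stab, funext_iff]
  simp

theorem mem_colStab {t : RectTableau r c} {σ : Equiv.Perm (Fin (r * c))} :
    σ ∈ t.colStab ↔ σ ∈ stab fun α => (t.symm α).2 := by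
  rw [RectTableau.colStab, Finset.mem_filter, mem_stab, funext_iff]
  simp

theorem stabSum_eq_sum_inv {ι : Type*} (χ : Equiv.Perm (Fin N) →* ℤˣ) (f : Fin N → ι) :
    stabSum χ f = ∑ σ ∈ stab f, sg (χ σ) • el σ⁻¹ := by
  have h : ∀ σ : Equiv.Perm (Fin N), σ ∈ stab f → σ⁻¹ ∈ stab f := by
    intro σ hσ
    rw [mem_stab] at hσ ⊢
    conv_lhs => rw [← hσ]
    funext x
    simp
  refine Finset.sum_nbij' (·⁻¹) (·⁻¹) h h (fun _ _ => inv_inv _) (fun _ _ => inv_inv _) ?_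
  intro σ _
  rw [inv_inv, map_inv, Int.units_inv_eq_self]

/-- The Young symmetrizer of a rectangular tableau. -/
theorem altSum_mul_symSum_eq (t : RectTableau r c) :
    altSum (fun α => (t.symm α).2) * symSum (fun α => (t.symm α).1) =
      ∑ σ ∈ t.rowStab, ∑ τ ∈ t.colStab, sg (Equiv.Perm.sign τ) • el (σ * τ)⁻¹ := by
  rw [altSum, symSum, stabSum_eq_sum_inv, stabSum_eq_sum_inv, Finset.sum_mul_sum, Finset.sum_comm]
  refine Finset.sum_congr (Finset.ext fun _ => mem_rowStab.symm) fun σ _ =>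
    Finset.sum_congr (Finset.ext fun _ => mem_colStab.symm) fun τ _ => ?_
  rw [MonoidHom.one_apply, map_one, one_smul, smul_mul_assoc, ← map_mul, mul_inv_rev]

theorem symSum_mul_altSum_eq (t : RectTableau r c) :
    symSum (fun α => (t.symm α).1) * altSum (fun α => (t.symm α).2) =
      ∑ σ ∈ t.rowStab, ∑ τ ∈ t.colStab, sg (Equiv.Perm.sign τ) • el (σ * τ) := by
  rw [altSum, symSum, stabSum, stabSum, Finset.sum_mul_sum]
  refine Finset.sum_congr (Finset.ext fun _ => mem_rowStab.symm) fun σ _ =>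
    Finset.sum_congr (Finset.ext fun _ => mem_colStab.symm) fun τ _ => ?_
  rw [MonoidHom.one_apply, map_one, one_smul, mul_smul_comm, ← map_mul]

/-- A simultaneous permutation changes `Z` only by signs, so permuting `I` is the same as permuting
`J` inversely. -/
theorem Z_comp_left (I : Fin N → Idx k l) (J : Fin N → Idx p q) (x : Equiv.Perm (Fin N)) :
    koszul (pars I) x • Z (I ∘ x) J = koszul (pars J) x⁻¹ • Z I (J ∘ ⇑x⁻¹) := by
  have h := Z_comp_perm I (J ∘ ⇑x⁻¹) x
  have h1 : (J ∘ ⇑x⁻¹) ∘ ⇑x = J := by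
    funext
    simp
  have h2 := koszul_inv (pars J) x⁻¹
  rw [inv_inv, ← pars_comp] at h2
  rw [h1, h2] at h
  rw [h, smul_smul, ← mul_assoc, koszul_mul_self, one_mul]

theorem P_eq_signedAct (t : RectTableau r c) (I : Fin (r * c) → Idx k l)
    (J : Fin (r * c) → Idx p q) : P t I J = signedAct (fun I => Z I J) I
      (altSum (fun α => (t.symm α).2) * symSum (fun α => (t.symm α).1)) := by
  rw [altSum_mul_symSum_eq, P, map_sum]
  refine Finset.sum_congr rfl fun σ _ => ?_
  rw [map_sum]
  refine Finset.sum_congr rfl fun τ _ => ?_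
  rw [map_smul, signedAct_el, smul_smul]
  rfl

/-- Passing from `I` to `J` inverts permutations, so the order of the two symmetrizers is reversed.
Straightening in `J` therefore uses the transposed tableau, the trivial character on its columns,
and `s = 1`. -/
theorem P_eq_signedAct_right (t : RectTableau r c) (I : Fin (r * c) → Idx k l)
    (J : Fin (r * c) → Idx p q) : P t I J = signedAct (fun J => Z I J) J
      (symSum (fun α => (t.symm α).1) * altSum (fun α => (t.symm α).2)) := by
  rw [P_eq_signedAct, altSum_mul_symSum_eq, symSum_mul_altSum_eq, map_sum, map_sum]
  refine Finset.sum_congr rfl fun σ _ => ?_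
  rw [map_sum, map_sum]
  refine Finset.sum_congr rfl fun τ _ => ?_
  rw [map_smul, map_smul, signedAct_el, signedAct_el, Z_comp_left, inv_inv]

theorem P_mem_span_left (t : RectTableau r c) (I : Fin (r * c) → Idx k l)
    (J : Fin (r * c) → Idx p q) :
    P t I J ∈ Submodule.span ℂ {f | ∃ I', t.IsSemistandard I' ∧ f = P t I' J} := by
  have h := (isGarnir_signedAct t Equiv.Perm.sign 1 (fun x y hxy => by
    simp [Equiv.Perm.sign_swap hxy]) (fun I : Fin (r * c) → Idx k l => Z I J)).mem_span
    (s := 0) (fun _ _ => sg_sign_swap) zero_le_one I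
  simp only [← P_eq_signedAct] at h
  exact h

theorem P_mem_span_right (t : RectTableau r c) (I : Fin (r * c) → Idx k l)
    (J : Fin (r * c) → Idx p q) :
    P t I J ∈ Submodule.span ℂ {f | ∃ J', t.IsSemistandard J' ∧ f = P t I J'} := by
  have h := (isGarnir_signedAct ((Equiv.prodComm _ _).trans t) 1 Equiv.Perm.sign (fun x y hxy => by
    simp [Equiv.Perm.sign_swap hxy]) (fun J : Fin (r * c) → Idx p q => Z I J)).mem_span
    (s := 1) (fun _ _ _ => by simp) le_rfl J
  simp only [Equiv.symm_trans_apply, Equiv.prodComm_symm, Equiv.prodComm_apply, Prod.fst_swap,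
    Prod.snd_swap, ← P_eq_signedAct_right] at h
  refine Submodule.span_mono ?_ h
  rintro f ⟨J', ⟨h1, h2, h3, h4⟩, rfl⟩
  exact ⟨J', ⟨h2, h1, h4, h3⟩, rfl⟩

theorem P_mem_span (t : RectTableau r c) (I : Fin (r * c) → Idx k l)
    (J : Fin (r * c) → Idx p q) :
    P t I J ∈ Submodule.span ℂ {f | ∃ I' J', t.IsSemistandard I' ∧ t.IsSemistandard J' ∧
      f = P t I' J'} := by
  refine Submodule.span_le.2 ?_ (P_mem_span_left t I J)
  rintro _ ⟨I', hI', rfl⟩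
  refine Submodule.span_mono ?_ (P_mem_span_right t I' J)
  rintro _ ⟨J', hJ', rfl⟩
  exact ⟨I', J', hI', hJ', rfl⟩

/-- A rectangle that is not contained in the hook has no semistandard filling. -/
theorem not_isSemistandard (t : RectTableau (n + 1) (m + 1))
    (K : Fin ((n + 1) * (m + 1)) → Idx n m) : ¬ t.IsSemistandard K := by
  rintro ⟨-, h2, h3, h4⟩
  have h0 : ∀ z : Idx n m, parity z = 0 → ∃ x, z = toLex (Sum.inl x) := by
    intro z hz
    obtain ⟨x, rfl⟩ | ⟨x, rfl⟩ : (∃ x, z = toLex (Sum.inl x)) ∨ ∃ x, z = toLex (Sum.inr x) := by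
      induction z using Lex.rec with
      | _ z => cases z <;> simp
    · exact ⟨x, rfl⟩
    · simp [parity] at hz
  have h0' : ∀ z : Idx n m, parity z = 1 → ∃ x, z = toLex (Sum.inr x) := by
    intro z hz
    obtain ⟨x, rfl⟩ | ⟨x, rfl⟩ : (∃ x, z = toLex (Sum.inl x)) ∨ ∃ x, z = toLex (Sum.inr x) := by
      induction z using Lex.rec with
      | _ z => cases z <;> simp
    · simp [parity] at hz
    · exact ⟨x, rfl⟩
  -- If the lowest entry of a column were even, the whole column would be even, giving `n + 1`
  -- distinct elements among `n`. So the bottom row is odd and strictly increasing, with `m + 1`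
  -- elements among `m`.
  have key : ∀ j, parity (K (t (Fin.last n, j))) = 1 := by
    intro j
    by_contra hc
    have hc0 : parity (K (t (Fin.last n, j))) = 0 := by
      have := parity_le_one (K (t (Fin.last n, j)))
      omega
    obtain ⟨y, hy⟩ := h0 _ hc0
    have hall : ∀ i, parity (K (t (i, j))) = 0 := by
      intro i
      by_contra hi
      have hi1 : parity (K (t (i, j))) = 1 := by
        have := parity_le_one (K (t (i, j)))
        omega
      obtain ⟨x, hx⟩ := h0' _ hi1
      have hle := h2 j (Fin.le_last i)
      simp only [hx, hy] at hle
      exact Sum.Lex.not_inr_le_inl hle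
    choose x hx using fun i => h0 _ (hall i)
    have : Function.Injective x := by
      have hm : StrictMono fun i => K (t (i, j)) := fun i i' hi => h3 j i i' hi (hall i) (hall i')
      intro i i' e
      apply hm.injective
      simp only [hx, e]
    have := Fintype.card_le_of_injective x this
    simp at this
  choose x hx using fun j => h0' _ (key j)
  have : Function.Injective x := by
    have hm : StrictMono fun j => K (t (Fin.last n, j)) :=
      fun j j' hj => h4 _ j j' hj (key j) (key j')
    intro i i' e
    apply hm.injective
    simp only [hx, e]
  have := Fintype.card_le_of_injective x this
  simp at this

/-- Replace the summation index `K` by `K ∘ x`: the signs of `I` then cancel in `xMon`, and the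
permutation is left acting only on the factor `xStarMon`. -/
theorem prodHom_signedAct (I : Fin N → Idx k l) (J : Fin N → Idx p q) (w : PermAlg N) :
    prodHom n m k l p q (signedAct (fun I => Z I J) I w) =
      ∑ K : Fin N → Idx n m, interSign (pars K) (pars K) •
        (xMon I K * signedAct (fun K => xStarMon K J) K w) := by
  have : (prodHom n m k l p q).toLinearMap ∘ₗ signedAct (fun I => Z I J) I =
      ∑ K : Fin N → Idx n m, interSign (pars K) (pars K) •
        (LinearMap.mulLeft ℂ (xMon I K) ∘ₗ signedAct (fun K => xStarMon K J) K) := by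
    refine permAlg_hom_ext fun x => ?_
    rw [LinearMap.comp_apply, signedAct_el, map_smul, AlgHom.toLinearMap_apply, prodHom_Z,
      LinearMap.sum_apply, ← Equiv.sum_comp (Equiv.arrowCongr x.symm (Equiv.refl (Idx n m))),
      Finset.smul_sum]
    refine Finset.sum_congr rfl fun K _ => ?_
    have e : Equiv.arrowCongr x.symm (Equiv.refl (Idx n m)) K = K ∘ x := by
      funext
      simp [Equiv.arrowCongr]
    rw [e, xMon_comp_perm, pars_comp, interSign_self_comp, LinearMap.smul_apply,
      LinearMap.comp_apply, LinearMap.mulLeft_apply, signedAct_el, smul_mul_assoc, mul_smul_comm,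
      smul_smul, smul_smul, smul_smul]
    congr 1
    linear_combination (interSign (pars K) (pars K) * koszul (pars K) x) *
      koszul_mul_self (pars I) x
  have h := LinearMap.congr_fun this w
  simpa using h

/-- The symmetrizer now acts on fillings of the rectangle by indices of `V`, and straightening puts
its values in the span of an empty set. -/
theorem prodHom_P (t : RectTableau (n + 1) (m + 1)) (I : Fin ((n + 1) * (m + 1)) → Idx k l)
    (J : Fin ((n + 1) * (m + 1)) → Idx p q) : prodHom n m k l p q (P t I J) = 0 := by
  rw [P_eq_signedAct, prodHom_signedAct]
  refine Finset.sum_eq_zero fun K _ => ?_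
  have h := (isGarnir_signedAct t Equiv.Perm.sign 1 (fun x y hxy => by
    simp [Equiv.Perm.sign_swap hxy]) (fun K : Fin ((n + 1) * (m + 1)) → Idx n m =>
      (xStarMon K J : Alg n m k l p q))).mem_span
    (s := 0) (fun _ _ => sg_sign_swap) zero_le_one K
  have he : {f : Alg n m k l p q | ∃ K : Fin ((n + 1) * (m + 1)) → Idx n m, IsSemistd 0 t K ∧
      f = signedAct (fun K => xStarMon K J) K (stabSum Equiv.Perm.sign (fun α => (t.symm α).2) *
        stabSum 1 (fun α => (t.symm α).1))} = ∅ :=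
    Set.eq_empty_of_forall_notMem fun f ⟨K, hK, _⟩ => not_isSemistandard t K hK
  rw [he, Submodule.span_empty, Submodule.mem_bot] at h
  rw [h, mul_zero, smul_zero]

end

end SuperInv

namespace SuperInv

open Classical in
section

/-! ### Relations of a fixed degree -/

variable {N M d a b k l p q n m : ℕ}

theorem sum_comp_perm {Y E : Type*} [Fintype Y] [AddCommMonoid E] (x : Equiv.Perm (Fin N))
    (F : (Fin N → Y) → E) : ∑ I, F (I ∘ x) = ∑ I, F I :=
  Equiv.sum_comp (Equiv.arrowCongr x.symm (Equiv.refl Y)) F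

/-- The signs between the blocks involve only `f` on the second block and `g` on the first, neither
of which `σ` touches; hence one scalar serves all `σ`. -/
theorem interSign_append (f g : Fin (N + M) → ℕ) :
    ∃ s : ℂ, (∀ σ : Equiv.Perm (Fin N),
      interSign (f ∘ blockPerm σ 1) g = s * (interSign (f ∘ Fin.castAdd M ∘ σ) (g ∘ Fin.castAdd M) *
        interSign (f ∘ Fin.natAdd N) (g ∘ Fin.natAdd N))) := by
  refine ⟨∏ α : Fin M, ∏ β : Fin N,
    (-1) ^ (f (Fin.natAdd N α) * g (Fin.castAdd M β)), fun σ => ?_⟩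
  have h1 : ∀ (x : Fin N) (y : Fin M), Fin.castAdd M x < Fin.natAdd N y := fun x y => by
    rw [Fin.lt_def, Fin.val_castAdd, Fin.val_natAdd]
    omega
  have h2 : ∀ (x : Fin N) (y : Fin M), ¬ Fin.natAdd N y < Fin.castAdd M x := fun x y =>
    (h1 x y).le.not_gt
  have h3 : ∀ x y : Fin N, Fin.castAdd M x < Fin.castAdd M y ↔ x < y := fun _ _ => Iff.rfl
  simp only [interSign, pairProd, Fin.prod_univ_add, Function.comp_apply, blockPerm_castAdd,
    blockPerm_natAdd, h1, h2, if_true, if_false, Finset.prod_const_one, one_mul,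
    Equiv.Perm.one_apply, Finset.prod_mul_distrib, h3,
    Fin.natAdd_lt_natAdd_iff]
  ring

/-- Splitting off the factors outside a block. -/
theorem exists_Z_comp_blockPerm (I : Fin (N + M) → Idx k l) (J : Fin (N + M) → Idx p q) :
    ∃ s : ℂ, ∀ σ : Equiv.Perm (Fin N), Z (I ∘ blockPerm σ 1) J =
      s • (Z (I ∘ Fin.castAdd M ∘ σ) (J ∘ Fin.castAdd M) *
        Z (I ∘ Fin.natAdd N) (J ∘ Fin.natAdd N)) := by
  obtain ⟨s, hs⟩ := interSign_append (pars I) (pars J)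
  refine ⟨s, fun σ => ?_⟩
  rw [Z_eq, Z_eq, Z_eq, smul_mul_smul_comm, ← SuperSym.mon_append, smul_smul]
  congr 1
  · exact hs σ
  · congr 1
    funext α
    refine Fin.addCases (fun x => ?_) (fun x => ?_) α
    · simp [blockPerm_castAdd]
    · simp [blockPerm_natAdd]

theorem signedAct_Z_mul_el (I : Fin d → Idx k l) (J : Fin d → Idx p q) (w : PermAlg d)
    (g : Equiv.Perm (Fin d)) : signedAct (fun I => Z I J) I (w * el g) =
      koszul (pars J) g⁻¹ • signedAct (fun I => Z I (J ∘ ⇑g⁻¹)) I w := by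
  have : signedAct (fun I => Z I J) I ∘ₗ LinearMap.mulRight ℂ (el g) =
      koszul (pars J) g⁻¹ • signedAct (fun I => Z I (J ∘ ⇑g⁻¹)) I := by
    refine permAlg_hom_ext fun x => ?_
    have h := Z_comp_left (I ∘ x) J g
    rw [LinearMap.comp_apply, LinearMap.mulRight_apply, ← map_mul, signedAct_el,
      LinearMap.smul_apply, signedAct_el, koszul_mul, mul_smul, ← pars_comp,
      Equiv.Perm.coe_mul, ← Function.comp_assoc, h, smul_comm]
  exact LinearMap.congr_fun this w

theorem viaEmbedding_castAdd (σ : Equiv.Perm (Fin N)) (h : N ≤ N + M) :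
    Equiv.Perm.viaEmbedding σ (Fin.castLEEmb h) = blockPerm σ 1 := by
  ext1 x
  refine Fin.addCases (fun x => ?_) (fun x => ?_) x
  · rw [blockPerm_castAdd]
    exact Equiv.Perm.viaEmbedding_apply σ (Fin.castLEEmb h) x
  · rw [blockPerm_natAdd, Equiv.Perm.viaEmbedding_apply_of_notMem]
    · rfl
    · rintro ⟨y, hy⟩
      have := congrArg Fin.val hy
      simp at this
      omega

/-- The Young symmetrizer of a rectangular tableau acts by multiples of the polynomials of the
tableau. -/
theorem exists_signedAct_rectSum {r c : ℕ} (t : RectTableau r c) (h : r * c ≤ r * c + M)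
    (I : Fin (r * c + M) → Idx k l) (J : Fin (r * c + M) → Idx p q) :
    ∃ s : ℂ, signedAct (fun I => Z I J) I (rectSum t (Fin.castLEEmb h)) =
      s • (P t (I ∘ Fin.castAdd M) (J ∘ Fin.castAdd M) *
        Z (I ∘ Fin.natAdd (r * c)) (J ∘ Fin.natAdd (r * c))) := by
  obtain ⟨s, hs⟩ := exists_Z_comp_blockPerm I J
  refine ⟨s, ?_⟩
  rw [rectSum, P, map_sum, Finset.sum_mul, Finset.smul_sum]
  refine Finset.sum_congr rfl fun σ _ => ?_
  rw [map_sum, Finset.sum_mul, Finset.smul_sum]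
  refine Finset.sum_congr rfl fun τ _ => ?_
  rw [map_smul, signedAct_el, viaEmbedding_castAdd, hs, koszul_blockPerm, koszul_one, mul_one,
    smul_mul_assoc, smul_smul, smul_smul, smul_smul, mul_comm]
  rfl

theorem hookSum_mul_el (K : Fin d → Idx n m) (g : Equiv.Perm (Fin d)) :
    hookSum K * el g = el g * hookSum (K ∘ g) := by
  rw [hookSum, hookSum, Finset.sum_mul, Finset.mul_sum]
  refine Finset.sum_nbij' (fun π => g⁻¹ * π * g) (fun π => g * π * g⁻¹) ?_ ?_ ?_ ?_ ?_
  · intro π hπ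
    rw [mem_stab] at hπ ⊢
    funext x
    have := congrFun hπ (g x)
    simpa using this
  · intro π hπ
    rw [mem_stab] at hπ ⊢
    funext x
    have := congrFun hπ (g⁻¹ x)
    simpa using this
  · intro π _
    group
  · intro π _
    group
  · intro π hπ
    rw [mem_stab] at hπ
    have h1 := koszul_mul (pars K) π g
    have h2 := koszul_mul (pars K) g (g⁻¹ * π * g)
    have h3 : g * (g⁻¹ * π * g) = π * g := by group
    rw [h3, h1, ← pars_comp, ← pars_comp, hπ, mul_comm] at h2
    rw [mul_right_inj' (koszul_ne_zero _ _)] at h2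
    rw [smul_mul_assoc, mul_smul_comm, ← map_mul, ← map_mul, h3, h2]

/-- The sum of the `Z_w(I, J)` with coefficients `ξ`, as a function of `w`. -/
noncomputable def relationSum (ξ : (Fin d → Idx k l) → (Fin d → Idx p q) → ℂ) :
    PermAlg d →ₗ[ℂ] SUW k l p q :=
  ∑ I, ∑ J, ξ I J • signedAct (fun I => Z I J) I

theorem relationSum_apply (ξ : (Fin d → Idx k l) → (Fin d → Idx p q) → ℂ) (w : PermAlg d) :
    relationSum ξ w = ∑ I, ∑ J, ξ I J • signedAct (fun I => Z I J) I w := by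
  simp [relationSum]

theorem relationSum_el (ξ : (Fin d → Idx k l) → (Fin d → Idx p q) → ℂ)
    (x : Equiv.Perm (Fin d)) : relationSum ξ (el x) =
      ∑ I, ∑ J, signedAct (fun I => ξ I J) I (el x⁻¹) • Z I J := by
  rw [relationSum_apply, ← sum_comp_perm x⁻¹]
  refine Finset.sum_congr rfl fun I _ => Finset.sum_congr rfl fun J _ => ?_
  have h := koszul_inv (pars I) x⁻¹
  rw [inv_inv, ← pars_comp] at h
  have h1 : (I ∘ ⇑x⁻¹) ∘ ⇑x = I := by
    funext
    simp
  rw [signedAct_el, signedAct_el, h, h1, smul_smul, smul_eq_mul, mul_comm]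

/-- By `relationSum_el`, a permutation acts on the coefficients by its inverse. Since `hookSum K` is
invariant under inversion, `hookSum K * el g` acts as `el g⁻¹ * hookSum K`, which annihilates `ξ`.
-/
theorem relationSum_el_mul_hookSum (ξ : (Fin d → Idx k l) → (Fin d → Idx p q) → ℂ)
    (hξ : ∀ I J (K : Fin d → Idx n m), signedAct (fun I => ξ I J) I (hookSum K) = 0)
    (K : Fin d → Idx n m) (g : Equiv.Perm (Fin d)) :
    relationSum ξ (hookSum K * el g) = 0 := by
  have h1 : ∀ I J, signedAct (fun I => ξ I J) I (el g⁻¹ * hookSum K) = 0 := fun I J => by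
    rw [signedAct_el_mul, hξ, smul_zero]
  have h2 : el g⁻¹ * hookSum K = ∑ π ∈ stab K, koszul (pars K) π • el (π * g)⁻¹ := by
    rw [hookSum, Finset.mul_sum]
    refine Finset.sum_nbij' (·⁻¹) (·⁻¹) ?_ ?_ ?_ ?_ ?_
    iterate 2
      intro π hπ
      rw [mem_stab] at hπ ⊢
      conv_lhs => rw [← hπ]
      funext x
      simp
    · simp
    · simp
    · intro π hπ
      rw [mem_stab] at hπ
      have h := koszul_inv (pars K) π
      rw [← pars_comp, hπ] at h
      rw [h, mul_smul_comm, ← map_mul, mul_inv_rev, inv_inv]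
  rw [hookSum, Finset.sum_mul, map_sum]
  have h3 : ∀ π ∈ stab K, relationSum ξ (koszul (pars K) π • el π * el g) =
      ∑ I, ∑ J, signedAct (fun I => ξ I J) I (koszul (pars K) π • el (π * g)⁻¹) • Z I J := by
    intro π _
    rw [smul_mul_assoc, ← map_mul, map_smul, relationSum_el]
    simp only [map_smul, Finset.smul_sum, smul_assoc]
  rw [Finset.sum_congr rfl h3, Finset.sum_comm]
  refine Finset.sum_eq_zero fun I _ => ?_
  rw [Finset.sum_comm]
  refine Finset.sum_eq_zero fun J _ => ?_
  rw [← Finset.sum_smul, ← map_sum, ← h2, h1, zero_smul]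

/-- The polynomials of a rectangular tableau indexed by semistandard sequences. -/
def semistandardPolys (k l p q : ℕ) {r c : ℕ} (t : RectTableau r c) : Set (SUW k l p q) :=
  {f | ∃ (I : Fin (r * c) → Idx k l) (J : Fin (r * c) → Idx p q),
    t.IsSemistandard I ∧ t.IsSemistandard J ∧ f = P t I J}

/-- The ideal generated by the polynomials of a rectangular tableau, as a linear subspace. -/
noncomputable def polyIdeal (k l p q : ℕ) {r c : ℕ} (t : RectTableau r c) :
    Submodule ℂ (SUW k l p q) :=
  (TwoSidedIdeal.asIdeal (TwoSidedIdeal.span (semistandardPolys k l p q t))).restrictScalars ℂ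

theorem mem_polyIdeal {r c : ℕ} {t : RectTableau r c} {f : SUW k l p q} :
    f ∈ polyIdeal k l p q t ↔ f ∈ TwoSidedIdeal.span (semistandardPolys k l p q t) := by
  rw [polyIdeal, Submodule.restrictScalars_mem, TwoSidedIdeal.mem_asIdeal]

theorem P_mem_polyIdeal {r c : ℕ} (t : RectTableau r c) (I : Fin (r * c) → Idx k l)
    (J : Fin (r * c) → Idx p q) : P t I J ∈ polyIdeal k l p q t := by
  refine Submodule.span_le.2 ?_ (P_mem_span t I J)
  exact fun f hf => mem_polyIdeal.2 (TwoSidedIdeal.subset_span hf)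

/-- A left factor only replaces a hook sum by a conjugate one, to which `hξ` applies equally. For
the rectangle, the left factor permutes `I`, the right factor permutes `J`, and what remains is some
`P t` on the first block times the monomial of the other positions. -/
theorem relationSum_mem_of_hookGenerators (t : RectTableau (n + 1) (m + 1))
    (ξ : (Fin d → Idx k l) → (Fin d → Idx p q) → ℂ)
    (hξ : ∀ I J (K : Fin d → Idx n m), signedAct (fun I => ξ I J) I (hookSum K) = 0)
    {e : PermAlg d} (he : e ∈ hookGenerators d t) (x g : Equiv.Perm (Fin d)) :
    relationSum ξ (el x * (e * el g)) ∈ polyIdeal k l p q t := by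
  rcases he with ⟨K, rfl⟩ | ⟨h, rfl⟩
  · have h1 := hookSum_mul_el (K ∘ ⇑x⁻¹) x
    have h2 : (K ∘ ⇑x⁻¹) ∘ ⇑x = K := by
      funext
      simp
    rw [h2] at h1
    rw [← mul_assoc, ← h1, mul_assoc, ← map_mul, relationSum_el_mul_hookSum ξ hξ]
    exact Submodule.zero_mem _
  · obtain ⟨M, rfl⟩ := Nat.exists_eq_add_of_le h
    rw [relationSum_apply]
    refine Submodule.sum_mem _ fun I _ => Submodule.sum_mem _ fun J _ => Submodule.smul_mem _ _ ?_
    rw [signedAct_el_mul, signedAct_Z_mul_el]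
    refine Submodule.smul_mem _ _ (Submodule.smul_mem _ _ ?_)
    obtain ⟨s, hs⟩ := exists_signedAct_rectSum t h (I ∘ x) (J ∘ ⇑g⁻¹)
    rw [hs]
    refine Submodule.smul_mem _ _ (mem_polyIdeal.2 (TwoSidedIdeal.mul_mem_right _ _ _ ?_))
    exact mem_polyIdeal.1 (P_mem_polyIdeal t _ _)

theorem relationSum_mem (t : RectTableau (n + 1) (m + 1))
    (ξ : (Fin d → Idx k l) → (Fin d → Idx p q) → ℂ)
    (hξ : ∀ I J (K : Fin d → Idx n m), signedAct (fun I => ξ I J) I (hookSum K) = 0)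
    (w : PermAlg d) : relationSum ξ w ∈ polyIdeal k l p q t := by
  have hw : w ∈ Ideal.span {x : PermAlg d | ∃ e ∈ hookGenerators d t, ∃ g, x = e * el g} := by
    rw [span_hookGenerators]
    trivial
  suffices h : ∀ b, relationSum ξ (b * w) ∈ polyIdeal k l p q t by simpa using h 1
  refine Submodule.span_induction ?_ ?_ ?_ ?_ hw
  · rintro _ ⟨e, he, g, rfl⟩ b
    induction b using MonoidAlgebra.induction_linear with
    | zero => simp
    | add u v hu hv =>
      rw [add_mul, map_add]
      exact Submodule.add_mem _ hu hv
    | single x c =>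
      have hx : MonoidAlgebra.single x c = c • el x := by simp
      rw [hx, smul_mul_assoc, map_smul]
      exact Submodule.smul_mem _ _ (relationSum_mem_of_hookGenerators t ξ hξ he x g)
  · simp
  · intro u v _ _ hu hv b
    rw [mul_add, map_add]
    exact Submodule.add_mem _ (hu b) (hv b)
  · intro c u _ hu b
    rw [smul_eq_mul, ← mul_assoc]
    exact hu _

/-- The left side is `relationSum ξ 1`; this is where the hook theorem is applied. -/
theorem sum_smul_Z_mem (t : RectTableau (n + 1) (m + 1))
    (ξ : (Fin d → Idx k l) → (Fin d → Idx p q) → ℂ)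
    (hξ : ∀ I J (K : Fin d → Idx n m), signedAct (fun I => ξ I J) I (hookSum K) = 0) :
    ∑ I, ∑ J, ξ I J • Z I J ∈ polyIdeal k l p q t := by
  have h := relationSum_mem t ξ hξ 1
  rw [← map_one el, relationSum_apply] at h
  simpa only [signedAct_el, koszul_one, one_smul, Equiv.Perm.coe_one, Function.comp_id] using h

end

end SuperInv

namespace SuperInv

open Classical in
section

/-! ### The coefficients of a relation -/

variable {N M d k l p q n m : ℕ}

theorem coeffFun_xMon_mul_xStarMon (I I' : Fin d → Idx k l) (L K : Fin d → Idx n m)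
    (J J' : Fin d → Idx p q) :
    SuperSym.coeffFun (aPar n m k l p q)
        (Fin.append (fun α => Sum.inl (I' α, K α)) fun α => Sum.inr (K α, J' α))
        (xMon I L * xStarMon L J) =
      SuperSym.coeffFun (aPar n m k l p q) (fun α => Sum.inl (I' α, K α)) (xMon I L) *
        SuperSym.coeffFun (aPar n m k l p q) (fun α => Sum.inr (K α, J' α)) (xStarMon L J) := by
  rw [xMon, xStarMon, smul_mul_smul_comm, map_smul, map_smul, map_smul,
    SuperSym.coeffFun_append (fun x => x.isLeft) _ _ _ _ (fun _ => rfl) (fun _ => by simp),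
    smul_eq_mul, smul_eq_mul, smul_eq_mul]
  ring

/-- The permutations `σ` and `τ` match the `x` factors and the `x*` factors separately. Both
determine the intermediate sequence, as `K ∘ σ` and as `K ∘ τ`, so the sum over it collapses to the
condition that these agree. -/
theorem coeffFun_prodHom_Z (I I' : Fin d → Idx k l) (K : Fin d → Idx n m)
    (J J' : Fin d → Idx p q) :
    SuperSym.coeffFun (aPar n m k l p q)
        (Fin.append (fun α => Sum.inl (I' α, K α)) fun α => Sum.inr (K α, J' α))
        (prodHom n m k l p q (Z I J)) =
      interSign (pars K) (pars K) * interSign (pars I') (pars K) * interSign (pars K) (pars J') *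
        ∑ σ : Equiv.Perm (Fin d), ∑ τ : Equiv.Perm (Fin d),
          if K ∘ σ = K ∘ τ ∧ I = I' ∘ σ ∧ J = J' ∘ τ then
            koszul (pars I') σ * koszul (pars K) σ * (koszul (pars K) τ * koszul (pars J') τ)
          else 0 := by
  rw [prodHom_Z, map_sum]
  simp only [map_smul, coeffFun_xMon_mul_xStarMon, coeffFun_xMon, coeffFun_xStarMon]
  have h : ∀ L : Fin d → Idx n m, interSign (pars L) (pars L) •
      ((interSign (pars I') (pars K) * ∑ σ : Equiv.Perm (Fin d),
        if I = I' ∘ σ ∧ L = K ∘ σ then koszul (pars I') σ * koszul (pars K) σ else 0) *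
      (interSign (pars K) (pars J') * ∑ σ : Equiv.Perm (Fin d),
        if L = K ∘ σ ∧ J = J' ∘ σ then koszul (pars K) σ * koszul (pars J') σ else 0)) =
      ∑ σ : Equiv.Perm (Fin d), ∑ τ : Equiv.Perm (Fin d),
        interSign (pars K) (pars K) * interSign (pars I') (pars K) * interSign (pars K) (pars J') *
        if L = K ∘ σ ∧ K ∘ σ = K ∘ τ ∧ I = I' ∘ σ ∧ J = J' ∘ τ then
          koszul (pars I') σ * koszul (pars K) σ * (koszul (pars K) τ * koszul (pars J') τ)
        else 0 := by
    intro L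
    rw [mul_mul_mul_comm, Finset.sum_mul_sum, smul_eq_mul, ← mul_assoc, Finset.mul_sum]
    refine Finset.sum_congr rfl fun σ _ => ?_
    rw [Finset.mul_sum]
    refine Finset.sum_congr rfl fun τ _ => ?_
    by_cases h1 : L = K ∘ σ
    · subst h1
      rw [pars_comp, interSign_self_comp]
      by_cases h2 : I = I' ∘ σ <;> by_cases h3 : K ∘ ⇑σ = K ∘ ⇑τ <;> by_cases h4 : J = J' ∘ τ <;>
        simp [h2, h3, h4, mul_assoc]
    · simp [h1]
  rw [Finset.sum_congr rfl fun L _ => h L, Finset.sum_comm, Finset.mul_sum]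
  refine Finset.sum_congr rfl fun σ _ => ?_
  rw [Finset.sum_comm, Finset.mul_sum]
  refine Finset.sum_congr rfl fun τ _ => ?_
  rw [← Finset.mul_sum, Finset.sum_eq_single (K ∘ σ)]
  · simp
  · intro L _ hL
    simp [hL]
  · simp

theorem coeffFun_prodHom_Z_of_ne (h : N ≠ M) (I : Fin N → Idx k l) (J : Fin N → Idx p q)
    (y : Fin (M + M) → (Idx k l × Idx n m) ⊕ (Idx n m × Idx p q)) :
    SuperSym.coeffFun (aPar n m k l p q) y (prodHom n m k l p q (Z I J)) = 0 := by
  rw [prodHom_Z, map_sum]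
  refine Finset.sum_eq_zero fun K _ => ?_
  rw [xMon, xStarMon, smul_mul_smul_comm, map_smul, map_smul, ← SuperSym.mon_append,
    SuperSym.coeffFun_mon_of_ne (by omega), smul_zero, smul_zero]

theorem exists_eq_sum_Z (f : SUW k l p q) : ∃ (D : Finset ℕ)
    (ξ : ∀ d, (Fin d → Idx k l) → (Fin d → Idx p q) → ℂ),
    f = ∑ d ∈ D, ∑ I, ∑ J, ξ d I J • Z I J := by
  obtain ⟨c, rfl⟩ := Finsupp.mem_span_range_iff_exists_finsupp.1 (SuperSym.mem_span_mon f)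
  refine ⟨c.support.image Sigma.fst,
    fun d I J => c ⟨d, fun α => (I α, J α)⟩ * interSign (pars I) (pars J), ?_⟩
  have h : c.support ⊆ (c.support.image Sigma.fst).sigma fun _ => Finset.univ := by
    intro s hs
    rw [Finset.mem_sigma]
    exact ⟨Finset.mem_image_of_mem _ hs, Finset.mem_univ _⟩
  rw [Finsupp.sum, Finset.sum_subset h fun s _ hs => by
    rw [Finsupp.notMem_support_iff.1 hs, zero_smul], Finset.sum_sigma]
  refine Finset.sum_congr rfl fun d _ => ?_
  rw [← Equiv.sum_comp (Equiv.arrowProdEquivProdArrow (Fin d) (fun _ => Idx k l)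
    (fun _ => Idx p q)).symm, Fintype.sum_prod_type]
  refine Finset.sum_congr rfl fun I _ => Finset.sum_congr rfl fun J _ => ?_
  rw [Z_eq, smul_smul, mul_assoc, interSign_mul_self, mul_one]
  rfl

/-- The coefficients of a relation, averaged over simultaneous permutations. -/
noncomputable def avgCoeff (ξ : (Fin d → Idx k l) → (Fin d → Idx p q) → ℂ)
    (I : Fin d → Idx k l) (J : Fin d → Idx p q) : ℂ :=
  ∑ τ : Equiv.Perm (Fin d), koszul (pars I) τ * koszul (pars J) τ * ξ (I ∘ τ) (J ∘ τ)

theorem sum_avgCoeff_smul_Z (ξ : (Fin d → Idx k l) → (Fin d → Idx p q) → ℂ) :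
    ∑ I, ∑ J, avgCoeff ξ I J • Z I J =
      (Fintype.card (Equiv.Perm (Fin d)) : ℂ) • ∑ I, ∑ J, ξ I J • Z I J := by
  have h : ∀ τ : Equiv.Perm (Fin d), ∑ I : Fin d → Idx k l, ∑ J : Fin d → Idx p q,
      (koszul (pars I) τ * koszul (pars J) τ * ξ (I ∘ τ) (J ∘ τ)) • Z I J =
      ∑ I, ∑ J, ξ I J • Z I J := by
    intro τ
    symm
    rw [← sum_comp_perm τ]
    refine Finset.sum_congr rfl fun I _ => ?_
    rw [← sum_comp_perm τ]
    refine Finset.sum_congr rfl fun J _ => ?_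
    rw [Z_comp_perm, smul_smul, mul_comm]
  rw [Nat.cast_smul_eq_nsmul, ← Finset.card_univ, ← Finset.sum_const,
    ← Finset.sum_congr rfl fun τ _ => h τ]
  symm
  rw [Finset.sum_comm]
  refine Finset.sum_congr rfl fun I _ => ?_
  rw [Finset.sum_comm]
  refine Finset.sum_congr rfl fun J _ => ?_
  rw [avgCoeff, Finset.sum_smul]

/-- Substituting `σ = π * τ` turns `K ∘ σ = K ∘ τ` into `π ∈ stab K`, and the sign of `τ` on `K`
occurs twice. The double sum is thus the one in `coeffFun_prodHom_Z`, so averaged coefficients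
translate a vanishing coefficient in `A` into annihilation by `hookSum K`. -/
theorem signedAct_avgCoeff_hookSum (ξ : (Fin d → Idx k l) → (Fin d → Idx p q) → ℂ)
    (I : Fin d → Idx k l) (J : Fin d → Idx p q) (K : Fin d → Idx n m) :
    signedAct (fun I => avgCoeff ξ I J) I (hookSum K) =
      ∑ σ : Equiv.Perm (Fin d), ∑ τ : Equiv.Perm (Fin d),
        if K ∘ σ = K ∘ τ then koszul (pars I) σ * koszul (pars K) σ *
          (koszul (pars K) τ * koszul (pars J) τ) * ξ (I ∘ σ) (J ∘ τ) else 0 := by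
  rw [Finset.sum_comm]
  have h : ∀ τ : Equiv.Perm (Fin d), (∑ σ : Equiv.Perm (Fin d),
      if K ∘ σ = K ∘ τ then koszul (pars I) σ * koszul (pars K) σ *
          (koszul (pars K) τ * koszul (pars J) τ) * ξ (I ∘ σ) (J ∘ τ) else 0) =
      ∑ π ∈ stab K, koszul (pars K) π * (koszul (pars I) π *
        (koszul (pars (I ∘ π)) τ * koszul (pars J) τ * ξ ((I ∘ π) ∘ τ) (J ∘ τ))) := by
    intro τ
    rw [sum_eq_sum_mul_right τ, stab, Finset.sum_filter]
    refine Finset.sum_congr rfl fun π _ => ?_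
    have hiff : K ∘ ⇑(π * τ) = K ∘ ⇑τ ↔ K ∘ ⇑π = K := by
      rw [Equiv.Perm.coe_mul, ← Function.comp_assoc]
      exact τ.surjective.right_cancellable
    by_cases hπ : K ∘ ⇑π = K
    · rw [if_pos hπ, if_pos (hiff.2 hπ), koszul_mul, koszul_mul, ← pars_comp, ← pars_comp, hπ,
        Equiv.Perm.coe_mul, ← Function.comp_assoc]
      linear_combination (koszul (pars I) π * koszul (pars (I ∘ π)) τ * koszul (pars K) π *
        koszul (pars J) τ * ξ ((I ∘ π) ∘ τ) (J ∘ τ)) * koszul_mul_self (pars K) τ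
    · rw [if_neg hπ, if_neg (mt hiff.1 hπ)]
  rw [Finset.sum_congr rfl fun τ _ => h τ, Finset.sum_comm, hookSum, map_sum]
  refine Finset.sum_congr rfl fun π _ => ?_
  rw [map_smul, signedAct_el, avgCoeff, smul_eq_mul, smul_eq_mul, Finset.mul_sum, Finset.mul_sum]

theorem signedAct_avgCoeff_hookSum_eq_zero {D : Finset ℕ}
    {ξ : ∀ d, (Fin d → Idx k l) → (Fin d → Idx p q) → ℂ}
    (h : prodHom n m k l p q (∑ d ∈ D, ∑ I, ∑ J, ξ d I J • Z I J) = 0) (hd : d ∈ D)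
    (I : Fin d → Idx k l) (J : Fin d → Idx p q) (K : Fin d → Idx n m) :
    signedAct (fun I => avgCoeff (ξ d) I J) I (hookSum K) = 0 := by
  have h1 := congrArg (SuperSym.coeffFun (aPar n m k l p q)
    (Fin.append (fun α => Sum.inl (I α, K α)) fun α => Sum.inr (K α, J α))) h
  simp only [map_sum, map_smul, map_zero] at h1
  -- The chosen monomial has degree `2 * d`, so only the component of degree `d` contributes.
  rw [Finset.sum_eq_single d] at h1
  · simp only [coeffFun_prodHom_Z, smul_eq_mul] at h1
    have hc : interSign (pars K) (pars K) * interSign (pars I) (pars K) *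
        interSign (pars K) (pars J) ≠ 0 :=
      mul_ne_zero (mul_ne_zero (left_ne_zero_of_mul_eq_one (interSign_mul_self _ _))
        (left_ne_zero_of_mul_eq_one (interSign_mul_self _ _)))
        (left_ne_zero_of_mul_eq_one (interSign_mul_self _ _))
    simp only [mul_left_comm (ξ d _ _)] at h1
    simp only [← Finset.mul_sum] at h1
    have h2 := (mul_eq_zero.1 h1).resolve_left hc
    rw [← h2, signedAct_avgCoeff_hookSum]
    simp only [Finset.mul_sum]
    symm
    calc _ = ∑ I' : Fin d → Idx k l, ∑ σ : Equiv.Perm (Fin d), ∑ J' : Fin d → Idx p q,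
          ∑ τ : Equiv.Perm (Fin d), ξ d I' J' *
            (if K ∘ ⇑σ = K ∘ ⇑τ ∧ I' = I ∘ ⇑σ ∧ J' = J ∘ ⇑τ then
              koszul (pars I) σ * koszul (pars K) σ * (koszul (pars K) τ * koszul (pars J) τ)
            else 0) := Finset.sum_congr rfl fun _ _ => Finset.sum_comm
      _ = _ := by
        rw [Finset.sum_comm]
        refine Finset.sum_congr rfl fun σ _ => ?_
        rw [Finset.sum_congr rfl fun I' _ => Finset.sum_comm, Finset.sum_comm]
        refine Finset.sum_congr rfl fun τ _ => ?_
        rw [Finset.sum_eq_single (I ∘ σ), Finset.sum_eq_single (J ∘ τ)]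
        · simp only [and_true, mul_ite, mul_zero]
          rw [mul_comm]
        · intro J' _ hJ'
          simp [hJ']
        · simp
        · intro I' _ hI'
          simp [hI']
        · simp
  · intro d' _ hne
    refine Finset.sum_eq_zero fun I' _ => Finset.sum_eq_zero fun J' _ => ?_
    rw [coeffFun_prodHom_Z_of_ne hne, smul_zero]
  · exact fun h => absurd hd h

end

end SuperInv

/-- **Second fundamental theorem for `gl(V)`.**  Let `dim V = (n | m)`, `dim U = (k | l)`,
`dim W = (p | q)` and let `t` be a standard tableau of rectangular shape with `n + 1` rows and
`m + 1` columns.  The ideal of relations between the scalar products, that is, the kernel of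
`S(U ⊗ W) → A^{gl(V)}`, is generated by the `P_t(I, J)` with `I`, `J` semistandard. -/
theorem theorem2p2 (n m k l p q : ℕ) (t : SuperInv.RectTableau (n + 1) (m + 1))
    (ht : t.IsStandard) :
    TwoSidedIdeal.ker (SuperInv.scalarProdHom n m k l p q) =
      TwoSidedIdeal.span {f : SuperInv.SUW k l p q |
        ∃ (I : Fin ((n + 1) * (m + 1)) → SuperInv.Idx k l)
          (J : Fin ((n + 1) * (m + 1)) → SuperInv.Idx p q),
          t.IsSemistandard I ∧ t.IsSemistandard J ∧ f = SuperInv.P t I J} := by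
  refine le_antisymm ?_ ?_
  · intro f hf
    rw [TwoSidedIdeal.mem_ker, SuperInv.scalarProdHom_eq_zero_iff] at hf
    obtain ⟨D, ξ, rfl⟩ := SuperInv.exists_eq_sum_Z f
    -- Each degree is handled alone. Averaging multiplies the component of degree `d` by `d!`, which
    -- is divided out at the end.
    refine SuperInv.mem_polyIdeal.1 (Submodule.sum_mem _ fun d hd => ?_)
    have h := SuperInv.sum_smul_Z_mem t (SuperInv.avgCoeff (ξ d))
      (SuperInv.signedAct_avgCoeff_hookSum_eq_zero hf hd)
    rw [SuperInv.sum_avgCoeff_smul_Z] at h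
    exact (Submodule.smul_mem_iff _ (Nat.cast_ne_zero.2 Fintype.card_ne_zero)).1 h
  · rw [TwoSidedIdeal.span_le]
    rintro _ ⟨I, J, -, -, rfl⟩
    rw [SetLike.mem_coe, TwoSidedIdeal.mem_ker, SuperInv.scalarProdHom_eq_zero_iff]
    exact SuperInv.prodHom_P t I J
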